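/- Let $d\ge 1$ and $\alpha>0$. Setting. For $\phi\in\mathcal S(\mathbb R^d)$, $x\in\mathbb R^d$ and $\xi\in\mathbb R^d\setminus\{0\}$ put $$\phi_{x,\xi}(t)=|\xi|^{\frac d2(1-\alpha)}\,\phi\big((t-x)|\xi|^{1-\alpha}\big)\,e^{it\cdot\xi}.$$ A family $\Omega=\{(x_j^k,\xi_k):k\in\mathbb N,\ j\in\mathbb Z^d\}$ with $x_j^k\in\mathbb R^d$, $\xi_k\in\mathbb R^d\setminus\{0\}$ is called admissible if only finitely many $k$ satisfy $|\xi_k|\le 2$ and if, for some $\rho>0$, the blocks $$\{(y,\eta):|y-x_j^k|\le\rho|\xi_k|^{\alpha-1},\ |\eta-\xi_k|\le\rho|\xi_k|^{1-\alpha}\}$$ cover $\{(x,\xi):|\xi|^\alpha\ge1\}$ and every point of $\mathbb R^{2d}$ lies in at most $N$ of them (counted by their indices $(j,k)$), for some finite $N$. Let $\phi\in\mathcal S(\mathbb R^d)$ and an admissible $\Omega$ be such that $\widehat\phi$ is supported in an annulus $\{c_1\le|\xi|\le c_2\}$, $0<c_1<c_2<\infty$, and that $\{\phi_{x_j^k,\xi_k}\}_{j,k}$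 is a frame of $L^2(\mathbb R^d)$. For $\beta\in\mathbb R$ let $M^{2,2}_{\alpha,\beta}$ be the set of $f\in\mathcal S'(\mathbb R^d)$ with $$\|f\|_{M^{2,2}_{\alpha,\beta}}=\Big(\sum_k\sum_{j\in\mathbb Z^d}|\langle f,\phi_{x_j^k,\xi_k}\rangle|^2(1+|\xi_k|)^{2\beta}\Big)^{1/2}<\infty ,$$ the pairing being antilinear in the second argument. A function $m:\mathbb R^d\setminus\{0\}\to\mathbb C$ satisfies the two-sided Miyachi condition with parameters $(\alpha,\beta_0)$ at infinity and $(a,b)\in\mathbb R^2$ near the origin if there is $\sigma>d/2$ such that $m$ is of class $C^{\lfloor\sigma\rfloor}$ and there is a constant $C$ with, for all multi-indices $|\gamma|\le\lfloor\sigma\rfloor$, $$|D^\gamma m(\xi)|\le C|\xi|^{-\beta_0+(\alpha-1)|\gamma|}\ \ (|\xi|\ge1),\qquad |D^\gamma m(\xi)|\le C|\xi|^{-b+(a-1)|\gamma|}\ \ (0<|\xi|<1).$$ The operator $T_m$ is defined by $\widehat{T_mf}=m\widehat f$, with $\widehat f(\xi)=\int f(t)e^{-it\cdot\xi}\,dt$,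 for those $f\in\mathcal S'(\mathbb R^d)$ for which $\widehat f$ and $m\widehat f$ are tempered distributions given by functions (whose product with every Schwartz function is integrable). Theorem. Suppose that $m$ satisfies the two-sided Miyachi condition with parameters $(\alpha,\beta_0)$ at infinity and some parameters $(a,b)$ near the origin, and that $m$ is bounded on $\{0<|\xi|<1\}$. Then for every $\beta\in\mathbb R$ the operator $T_m$ is well defined on $M^{2,2}_{\alpha,\beta-\beta_0}$, and there is a constant $C<\infty$ such that $$\|T_mf\|_{M^{2,2}_{\alpha,\beta}}\le C\,\|f\|_{M^{2,2}_{\alpha,\beta-\beta_0}}\qquad\text{for all } f\in M^{2,2}_{\alpha,\beta-\beta_0}.$$ In particular, if $\beta_0=0$, then $T_m$ is bounded on $M^{2,2}_{\alpha,\beta}$ for every $\beta\in\mathbb R$. The symbol $m(\xi)=e^{i|\xi|^\alpha}$ satisfies these hypotheses with $\beta_0=0$, so that its $T_m$ is bounded on $M^{2,2}_{\alpha,\beta}$ for every $\beta\in\mathbb R$. -/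

import Mathlib

open MeasureTheory FourierTransform
open scoped SchwartzMap ENNReal NNReal

noncomputable section

namespace Subdyadic

/-- The Euclidean space of dimension `d`. -/
abbrev E (d : ℕ) : Type := EuclideanSpace ℝ (Fin d)

variable {d : ℕ}

/-! ### Wave packets -/

/-- The plane wave `t ↦ e^{i t · ξ}`. -/
def planeWave (ξ : E d) (t : E d) : ℂ := Complex.exp ((inner ℝ t ξ : ℝ) * Complex.I)

theorem hasTemperateGrowth_cexp_mul_I :
    (fun s : ℝ => Complex.exp ((s : ℂ) * Complex.I)).HasTemperateGrowth := by
  refine ⟨(Complex.ofRealCLM.contDiff.mul contDiff_const).cexp, fun n => ⟨0, 1, fun s => ?_⟩⟩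
  have hn : ∀ n : ℕ, iteratedDeriv n (fun s : ℝ => Complex.exp ((s : ℂ) * Complex.I))
      = fun s : ℝ => Complex.I ^ n * Complex.exp ((s : ℂ) * Complex.I) := by
    intro n
    induction n with
    | zero => simp
    | succ n ih =>
      rw [iteratedDeriv_succ, ih]
      funext s
      have h1 : HasDerivAt (fun s : ℝ => (s : ℂ) * Complex.I) (1 * Complex.I) s :=
        (Complex.ofRealCLM.hasDerivAt (x := s)).mul_const Complex.I
      have h2 := (h1.cexp).const_mul (Complex.I ^ n)
      rw [h2.deriv]
      ring
  rw [norm_iteratedFDeriv_eq_norm_iteratedDeriv, hn]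
  simp [Complex.norm_exp_ofReal_mul_I]

theorem hasTemperateGrowth_planeWave (ξ : E d) : (planeWave ξ).HasTemperateGrowth := by
  have h := hasTemperateGrowth_cexp_mul_I.comp
    (Function.hasTemperateGrowth_inner_left (H := E d) ξ)
  exact h

/-- The dilation by a nonzero factor, as a continuous linear equivalence. -/
def dilation (r : ℝ) (hr : r ≠ 0) : E d ≃L[ℝ] E d :=
  ContinuousLinearEquiv.smulLeft (Units.mk0 r hr)

theorem scale_ne_zero (α : ℝ) {ξ : E d} (hξ : ξ ≠ 0) : ‖ξ‖ ^ (1 - α) ≠ 0 :=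
  (Real.rpow_pos_of_pos (norm_pos_iff.mpr hξ) _).ne'

/-- The dispersive wave packet
`φ_{x,ξ}(t) = |ξ|^{(d/2)(1-α)} φ((t - x)|ξ|^{1-α}) e^{i t · ξ}` with `ξ ≠ 0`,
as a Schwartz function of `t`; see `packet_apply` for the formula. -/
def packet (α : ℝ) (φ : 𝓢(E d, ℂ)) (x ξ : E d) (hξ : ξ ≠ 0) : 𝓢(E d, ℂ) :=
  ((‖ξ‖ ^ ((d : ℝ) / 2 * (1 - α)) : ℝ) : ℂ) •
    SchwartzMap.smulLeftCLM ℂ (planeWave ξ)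
      (SchwartzMap.compSubConstCLM ℂ x
        (SchwartzMap.compCLMOfContinuousLinearEquiv ℂ
          (dilation (‖ξ‖ ^ (1 - α)) (scale_ne_zero α hξ)) φ))

theorem packet_apply (α : ℝ) (φ : 𝓢(E d, ℂ)) (x ξ : E d) (hξ : ξ ≠ 0) (t : E d) :
    packet α φ x ξ hξ t =
      ((‖ξ‖ ^ ((d : ℝ) / 2 * (1 - α)) : ℝ) : ℂ) *
        (φ ((‖ξ‖ ^ (1 - α)) • (t - x)) * Complex.exp ((inner ℝ t ξ : ℝ) * Complex.I)) := by
  simp only [packet, _root_.smul_apply, smul_eq_mul,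
    SchwartzMap.smulLeftCLM_apply_apply (hasTemperateGrowth_planeWave ξ),
    SchwartzMap.compSubConstCLM_apply, SchwartzMap.compCLMOfContinuousLinearEquiv_apply,
    Function.comp_apply, planeWave]
  rw [mul_comm (Complex.exp _)]
  rfl

/-- The complex conjugate of a Schwartz function. -/
def conjSchwartz (ψ : 𝓢(E d, ℂ)) : 𝓢(E d, ℂ) :=
  SchwartzMap.postcompCLM (𝕜 := ℝ) (Complex.conjCLE : ℂ →L[ℝ] ℂ) ψ

theorem conjSchwartz_apply (ψ : 𝓢(E d, ℂ)) (t : E d) :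
    conjSchwartz ψ t = (starRingEnd ℂ) (ψ t) := rfl

/-! ### Subdyadic lattices -/

/-- The block `Q_α(x, ξ; ρ) = {(y,η) : |y-x| ≤ ρ|ξ|^{α-1}, |η-ξ| ≤ ρ|ξ|^{1-α}}`. -/
def block (α ρ : ℝ) (x ξ : E d) : Set (E d × E d) :=
  {z | ‖z.1 - x‖ ≤ ρ * ‖ξ‖ ^ (α - 1) ∧ ‖z.2 - ξ‖ ≤ ρ * ‖ξ‖ ^ (1 - α)}

variable (d) in
/-- A family of phase space points `(x_j^k, ξ_k)`, `k ∈ ℕ`, `j ∈ ℤ^d`, with `ξ_k ≠ 0`. -/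
structure PhaseLattice where
  /-- The frequency centres `ξ_k`. -/
  freq : ℕ → E d
  /-- The spatial centres `x_j^k`, written `pos k j`. -/
  pos : ℕ → (Fin d → ℤ) → E d
  freq_ne_zero : ∀ k, freq k ≠ 0

/-- The lattice is adapted to the subdyadic geometry: only finitely many frequency centres are low,
and, for some fixed size `ρ`, the blocks around the lattice points cover `{|ξ|^α ≥ 1}` and have
uniformly finite overlap. -/
def IsAdmissibleLattice (α : ℝ) (Ω : PhaseLattice d) : Prop :=
  {k : ℕ | ‖Ω.freq k‖ ≤ 2}.Finite ∧
  ∃ ρ : ℝ, 0 < ρ ∧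
    (∀ z : E d × E d, 1 ≤ ‖z.2‖ ^ α → ∃ k j, z ∈ block α ρ (Ω.pos k j) (Ω.freq k)) ∧
    ∃ N : ℕ, ∀ z : E d × E d,
      {p : ℕ × (Fin d → ℤ) | z ∈ block α ρ (Ω.pos p.1 p.2) (Ω.freq p.1)}.encard ≤ N

/-- The packet `φ_{x_j^k, ξ_k}` at a lattice point. -/
def latticePacket (α : ℝ) (φ : 𝓢(E d, ℂ)) (Ω : PhaseLattice d) (k : ℕ) (j : Fin d → ℤ) :
    𝓢(E d, ℂ) :=
  packet α φ (Ω.pos k j) (Ω.freq k) (Ω.freq_ne_zero k)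

/-- The packets over the lattice form a frame of `L²(ℝ^d)`. -/
def IsGaborFrame (α : ℝ) (φ : 𝓢(E d, ℂ)) (Ω : PhaseLattice d) : Prop :=
  ∃ A B : ℝ≥0, 0 < A ∧ ∀ f : Lp ℂ 2 (volume : Measure (E d)),
    A * ‖f‖ₑ ^ 2 ≤ ∑' (k : ℕ) (j : Fin d → ℤ),
        ‖inner ℂ ((latticePacket α φ Ω k j).toLp 2) f‖ₑ ^ 2 ∧
    ∑' (k : ℕ) (j : Fin d → ℤ),
        ‖inner ℂ ((latticePacket α φ Ω k j).toLp 2) f‖ₑ ^ 2 ≤ B * ‖f‖ₑ ^ 2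

/-- A window and a lattice that are `α`-admissible together. The localization of the packets in
the blocks is automatic for a Schwartz window whose Fourier transform lives in an annulus; the
normalization of the Fourier transform plays no role, since the radii are arbitrary. -/
structure IsAdmissiblePair (α : ℝ) (φ : 𝓢(E d, ℂ)) (Ω : PhaseLattice d) : Prop where
  annulus : ∃ c₁ c₂ : ℝ, 0 < c₁ ∧ c₁ < c₂ ∧
    Function.support (𝓕 φ : 𝓢(E d, ℂ)) ⊆ {ξ | c₁ ≤ ‖ξ‖ ∧ ‖ξ‖ ≤ c₂}
  lattice : IsAdmissibleLattice α Ω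
  frame : IsGaborFrame α φ Ω

/-! ### The dispersive modulation spaces `M^{2,2}_{α,β}` -/

/-- The Gabor coefficient `c_{j,k}(f) = ⟨f, φ_{x_j^k, ξ_k}⟩` of a tempered distribution; the pairing
is antilinear in the packet. -/
def coeff (α : ℝ) (φ : 𝓢(E d, ℂ)) (Ω : PhaseLattice d) (f : 𝓢'(E d, ℂ))
    (k : ℕ) (j : Fin d → ℤ) : ℂ :=
  f (conjSchwartz (latticePacket α φ Ω k j))

/-- The radial weight `w_β(ξ) = (1 + |ξ|)^β`. -/
def weight (β : ℝ) (ξ : E d) : ℝ := (1 + ‖ξ‖) ^ β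

/-- The norm `(∑_k (∑_j |c_{j,k}(f)|²) w_β(ξ_k)²)^{1/2}` of `M^{2,2}_{α,β}`, with values
in `[0, ∞]`. -/
def modNorm (α : ℝ) (φ : 𝓢(E d, ℂ)) (Ω : PhaseLattice d) (β : ℝ) (f : 𝓢'(E d, ℂ)) : ℝ≥0∞ :=
  (∑' k : ℕ, (∑' j : Fin d → ℤ, ‖coeff α φ Ω f k j‖ₑ ^ 2) *
    ENNReal.ofReal (weight β (Ω.freq k)) ^ 2) ^ (1 / 2 : ℝ)

/-- The space `M^{2,2}_{α,β}`, as a set of tempered distributions. -/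
def modSpace (α : ℝ) (φ : 𝓢(E d, ℂ)) (Ω : PhaseLattice d) (β : ℝ) : Set 𝓢'(E d, ℂ) :=
  {f | modNorm α φ Ω β f < ∞}

/-! ### Multipliers -/

/-- The partial derivative `∂_{i_1} ⋯ ∂_{i_n} m (ξ)`. As `i` varies these are the derivatives
`D^γ m (ξ)` with `|γ| = n`. -/
def partialDeriv (m : E d → ℂ) {n : ℕ} (i : Fin n → Fin d) (ξ : E d) : ℂ :=
  iteratedFDeriv ℝ n m ξ (fun l => EuclideanSpace.single (i l) (1 : ℝ))

/-- The two-sided Miyachi condition for `m : ℝ^d ∖ {0} → ℂ` (the value at `0` is irrelevant), with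
parameters `(α, β)` at infinity and `(α₀, β₀)` near the origin. -/
def TwoSidedMiyachi (α β α₀ β₀ : ℝ) (m : E d → ℂ) : Prop :=
  ∃ σ : ℝ, (d : ℝ) / 2 < σ ∧
    ContDiffOn ℝ (⌊σ⌋₊ : ℕ) m {0}ᶜ ∧
    ∃ C : ℝ, ∀ n : ℕ, n ≤ ⌊σ⌋₊ → ∀ (i : Fin n → Fin d) (ξ : E d),
      (1 ≤ ‖ξ‖ → ‖partialDeriv m i ξ‖ ≤ C * ‖ξ‖ ^ (-β + (α - 1) * n)) ∧
      (0 < ‖ξ‖ → ‖ξ‖ < 1 → ‖partialDeriv m i ξ‖ ≤ C * ‖ξ‖ ^ (-β₀ + (α₀ - 1) * n))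

/-- `m` is bounded near the origin. -/
def BoundedNearOrigin (m : E d → ℂ) : Prop :=
  ∃ K : ℝ, ∀ ξ : E d, 0 < ‖ξ‖ → ‖ξ‖ < 1 → ‖m ξ‖ ≤ K

/-- The tempered distribution `u` is the (absolutely convergent) integral against the
function `g`. -/
def RepresentedBy (u : 𝓢'(E d, ℂ)) (g : E d → ℂ) : Prop :=
  ∀ ψ : 𝓢(E d, ℂ), Integrable (fun ζ => g ζ * ψ ζ) ∧ u ψ = ∫ ζ, g ζ * ψ ζ

/-- `u = T_m f`, that is `û = m f̂`, where `f̂` and `m f̂` are tempered distributions given by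
functions. Here `f̂(ξ) = ∫ f(t) e^{-i t·ξ} dt`, which is Mathlib's `𝓕 f` at `ζ = ξ / 2π`, so that the
symbol is evaluated at `ξ = 2π ζ`. -/
def IsMultiplierImage (m : E d → ℂ) (f u : 𝓢'(E d, ℂ)) : Prop :=
  ∃ g : E d → ℂ, RepresentedBy (𝓕 f) g ∧
    RepresentedBy (𝓕 u) (fun ζ => m ((2 * Real.pi) • ζ) * g ζ)

/-- `T_m` is well defined on `M^{2,2}_{α,β'}` and bounded from there to `M^{2,2}_{α,β}`. -/
def MultiplierBounded (α : ℝ) (φ : 𝓢(E d, ℂ)) (Ω : PhaseLattice d) (m : E d → ℂ)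
    (β' β : ℝ) : Prop :=
  ∃ C : ℝ≥0, ∀ f ∈ modSpace α φ Ω β',
    (∃! u, IsMultiplierImage m f u) ∧
    ∀ u, IsMultiplierImage m f u → modNorm α φ Ω β u ≤ C * modNorm α φ Ω β' f

/-- The oscillatory symbol `e^{i|ξ|^α}`. -/
def oscillatorySymbol (α : ℝ) (ξ : E d) : ℂ :=
  Complex.exp (((‖ξ‖ ^ α : ℝ) : ℂ) * Complex.I)

end Subdyadic

end

open Subdyadic

open MeasureTheory FourierTransform
open scoped SchwartzMap ENNReal NNReal

noncomputable section

namespace Subdyadic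

variable {d : ℕ}

section

/-! ### Geometry of admissible lattices -/

/-! On a weighted `L²` space over frequency, a Fourier multiplier acts by pointwise multiplication,
so `|m(ξ)| ≤ C (1 + |ξ|)^{-β₀}` suffices for the bound. The theorem therefore reduces to identifying
`M^{2,2}_{α,β}`, up to equivalence of norms, with the distributions whose Fourier transform is a
function `F` with `(1 + |ξ|)^β F ∈ L²`. The two inclusions are `exists_modNorm_le` and
`exists_representedBy`.

The first needs only a Bessel bound. Packets whose frequency supports meet have comparable scales,
their inner products decay in the scaled distance of their positions, and bounded overlap of blocks
of equal volume limits the number of close positions; Schur's test concludes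
(`exists_synthesisBound`). Weights enter as powers of `(R² + |ζ|²)^{1/2}`. Since `α > 0`, the width
`|ξ|^{1-α}` is at most `δ(|ξ| + R)` once `R` is large, for any fixed `δ > 0`, so for large `R` the
weight is nearly constant on each frequency support. `synthesisBound_exp_sub_one` shows that
replacing it by constants there is a small perturbation.

The second inclusion must come from a frame inequality known only in `L²`, while `f` is merely a
tempered distribution. Consider one step of the frame algorithm, `ψ ↦ ψ - B⁻¹ ∑_{p ∈ F} ⟨ψ, φ_p⟩
φ_p`, with `F` finite, so that Schwartz functions stay Schwartz, and chosen according to `ψ`. By the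
perturbation estimate it contracts weighted `L²` norms. The pairing of `f` with the subtracted sum
is at most a constant times `‖f‖_{M^{2,2}_{α,β}}` times the dual weighted norm of `ψ`
(`norm_frameSum_pairing_le`). Iteration gives a geometric series, provided that `f` of the remainder
tends to zero. For this the step must also contract a norm controlling `f`, hence one that sees
decay in space: `axisNorm`, built from Sobolev norms of `x_i^n ψ`. A commutator with `x_i` gains an
inverse packet scale, bounded by a power of the weight; the Sobolev orders in `axisNorm` fall with
`n` to absorb this, and small factors `κ^n` make the commutators harmless
(`exists_axisNorm_contraction`). The norm controlling `f` depends on `f`, but enters only through a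
term tending to zero, so the final constant is uniform (`le_of_contraction`). Riesz representation
then produces the function.

For `e^{i|ξ|^α}`, homogeneity bounds the derivatives of `|ξ|^α`, and the composition formula bounds
those of the exponential. -/

/-- The frequency scale `|ξ_k|^{1-α}` of the packets with index `k`. -/
def PhaseLattice.scale (Ω : PhaseLattice d) (α : ℝ) (k : ℕ) : ℝ := ‖Ω.freq k‖ ^ (1 - α)

theorem PhaseLattice.norm_freq_pos (Ω : PhaseLattice d) (k : ℕ) : 0 < ‖Ω.freq k‖ :=
  norm_pos_iff.mpr (Ω.freq_ne_zero k)

theorem PhaseLattice.scale_pos (Ω : PhaseLattice d) (α : ℝ) (k : ℕ) : 0 < Ω.scale α k :=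
  Real.rpow_pos_of_pos (Ω.norm_freq_pos k) _

theorem PhaseLattice.inv_scale (Ω : PhaseLattice d) (α : ℝ) (k : ℕ) :
    (Ω.scale α k)⁻¹ = ‖Ω.freq k‖ ^ (α - 1) := by
  rw [PhaseLattice.scale, ← Real.rpow_neg (norm_nonneg _), neg_sub]

theorem exists_norm_freq_lower_bound {Ω : PhaseLattice d} (h : {k : ℕ | ‖Ω.freq k‖ ≤ 2}.Finite) :
    ∃ μ : ℝ, 0 < μ ∧ ∀ k, μ ≤ ‖Ω.freq k‖ := by
  obtain ⟨μ, hμ, hμ'⟩ : ∃ μ : ℝ, 0 < μ ∧ ∀ k ∈ h.toFinset, μ ≤ ‖Ω.freq k‖ := by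
    induction h.toFinset using Finset.induction_on with
    | empty => exact ⟨1, one_pos, by simp⟩
    | insert k s _ ih =>
      obtain ⟨μ, hμ, hs⟩ := ih
      refine ⟨min μ ‖Ω.freq k‖, lt_min hμ (Ω.norm_freq_pos k), fun l hl => ?_⟩
      rcases Finset.mem_insert.mp hl with rfl | hl
      · exact min_le_right _ _
      · exact (min_le_left _ _).trans (hs l hl)
  refine ⟨min μ 2, lt_min hμ two_pos, fun k => ?_⟩
  by_cases hk : ‖Ω.freq k‖ ≤ 2
  · exact (min_le_left _ _).trans (hμ' k (h.mem_toFinset.mpr hk))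
  · exact (min_le_right _ _).trans (not_le.mp hk).le

/-- Away from the origin, `|ξ|^{1-α}` is small compared with `R + |ξ|` when `R` is large. -/
theorem exists_rpow_one_sub_le {α μ : ℝ} (hα : 0 < α) (hμ : 0 < μ) {δ : ℝ} (hδ : 0 < δ) :
    ∃ R₀ : ℝ, 1 ≤ R₀ ∧ ∀ t, μ ≤ t → t ^ (1 - α) ≤ δ * t + δ * R₀ := by
  -- Beyond `T` one has `t ^ (-α) ≤ δ`. On `[μ, T]` the monotone function `t ^ (1 - α)` is at most
  -- its larger endpoint value `C`, which `δ * R₀` absorbs.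
  set T : ℝ := max μ (δ ^ (-(1 / α))) with hT
  have hT0 : 0 < T := lt_of_lt_of_le hμ (le_max_left _ _)
  set C : ℝ := max (μ ^ (1 - α)) (T ^ (1 - α)) with hC
  have hC0 : 0 < C := lt_of_lt_of_le (Real.rpow_pos_of_pos hμ _) (le_max_left _ _)
  refine ⟨max 1 (C / δ), le_max_left _ _, fun t ht => ?_⟩
  have ht0 : 0 < t := hμ.trans_le ht
  have h1 : C ≤ δ * max 1 (C / δ) := by
    calc C = δ * (C / δ) := by field_simp
      _ ≤ _ := by gcongr; exact le_max_right _ _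
  by_cases htT : t ≤ T
  · have : t ^ (1 - α) ≤ C := by
      rcases le_total 0 (1 - α) with h | h
      · exact (Real.rpow_le_rpow ht0.le htT h).trans (le_max_right _ _)
      · exact (Real.rpow_le_rpow_of_nonpos hμ ht h).trans (le_max_left _ _)
    have : 0 ≤ δ * t := by positivity
    linarith
  · have h2 : t ^ (-α) ≤ δ := by
      have h3 : δ ^ (-(1 / α)) ≤ t := (le_max_right _ _).trans (not_le.mp htT).le
      have h4 := Real.rpow_le_rpow_of_nonpos (Real.rpow_pos_of_pos hδ _) h3 (neg_nonpos.mpr hα.le)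
      rw [← Real.rpow_mul hδ.le] at h4
      have : -(1 / α) * -α = 1 := by field_simp
      rwa [this, Real.rpow_one] at h4
    have h5 : t ^ (1 - α) = t ^ (-α) * t := by
      rw [show 1 - α = -α + 1 by ring, Real.rpow_add ht0, Real.rpow_one]
    rw [h5]
    have : t ^ (-α) * t ≤ δ * t := by gcongr
    linarith

/-- Packets whose frequency supports meet have comparable frequency scales. -/
theorem exists_scale_comparable {Ω : PhaseLattice d} {α μ : ℝ} (hα : 0 < α) (hμ : 0 < μ)
    (h : ∀ k, μ ≤ ‖Ω.freq k‖) {c : ℝ} (hc : 0 < c) :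
    ∃ K : ℝ, 1 ≤ K ∧ ∀ k l,
      ‖Ω.freq k - Ω.freq l‖ ≤ c * (Ω.scale α k + Ω.scale α l) →
      Ω.scale α k ≤ K * Ω.scale α l := by
  -- With this `δ`, each width `c * scale` is at most a third of `‖freq‖ + R₀`, so the larger
  -- frequency can be absorbed on the left in `key`.
  obtain ⟨R₀, hR₀, hR⟩ := exists_rpow_one_sub_le hα hμ (δ := 1 / (3 * c)) (by positivity)
  have key : ∀ k l, ‖Ω.freq k - Ω.freq l‖ ≤ c * (Ω.scale α k + Ω.scale α l) →
      ‖Ω.freq k‖ ≤ (2 + R₀ / μ) * ‖Ω.freq l‖ := by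
    intro k l hkl
    have h1 : ‖Ω.freq k‖ ≤ ‖Ω.freq k - Ω.freq l‖ + ‖Ω.freq l‖ := by
      simpa using norm_add_le (Ω.freq k - Ω.freq l) (Ω.freq l)
    have h2 : c * Ω.scale α k ≤ (‖Ω.freq k‖ + R₀) / 3 := by
      calc c * Ω.scale α k ≤ c * (1 / (3 * c) * ‖Ω.freq k‖ + 1 / (3 * c) * R₀) := by
            gcongr; exact hR _ (h k)
        _ = _ := by field_simp
    have h3 : c * Ω.scale α l ≤ (‖Ω.freq l‖ + R₀) / 3 := by
      calc c * Ω.scale α l ≤ c * (1 / (3 * c) * ‖Ω.freq l‖ + 1 / (3 * c) * R₀) := by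
            gcongr; exact hR _ (h l)
        _ = _ := by field_simp
    have h4 : R₀ ≤ R₀ / μ * ‖Ω.freq l‖ := by
      rw [div_mul_eq_mul_div, le_div_iff₀ hμ]
      gcongr; exact h l
    linarith
  set A : ℝ := 2 + R₀ / μ with hA
  have hA1 : 1 ≤ A := by have : 0 ≤ R₀ / μ := by positivity
                         linarith
  refine ⟨A ^ |1 - α|, Real.one_le_rpow hA1 (abs_nonneg _), fun k l hkl => ?_⟩
  have hk := Ω.norm_freq_pos k
  have hl := Ω.norm_freq_pos l
  unfold PhaseLattice.scale
  rcases le_total 0 (1 - α) with h0 | h0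
  · rw [abs_of_nonneg h0, ← Real.mul_rpow (by positivity) hl.le]
    exact Real.rpow_le_rpow hk.le (key k l hkl) h0
  · have h1 : ‖Ω.freq l‖ ≤ A * ‖Ω.freq k‖ := by
      apply key
      rw [norm_sub_rev, add_comm]; exact hkl
    rw [abs_of_nonpos h0]
    have h2 := Real.rpow_le_rpow_of_nonpos hl h1 h0
    rw [Real.mul_rpow (by positivity) hk.le] at h2
    calc ‖Ω.freq k‖ ^ (1 - α) = A ^ (-(1 - α)) * (A ^ (1 - α) * ‖Ω.freq k‖ ^ (1 - α)) := by
          rw [← mul_assoc, ← Real.rpow_add (by positivity)]; simp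
      _ ≤ _ := by gcongr

/-! ### Counting lattice points -/

theorem integral_one_add_scaled_norm (L r : ℝ) (hr : 0 < r) (x : E d) :
    ∫ t : E d, (1 + r * ‖t - x‖) ^ (-L) = (r ^ d)⁻¹ * ∫ t : E d, (1 + ‖t‖) ^ (-L) := by
  have h1 := integral_sub_right_eq_self (μ := (volume : Measure (E d)))
    (fun t : E d => (1 + r * ‖t‖) ^ (-L)) x
  rw [h1]
  have h2 := Measure.integral_comp_smul (volume : Measure (E d))
    (fun t : E d => (1 + ‖t‖) ^ (-L)) r
  simp only [norm_smul, Real.norm_of_nonneg hr.le, finrank_euclideanSpace_fin] at h2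
  rw [h2, abs_of_pos (by positivity), smul_eq_mul]

theorem integrable_one_add_scaled_norm {L : ℝ} (hL : (d : ℝ) < L) {r : ℝ} (hr : 0 < r) (x : E d) :
    Integrable (fun t : E d => (1 + r * ‖t - x‖) ^ (-L)) := by
  have h0 : Integrable (fun t : E d => (1 + ‖t‖) ^ (-L)) :=
    integrable_one_add_norm (by simpa using hL)
  have h1 := (h0.comp_smul hr.ne').comp_sub_right x
  simpa only [norm_smul, Real.norm_of_nonneg hr.le] using h1

theorem block_eq_prod (α ρ : ℝ) (x ξ : E d) :
    block α ρ x ξ = Metric.closedBall x (ρ * ‖ξ‖ ^ (α - 1)) ×ˢ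
      Metric.closedBall ξ (ρ * ‖ξ‖ ^ (1 - α)) := by
  ext z
  simp [block, dist_eq_norm]

theorem measurableSet_block (α ρ : ℝ) (x ξ : E d) : MeasurableSet (block α ρ x ξ) := by
  rw [block_eq_prod]
  exact Metric.isClosed_closedBall.measurableSet.prod Metric.isClosed_closedBall.measurableSet

/-- The two side lengths are reciprocal up to `ρ`, so all blocks have the same volume. This is what
turns bounded overlap into a count of lattice points. -/
theorem volume_block {α ρ : ℝ} (hρ : 0 < ρ) (x : E d) {ξ : E d} (hξ : ξ ≠ 0) :
    volume (block α ρ x ξ) =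
      ENNReal.ofReal (ρ ^ d * ρ ^ d) * (volume (Metric.ball (0 : E d) 1)) ^ 2 := by
  have h : 0 < ‖ξ‖ := norm_pos_iff.mpr hξ
  rw [block_eq_prod, Measure.volume_eq_prod, Measure.prod_prod,
    Measure.addHaar_closedBall _ _ (by positivity), Measure.addHaar_closedBall _ _ (by positivity),
    finrank_euclideanSpace_fin]
  have h1 : (ρ * ‖ξ‖ ^ (α - 1)) ^ d * (ρ * ‖ξ‖ ^ (1 - α)) ^ d = ρ ^ d * ρ ^ d := by
    rw [← mul_pow, ← mul_pow]
    congr 1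
    have : ‖ξ‖ ^ (α - 1) * ‖ξ‖ ^ (1 - α) = 1 := by
      rw [← Real.rpow_add h]; simp
    calc _ = ρ * ρ * (‖ξ‖ ^ (α - 1) * ‖ξ‖ ^ (1 - α)) := by ring
      _ = _ := by rw [this, mul_one]
  rw [← h1, ENNReal.ofReal_mul (by positivity)]
  ring

/-- Points of the lattice near a given one, weighted by their scaled distance, are summable with a
uniform bound. -/
theorem exists_sum_near_le {Ω : PhaseLattice d} {α : ℝ} {ρ : ℝ} (hρ : 0 < ρ) {N : ℕ}
    (hN : ∀ z : E d × E d,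
      {p : ℕ × (Fin d → ℤ) | z ∈ block α ρ (Ω.pos p.1 p.2) (Ω.freq p.1)}.encard ≤ N)
    {L : ℝ} (hL : (d : ℝ) < L) {c K : ℝ} (hc : 0 < c) (hK : 1 ≤ K) :
    ∃ C : ℝ, ∀ (p : ℕ × (Fin d → ℤ)) (F : Finset (ℕ × (Fin d → ℤ))),
      (∀ q ∈ F, ‖Ω.freq p.1 - Ω.freq q.1‖ ≤ c * (Ω.scale α p.1 + Ω.scale α q.1) ∧
        Ω.scale α q.1 ≤ K * Ω.scale α p.1 ∧ Ω.scale α p.1 ≤ K * Ω.scale α q.1) →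
      ∑ q ∈ F, (1 + Ω.scale α p.1 * ‖Ω.pos p.1 p.2 - Ω.pos q.1 q.2‖) ^ (-L) ≤ C := by
  have hL0 : 0 < L := lt_of_le_of_lt (Nat.cast_nonneg d) hL
  set I : ℝ := ∫ t : E d, (1 + ‖t‖) ^ (-L) with hI
  set V : ℝ := ρ ^ d * ρ ^ d * (volume (Metric.ball (0 : E d) 1)).toReal ^ 2 with hV
  set v : ℝ := (volume (Metric.ball (0 : E d) 1)).toReal with hv
  have hv0 : 0 < v := ENNReal.toReal_pos (Metric.measure_ball_pos _ _ one_pos).ne'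
    measure_ball_lt_top.ne
  have hV0 : 0 < V := by positivity
  set c' : ℝ := ρ * K + c * (1 + K) with hc'
  have hc'0 : 0 < c' := by positivity
  refine ⟨(1 + K * ρ) ^ L * (N * (I * (c' ^ d * v))) / V, fun p F hF => ?_⟩
  set r := Ω.scale α p.1 with hr
  have hr0 : 0 < r := Ω.scale_pos α p.1
  set x := Ω.pos p.1 p.2
  set ξ := Ω.freq p.1
  let Q : ℕ × (Fin d → ℤ) → Set (E d × E d) := fun q => block α ρ (Ω.pos q.1 q.2) (Ω.freq q.1)
  -- The integral of `h` does not depend on `r`, since the factors `r ^ d` from space and frequency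
  -- cancel. On the block of each nearby `q` the indicator equals one, and the decay factor is
  -- comparable to its value at the centre; hence the sum is dominated by `N * ∫ h`.
  let h : E d × E d → ℝ := fun z => (1 + r * ‖z.1 - x‖) ^ (-L) *
    (Metric.closedBall ξ (c' * r)).indicator (fun _ => (1 : ℝ)) z.2
  have hh0 : ∀ z, 0 ≤ h z := fun z => mul_nonneg (by positivity)
    (Set.indicator_nonneg (fun _ _ => zero_le_one) _)
  have hind : Integrable ((Metric.closedBall ξ (c' * r)).indicator (fun _ => (1 : ℝ))) :=
    (integrable_indicator_iff Metric.isClosed_closedBall.measurableSet).mpr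
      (integrableOn_const measure_closedBall_lt_top.ne)
  have hh : Integrable h := (integrable_one_add_scaled_norm hL hr0 x).mul_prod hind
  have hhI : ∫ z, h z = I * (c' ^ d * v) := by
    have := integral_prod_mul (μ := (volume : Measure (E d))) (ν := (volume : Measure (E d)))
      (fun t : E d => (1 + r * ‖t - x‖) ^ (-L))
      ((Metric.closedBall ξ (c' * r)).indicator (fun _ => (1 : ℝ)))
    rw [Measure.volume_eq_prod]
    refine this.trans ?_
    rw [integral_one_add_scaled_norm L r hr0, integral_indicator
      Metric.isClosed_closedBall.measurableSet, setIntegral_const, smul_eq_mul, mul_one,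
      Measure.real, Measure.addHaar_closedBall _ _ (by positivity), finrank_euclideanSpace_fin,
      ENNReal.toReal_mul, ENNReal.toReal_ofReal (by positivity), mul_pow, ← hI, ← hv]
    field_simp
  have hvol : ∀ q, volume.real (Q q) = V := by
    intro q
    rw [Measure.real, volume_block hρ _ (Ω.freq_ne_zero q.1), ENNReal.toReal_mul,
      ENNReal.toReal_ofReal (by positivity), ENNReal.toReal_pow]
  have hfin : ∀ q, volume (Q q) ≠ ∞ := by
    intro q hq
    have := hvol q
    rw [Measure.real, hq] at this
    simp at this
    exact hV0.ne this
  have hmeas : ∀ q, MeasurableSet (Q q) := fun q => measurableSet_block _ _ _ _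
  have step : ∀ q ∈ F, (1 + r * ‖x - Ω.pos q.1 q.2‖) ^ (-L) * V ≤
      (1 + K * ρ) ^ L * ∫ z in Q q, h z := by
    intro q hq
    obtain ⟨h1, h2, h3⟩ := hF q hq
    rw [← integral_const_mul, ← hvol q]
    have : (1 + r * ‖x - Ω.pos q.1 q.2‖) ^ (-L) * volume.real (Q q) =
        ∫ z in Q q, (1 + r * ‖x - Ω.pos q.1 q.2‖) ^ (-L) := by
      rw [setIntegral_const, smul_eq_mul, mul_comm]
    rw [this]
    refine setIntegral_mono_on (integrableOn_const (hfin q))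
      (hh.integrableOn.const_mul _) (hmeas q) fun z hz => ?_
    obtain ⟨hz1, hz2⟩ := hz
    rw [← Ω.inv_scale] at hz1
    change _ ≤ ρ * Ω.scale α q.1 at hz2
    have hs := Ω.scale_pos α q.1
    have hmem : z.2 ∈ Metric.closedBall ξ (c' * r) := by
      rw [Metric.mem_closedBall, dist_eq_norm]
      calc ‖z.2 - ξ‖ ≤ ‖z.2 - Ω.freq q.1‖ + ‖ξ - Ω.freq q.1‖ := by
            rw [norm_sub_rev ξ]; exact norm_sub_le_norm_sub_add_norm_sub _ _ _
        _ ≤ ρ * Ω.scale α q.1 + c * (r + Ω.scale α q.1) := add_le_add hz2 h1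
        _ ≤ ρ * (K * r) + c * (r + K * r) := by gcongr
        _ = c' * r := by rw [hc']; ring
    have hle : 1 + r * ‖z.1 - x‖ ≤ (1 + K * ρ) * (1 + r * ‖x - Ω.pos q.1 q.2‖) := by
      have h4 : ‖z.1 - x‖ ≤ ‖z.1 - Ω.pos q.1 q.2‖ + ‖x - Ω.pos q.1 q.2‖ := by
        rw [norm_sub_rev x]; exact norm_sub_le_norm_sub_add_norm_sub _ _ _
      have h5 : r * ‖z.1 - Ω.pos q.1 q.2‖ ≤ K * ρ := by
        calc r * ‖z.1 - Ω.pos q.1 q.2‖ ≤ (K * Ω.scale α q.1) * (ρ * (Ω.scale α q.1)⁻¹) := by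
              gcongr
          _ = K * ρ := by field_simp
      have h6 : r * ‖z.1 - x‖ ≤ K * ρ + r * ‖x - Ω.pos q.1 q.2‖ := by
        calc r * ‖z.1 - x‖ ≤ r * (‖z.1 - Ω.pos q.1 q.2‖ + ‖x - Ω.pos q.1 q.2‖) := by gcongr
          _ = r * ‖z.1 - Ω.pos q.1 q.2‖ + r * ‖x - Ω.pos q.1 q.2‖ := by ring
          _ ≤ _ := by gcongr
      have h7 : 0 ≤ K * ρ * (r * ‖x - Ω.pos q.1 q.2‖) := by positivity
      nlinarith
    simp only [h, Set.indicator_of_mem hmem, mul_one]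
    have h8 := Real.rpow_le_rpow_of_nonpos (by positivity) hle (neg_nonpos.mpr hL0.le)
    rw [Real.mul_rpow (by positivity) (by positivity)] at h8
    calc (1 + r * ‖x - Ω.pos q.1 q.2‖) ^ (-L) = (1 + K * ρ) ^ L *
          ((1 + K * ρ) ^ (-L) * (1 + r * ‖x - Ω.pos q.1 q.2‖) ^ (-L)) := by
          rw [← mul_assoc, ← Real.rpow_add (by positivity)]; simp
      _ ≤ _ := by gcongr
  have hsum : ∑ q ∈ F, ∫ z in Q q, h z ≤ N * ∫ z, h z := by
    rw [← integral_const_mul]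
    calc ∑ q ∈ F, ∫ z in Q q, h z = ∫ z, ∑ q ∈ F, (Q q).indicator h z := by
          rw [integral_finsetSum _ fun q _ => hh.indicator (hmeas q)]
          exact Finset.sum_congr rfl fun q _ => (integral_indicator (hmeas q)).symm
      _ ≤ _ := by
          refine integral_mono (integrable_finsetSum _ fun q _ => hh.indicator (hmeas q))
            (hh.const_mul _) fun z => ?_
          classical
          simp only [Set.indicator_apply]
          rw [← Finset.sum_filter, Finset.sum_const, nsmul_eq_mul]
          refine mul_le_mul_of_nonneg_right ?_ (hh0 z)
          have h9 : ((F.filter fun q => z ∈ Q q : Finset _) : Set (ℕ × (Fin d → ℤ))).encard ≤ N :=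
            (Set.encard_le_encard fun q hq => (Finset.mem_filter.mp hq).2).trans (hN z)
          rw [Set.encard_coe_eq_coe_finsetCard] at h9
          exact_mod_cast h9
  rw [le_div_iff₀ hV0, Finset.sum_mul]
  calc _ ≤ ∑ q ∈ F, (1 + K * ρ) ^ L * ∫ z in Q q, h z := Finset.sum_le_sum step
    _ = (1 + K * ρ) ^ L * ∑ q ∈ F, ∫ z in Q q, h z := by rw [Finset.mul_sum]
    _ ≤ _ := by rw [← hhI]; gcongr

end

section

/-! ### Bessel sequences in a Hilbert space -/

section Hilbert

variable {ι H : Type*} [NormedAddCommGroup H] [InnerProductSpace ℂ H]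

/-- Finite linear combinations of the family `e` are bounded by the `ℓ²` norm of the coefficients:
`e` is a Bessel sequence with bound `B`. -/
def SynthesisBound (B : ℝ) (e : ι → H) : Prop :=
  ∀ (F : Finset ι) (c : ι → ℂ), ‖∑ p ∈ F, c p • e p‖ ^ 2 ≤ B * ∑ p ∈ F, ‖c p‖ ^ 2

/-- Schur's test: expand the square of the norm into a Gram double sum and use `2|c_p c_q| ≤ |c_p|²
+ |c_q|²`. The moduli of the Gram entries are symmetric, so a bound on row sums suffices. -/
theorem synthesisBound_of_schur {e : ι → H} {C : ℝ}
    (h : ∀ (p : ι) (F : Finset ι), ∑ q ∈ F, ‖inner ℂ (e p) (e q)‖ ≤ C) : SynthesisBound C e := by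
  intro F c
  have h1 : ‖∑ p ∈ F, c p • e p‖ ^ 2 ≤
      ∑ p ∈ F, ∑ q ∈ F, ‖c p‖ * ‖c q‖ * ‖inner ℂ (e p) (e q)‖ := by
    have : ((‖∑ p ∈ F, c p • e p‖ ^ 2 : ℝ) : ℂ) =
        ∑ p ∈ F, ∑ q ∈ F, (starRingEnd ℂ) (c p) * (c q * inner ℂ (e p) (e q)) := by
      have := inner_self_eq_norm_sq_to_K (𝕜 := ℂ) (∑ p ∈ F, c p • e p)
      rw [sum_inner] at this
      simp only [inner_sum, inner_smul_left, inner_smul_right] at this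
      rw [Complex.ofReal_pow]
      exact this.symm.trans (Finset.sum_congr rfl fun p _ => Finset.sum_congr rfl fun q _ => by ring)
    have h2 : ‖∑ p ∈ F, c p • e p‖ ^ 2 = ‖((‖∑ p ∈ F, c p • e p‖ ^ 2 : ℝ) : ℂ)‖ := by
      rw [Complex.norm_real, Real.norm_of_nonneg (by positivity)]
    rw [h2, this]
    refine (norm_sum_le _ _).trans (Finset.sum_le_sum fun p _ => (norm_sum_le _ _).trans
      (Finset.sum_le_sum fun q _ => ?_))
    rw [norm_mul, norm_mul, RCLike.norm_conj, mul_assoc]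
  refine h1.trans ?_
  have h3 : ∑ p ∈ F, ∑ q ∈ F, ‖c p‖ * ‖c q‖ * ‖inner ℂ (e p) (e q)‖ ≤
      ∑ p ∈ F, ∑ q ∈ F, (‖c p‖ ^ 2 * ‖inner ℂ (e p) (e q)‖ / 2 +
        ‖c q‖ ^ 2 * ‖inner ℂ (e q) (e p)‖ / 2) := by
    refine Finset.sum_le_sum fun p _ => Finset.sum_le_sum fun q _ => ?_
    rw [norm_inner_symm (e q) (e p)]
    have := norm_nonneg (inner ℂ (e p) (e q))
    nlinarith [mul_nonneg this (sq_nonneg (‖c p‖ - ‖c q‖))]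
  have h4 : ∀ p ∈ F, ∑ q ∈ F, ‖c p‖ ^ 2 * ‖inner ℂ (e p) (e q)‖ / 2 ≤ C * ‖c p‖ ^ 2 / 2 := by
    intro p _
    rw [← Finset.sum_div, ← Finset.mul_sum, mul_comm C]
    gcongr
    exact h p F
  refine h3.trans ?_
  simp only [Finset.sum_add_distrib]
  rw [Finset.sum_comm (f := fun p q => ‖c q‖ ^ 2 * ‖inner ℂ (e q) (e p)‖ / 2)]
  have h5 := Finset.sum_le_sum h4
  rw [← Finset.sum_div, ← Finset.mul_sum] at h5
  linarith

theorem SynthesisBound.mono {e : ι → H} {B B' : ℝ} (h : SynthesisBound B e) (hB : B ≤ B') :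
    SynthesisBound B' e := fun F c =>
  (h F c).trans (mul_le_mul_of_nonneg_right hB (Finset.sum_nonneg fun _ _ => by positivity))

theorem SynthesisBound.norm_sum_le {e : ι → H} {B : ℝ} (h : SynthesisBound B e)
    (F : Finset ι) (c : ι → ℂ) :
    ‖∑ p ∈ F, c p • e p‖ ≤ √B * √(∑ p ∈ F, ‖c p‖ ^ 2) := by
  rw [← Real.sqrt_mul' _ (Finset.sum_nonneg fun _ _ => by positivity)]
  exact Real.le_sqrt_of_sq_le (h F c)

/-- The analysis bound dual to the synthesis bound. -/
theorem SynthesisBound.analysis {e : ι → H} {B : ℝ} (hB : 0 ≤ B) (h : SynthesisBound B e)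
    (F : Finset ι) (y : H) : ∑ p ∈ F, ‖inner ℂ (e p) y‖ ^ 2 ≤ B * ‖y‖ ^ 2 := by
  set S := ∑ p ∈ F, ‖inner ℂ (e p) y‖ ^ 2 with hS
  have hS0 : 0 ≤ S := Finset.sum_nonneg fun _ _ => by positivity
  -- Testing the synthesis bound on the coefficients `⟨e_p, y⟩` gives `S² ≤ B S ‖y‖²`; then divide
  -- by `S`.
  have h1 : (S : ℂ) = inner ℂ (∑ p ∈ F, inner ℂ (e p) y • e p) y := by
    rw [sum_inner, hS, Complex.ofReal_sum]
    refine Finset.sum_congr rfl fun p _ => ?_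
    rw [inner_smul_left, RCLike.conj_mul]
    simp
  have h2 : S ≤ ‖∑ p ∈ F, inner ℂ (e p) y • e p‖ * ‖y‖ := by
    calc S = ‖(S : ℂ)‖ := by rw [Complex.norm_real, Real.norm_of_nonneg hS0]
      _ ≤ _ := by rw [h1]; exact norm_inner_le_norm _ _
  have h3 := h F fun p => inner ℂ (e p) y
  rw [← hS] at h3
  rcases hS0.eq_or_lt with h0 | h0
  · rw [← h0]; positivity
  · have h4 : S ^ 2 ≤ B * S * ‖y‖ ^ 2 := by
      calc S ^ 2 ≤ (‖∑ p ∈ F, inner ℂ (e p) y • e p‖ * ‖y‖) ^ 2 := by gcongr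
        _ = ‖∑ p ∈ F, inner ℂ (e p) y • e p‖ ^ 2 * ‖y‖ ^ 2 := mul_pow _ _ _
        _ ≤ _ := by gcongr
    have : S * S ≤ S * (B * ‖y‖ ^ 2) := by nlinarith
    exact le_of_mul_le_mul_left this h0

theorem SynthesisBound.add {e e' : ι → H} {B B' : ℝ} (h : SynthesisBound B e)
    (h' : SynthesisBound B' e') : SynthesisBound (2 * (B + B')) fun p => e p + e' p := by
  intro F c
  simp only [smul_add, Finset.sum_add_distrib]
  have h1 := h F c
  have h2 := h' F c
  have h3 := norm_add_le (∑ p ∈ F, c p • e p) (∑ p ∈ F, c p • e' p)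
  have h4 := norm_nonneg (∑ p ∈ F, c p • e p + ∑ p ∈ F, c p • e' p)
  nlinarith [sq_nonneg (‖∑ p ∈ F, c p • e p‖ - ‖∑ p ∈ F, c p • e' p‖)]

end Hilbert

/-! ### Coordinate multiplication and band-limited windows -/

theorem hasTemperateGrowth_inner_ofReal (v : E d) :
    (fun x : E d => ((inner ℝ x v : ℝ) : ℂ)).HasTemperateGrowth :=
  Function.Complex.hasTemperateGrowth_ofReal.comp (Function.hasTemperateGrowth_inner_left (H := E d) v)

/-- Multiplication of a Schwartz function by the linear function `x ↦ x · v`. -/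
def coordMul (v : E d) : 𝓢(E d, ℂ) →L[ℂ] 𝓢(E d, ℂ) :=
  SchwartzMap.smulLeftCLM ℂ (fun x : E d => ((inner ℝ x v : ℝ) : ℂ))

theorem coordMul_apply (v : E d) (ψ : 𝓢(E d, ℂ)) (x : E d) :
    coordMul v ψ x = ((inner ℝ x v : ℝ) : ℂ) * ψ x := by
  rw [coordMul, SchwartzMap.smulLeftCLM_apply_apply (hasTemperateGrowth_inner_ofReal v),
    smul_eq_mul]

/-- The Fourier transform of `g` lives in the ball of radius `c`. -/
def BandLimited (c : ℝ) (g : 𝓢(E d, ℂ)) : Prop :=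
  tsupport (𝓕 g : 𝓢(E d, ℂ)) ⊆ Metric.closedBall 0 c

/-- Multiplication by a coordinate is, up to a constant, a derivative on the Fourier side, which
does not enlarge the support. Hence the windows arising from commutators have the same Bessel
theory. -/
theorem BandLimited.coordMul {c : ℝ} {g : 𝓢(E d, ℂ)} (hg : BandLimited c g) (v : E d) :
    BandLimited c (coordMul v g) := by
  have h1 := SchwartzMap.lineDerivOp_fourier_eq g v
  have h2 : SchwartzMap.smulLeftCLM ℂ (fun x : E d => (inner ℝ x v : ℝ)) g =
      Subdyadic.coordMul v g := by
    ext x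
    rw [SchwartzMap.smulLeftCLM_apply_apply (Function.hasTemperateGrowth_inner_left (H := E d) v),
      coordMul_apply, Complex.real_smul]
  rw [h2, FourierTransform.fourier_smul] at h1
  have h3 : (𝓕 (Subdyadic.coordMul v g) : 𝓢(E d, ℂ)) =
      (-(2 * Real.pi * Complex.I))⁻¹ • LineDeriv.lineDerivOp v (𝓕 g : 𝓢(E d, ℂ)) := by
    rw [h1, smul_smul, inv_mul_cancel₀ (by simp [Real.pi_ne_zero]), one_smul]
  unfold BandLimited
  rw [h3]
  refine (closure_mono ?_).trans ((SchwartzMap.tsupport_lineDerivOp_subset v _).trans hg)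
  intro x hx hx'
  apply hx
  rw [_root_.smul_apply, hx', smul_zero]

theorem BandLimited.eq_zero {c : ℝ} {g : 𝓢(E d, ℂ)} (hg : BandLimited c g) {ζ : E d}
    (h : (𝓕 g : 𝓢(E d, ℂ)) ζ ≠ 0) : ‖ζ‖ ≤ c := by
  simpa using hg (subset_tsupport _ h)

/-! ### Packets -/

theorem norm_packet_apply (α : ℝ) (g : 𝓢(E d, ℂ)) (x ξ : E d) (hξ : ξ ≠ 0) (t : E d) :
    ‖packet α g x ξ hξ t‖ =
      ‖ξ‖ ^ ((d : ℝ) / 2 * (1 - α)) * ‖g ((‖ξ‖ ^ (1 - α)) • (t - x))‖ := by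
  rw [packet_apply, norm_mul, norm_mul, Complex.norm_real, Complex.norm_exp_ofReal_mul_I, mul_one,
    Real.norm_of_nonneg (by positivity)]

/-- Split `t · v = x · v + (t - x) · v`. The second term is the window's own coordinate divided by
the packet scale. -/
theorem coordMul_packet (α : ℝ) (g : 𝓢(E d, ℂ)) (x ξ : E d) (hξ : ξ ≠ 0) (v : E d) :
    coordMul v (packet α g x ξ hξ) = ((inner ℝ x v : ℝ) : ℂ) • packet α g x ξ hξ +
      (((‖ξ‖ ^ (1 - α))⁻¹ : ℝ) : ℂ) • packet α (coordMul v g) x ξ hξ := by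
  ext t
  have h : ‖ξ‖ ^ (1 - α) ≠ 0 := scale_ne_zero α hξ
  simp only [coordMul_apply, _root_.add_apply, _root_.smul_apply, packet_apply, smul_eq_mul,
    inner_smul_left, inner_sub_left]
  push_cast
  have h' : ((‖ξ‖ ^ (1 - α) : ℝ) : ℂ) ≠ 0 := by exact_mod_cast h
  field_simp
  simp
  ring

/-- Up to a factor, the Fourier transform of a packet is the rescaled Fourier transform of the
window, recentred at the frequency of the packet. -/
theorem exists_fourier_packet (α : ℝ) (g : 𝓢(E d, ℂ)) (x ξ : E d) (hξ : ξ ≠ 0) (ζ : E d) :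
    ∃ A : ℂ, (𝓕 (packet α g x ξ hξ) : 𝓢(E d, ℂ)) ζ =
      A * (𝓕 g : 𝓢(E d, ℂ)) ((‖ξ‖ ^ (1 - α))⁻¹ • (ζ - (2 * Real.pi)⁻¹ • ξ)) := by
  set r := ‖ξ‖ ^ (1 - α) with hr
  have hr0 : r ≠ 0 := scale_ne_zero α hξ
  set ω := r⁻¹ • (ζ - (2 * Real.pi)⁻¹ • ξ) with hω
  refine ⟨((‖ξ‖ ^ ((d : ℝ) / 2 * (1 - α)) : ℝ) : ℂ) *
    Complex.exp (((inner ℝ x ξ - 2 * Real.pi * inner ℝ x ζ : ℝ) : ℂ) * Complex.I) *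
    ((|(r ^ d)⁻¹| : ℝ) : ℂ), ?_⟩
  rw [SchwartzMap.fourier_coe, SchwartzMap.fourier_coe, Real.fourier_eq', Real.fourier_eq']
  set k : E d → ℂ := fun s => Complex.exp (((-2 * Real.pi * inner ℝ s ω : ℝ) : ℂ) * Complex.I) • g s
  have h1 : ∫ t : E d, k (r • (t - x)) = ((|(r ^ d)⁻¹| : ℝ) : ℂ) * ∫ s, k s := by
    rw [integral_sub_right_eq_self (fun t => k (r • t)) x, Measure.integral_comp_smul,
      finrank_euclideanSpace_fin, Complex.real_smul]
  rw [mul_assoc, ← h1, ← integral_const_mul]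
  refine integral_congr_ae (Filter.Eventually.of_forall fun t => ?_)
  simp only [packet_apply, k, smul_eq_mul, ← hr]
  have h2 : -2 * Real.pi * inner ℝ (r • (t - x)) ω =
      -2 * Real.pi * inner ℝ (t - x) ζ + inner ℝ (t - x) ξ := by
    rw [hω, inner_smul_left, inner_smul_right, inner_sub_right, inner_smul_right]
    have := Real.pi_ne_zero
    simp
    field_simp
    ring
  rw [h2]
  have h3 : Complex.exp (((-2 * Real.pi * inner ℝ t ζ : ℝ) : ℂ) * Complex.I) *
      Complex.exp ((inner ℝ t ξ : ℝ) * Complex.I) =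
      Complex.exp (((inner ℝ x ξ - 2 * Real.pi * inner ℝ x ζ : ℝ) : ℂ) * Complex.I) *
      Complex.exp (((-2 * Real.pi * inner ℝ (t - x) ζ + inner ℝ (t - x) ξ : ℝ) : ℂ) *
        Complex.I) := by
    rw [← Complex.exp_add, ← Complex.exp_add]
    congr 1
    rw [inner_sub_left, inner_sub_left]
    push_cast
    ring
  linear_combination ((‖ξ‖ ^ ((d : ℝ) / 2 * (1 - α)) : ℝ) : ℂ) * g (r • (t - x)) * h3

/-- The factor `(2π)⁻¹` at the centre comes from the normalization of `𝓕` with the kernel `e^{-2πi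
t·ζ}`. -/
theorem fourier_latticePacket_support {Ω : PhaseLattice d} {α c : ℝ} {g : 𝓢(E d, ℂ)}
    (hg : BandLimited c g) {k : ℕ} {j : Fin d → ℤ} {ζ : E d}
    (h : (𝓕 (latticePacket α g Ω k j) : 𝓢(E d, ℂ)) ζ ≠ 0) :
    ‖ζ - (2 * Real.pi)⁻¹ • Ω.freq k‖ ≤ c * Ω.scale α k := by
  obtain ⟨A, hA⟩ := exists_fourier_packet α g (Ω.pos k j) (Ω.freq k) (Ω.freq_ne_zero k) ζ
  have hs := Ω.scale_pos α k
  have h1 := hg.eq_zero (ζ := (Ω.scale α k)⁻¹ • (ζ - (2 * Real.pi)⁻¹ • Ω.freq k)) (by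
    intro h0
    apply h
    rw [latticePacket, hA]
    unfold PhaseLattice.scale at h0
    rw [h0, mul_zero])
  rw [norm_smul, Real.norm_of_nonneg (by positivity), inv_mul_le_iff₀ hs] at h1
  linarith

end

section

/-! ### Schwartz functions as elements of `L²` -/

/-- The class in `L²` of a Schwartz function. -/
def toL2 : 𝓢(E d, ℂ) →L[ℂ] Lp ℂ 2 (volume : Measure (E d)) :=
  SchwartzMap.toLpCLM ℂ ℂ 2 volume

theorem coeFn_toL2 (u : 𝓢(E d, ℂ)) : (toL2 u : E d → ℂ) =ᵐ[volume] u :=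
  SchwartzMap.coeFn_toLp u 2 volume

theorem inner_toL2 (u v : 𝓢(E d, ℂ)) : inner ℂ (toL2 u) (toL2 v) = ∫ x, inner ℂ (u x) (v x) :=
  SchwartzMap.inner_toL2_toL2_eq u v volume

theorem inner_toL2_fourier (u v : 𝓢(E d, ℂ)) :
    inner ℂ (toL2 (𝓕 u)) (toL2 (𝓕 v)) = inner ℂ (toL2 u) (toL2 v) :=
  SchwartzMap.inner_fourier_toL2_eq u v

theorem norm_toL2_sq (u : 𝓢(E d, ℂ)) : ‖toL2 u‖ ^ 2 = ∫ x, ‖u x‖ ^ 2 := by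
  have h := inner_self_eq_norm_sq_to_K (𝕜 := ℂ) (toL2 u)
  rw [inner_toL2] at h
  simp only [inner_self_eq_norm_sq_to_K] at h
  have h2 : ((∫ x, ‖u x‖ ^ 2 : ℝ) : ℂ) = ((‖toL2 u‖ ^ 2 : ℝ) : ℂ) := by
    rw [← integral_complex_ofReal]
    push_cast
    exact h
  exact_mod_cast h2.symm

theorem norm_toL2_fourier (u : 𝓢(E d, ℂ)) : ‖toL2 (𝓕 u)‖ = ‖toL2 u‖ := by
  have h := inner_toL2_fourier u u
  rw [inner_self_eq_norm_sq_to_K, inner_self_eq_norm_sq_to_K] at h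
  have h2 : ‖toL2 (𝓕 u)‖ ^ 2 = ‖toL2 u‖ ^ 2 := by exact_mod_cast h
  exact (sq_eq_sq₀ (norm_nonneg _) (norm_nonneg _)).mp h2

theorem integrable_norm_sq (u : 𝓢(E d, ℂ)) : Integrable fun x => ‖u x‖ ^ 2 :=
  (u.memLp 2 volume).integrable_norm_pow two_ne_zero

/-! ### Bessel bounds for packets -/

theorem exists_decay (g : 𝓢(E d, ℂ)) (n : ℕ) :
    ∃ C : ℝ, 0 ≤ C ∧ ∀ t, ‖g t‖ ≤ C * (1 + ‖t‖) ^ (-(n : ℝ)) := by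
  refine ⟨2 ^ n * ((Finset.Iic (n, 0)).sup fun m => SchwartzMap.seminorm ℝ m.1 m.2) g,
    mul_nonneg (by positivity) (apply_nonneg _ _), fun t => ?_⟩
  have h := SchwartzMap.one_add_le_sup_seminorm_apply (𝕜 := ℝ) (m := (n, 0)) le_rfl le_rfl g t
  rw [norm_iteratedFDeriv_zero] at h
  rw [Real.rpow_neg (by positivity), Real.rpow_natCast, ← div_eq_mul_inv,
    le_div_iff₀ (by positivity), mul_comm]
  exact h

theorem latticePacket_amplitude (Ω : PhaseLattice d) (α : ℝ) (k : ℕ) :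
    ‖Ω.freq k‖ ^ ((d : ℝ) / 2 * (1 - α)) = Ω.scale α k ^ ((d : ℝ) / 2) := by
  rw [PhaseLattice.scale, ← Real.rpow_mul (norm_nonneg _), mul_comm]

/-- The window decays to order `2L` with `L = d + 1`. One power `L` from each packet yields the
decay between the two positions. A second power `L` from the first packet remains to be integrated
in `t`, and its integral `r^{-d}` cancels the amplitudes. -/
theorem exists_gram_le (Ω : PhaseLattice d) (α : ℝ) (g : 𝓢(E d, ℂ)) {K : ℝ} (hK : 1 ≤ K) :
    ∃ C : ℝ, 0 ≤ C ∧ ∀ p q : ℕ × (Fin d → ℤ),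
      Ω.scale α p.1 ≤ K * Ω.scale α q.1 → Ω.scale α q.1 ≤ K * Ω.scale α p.1 →
      ‖inner ℂ (toL2 (latticePacket α g Ω p.1 p.2)) (toL2 (latticePacket α g Ω q.1 q.2))‖ ≤
        C * (1 + Ω.scale α p.1 * ‖Ω.pos p.1 p.2 - Ω.pos q.1 q.2‖) ^ (-((d : ℝ) + 1)) := by
  obtain ⟨C₀, hC₀, hg⟩ := exists_decay g (2 * (d + 1))
  set L : ℝ := (d : ℝ) + 1 with hL
  have hL0 : 0 < L := by positivity
  have hg' : ∀ t, ‖g t‖ ≤ C₀ * (1 + ‖t‖) ^ (-(2 * L)) := by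
    intro t
    refine (hg t).trans_eq ?_
    push_cast
    rfl
  set I : ℝ := ∫ t : E d, (1 + ‖t‖) ^ (-L) with hI
  have hI0 : 0 ≤ I := integral_nonneg fun t => by positivity
  refine ⟨C₀ ^ 2 * K ^ ((d : ℝ) / 2) * K ^ (2 * L) * I, by positivity, fun p q hpq hqp => ?_⟩
  set r := Ω.scale α p.1
  set s := Ω.scale α q.1
  have hr : 0 < r := Ω.scale_pos α p.1
  have hs : 0 < s := Ω.scale_pos α q.1
  set x := Ω.pos p.1 p.2
  set y := Ω.pos q.1 q.2
  have hpt : ∀ t : E d, ‖inner ℂ (latticePacket α g Ω p.1 p.2 t) (latticePacket α g Ω q.1 q.2 t)‖ ≤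
      C₀ ^ 2 * K ^ ((d : ℝ) / 2) * K ^ (2 * L) * (1 + r * ‖x - y‖) ^ (-L) * r ^ d *
        (1 + r * ‖t - x‖) ^ (-L) := by
    intro t
    have h1 : ‖latticePacket α g Ω p.1 p.2 t‖ ≤
        r ^ ((d : ℝ) / 2) * (C₀ * (1 + r * ‖t - x‖) ^ (-(2 * L))) := by
      rw [latticePacket, norm_packet_apply, latticePacket_amplitude]
      gcongr
      refine (hg' _).trans_eq ?_
      rw [norm_smul, Real.norm_of_nonneg (by positivity)]
      rfl
    have h2 : ‖latticePacket α g Ω q.1 q.2 t‖ ≤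
        s ^ ((d : ℝ) / 2) * (C₀ * (1 + s * ‖t - y‖) ^ (-(2 * L))) := by
      rw [latticePacket, norm_packet_apply, latticePacket_amplitude]
      gcongr
      refine (hg' _).trans_eq ?_
      rw [norm_smul, Real.norm_of_nonneg (by positivity)]
      rfl
    have h3 : s ^ ((d : ℝ) / 2) ≤ K ^ ((d : ℝ) / 2) * r ^ ((d : ℝ) / 2) := by
      rw [← Real.mul_rpow (by positivity) hr.le]
      exact Real.rpow_le_rpow hs.le hqp (by positivity)
    have h4 : (1 + s * ‖t - y‖) ^ (-(2 * L)) ≤ K ^ (2 * L) * (1 + r * ‖t - y‖) ^ (-L) := by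
      have h5 : 1 + r * ‖t - y‖ ≤ K * (1 + s * ‖t - y‖) := by
        have : r * ‖t - y‖ ≤ K * s * ‖t - y‖ := by gcongr
        linarith
      have h6 := Real.rpow_le_rpow_of_nonpos (by positivity) h5
        (neg_nonpos.mpr (show (0 : ℝ) ≤ 2 * L by positivity))
      rw [Real.mul_rpow (by positivity) (by positivity)] at h6
      have h7 : (1 + r * ‖t - y‖) ^ (-L) ≥ (1 + r * ‖t - y‖) ^ (-(2 * L)) :=
        Real.rpow_le_rpow_of_exponent_le (by have : 0 ≤ r * ‖t - y‖ := by positivity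
                                             linarith) (by linarith)
      have h9 : K ^ (2 * L) * (1 + r * ‖t - y‖) ^ (-L) ≥ _ :=
        mul_le_mul_of_nonneg_left (h6.trans h7) (by positivity : (0 : ℝ) ≤ K ^ (2 * L))
      rw [← mul_assoc, ← Real.rpow_add (by positivity)] at h9
      simpa using h9
    have h5 : (1 + r * ‖t - x‖) ^ (-(2 * L)) * (1 + r * ‖t - y‖) ^ (-L) ≤
        (1 + r * ‖x - y‖) ^ (-L) * (1 + r * ‖t - x‖) ^ (-L) := by
      rw [show -(2 * L) = -L + -L by ring, Real.rpow_add (by positivity), mul_assoc, mul_comm,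
        ← Real.mul_rpow (by positivity) (by positivity)]
      refine mul_le_mul_of_nonneg_right ?_ (by positivity)
      refine Real.rpow_le_rpow_of_nonpos (by positivity) ?_ (by linarith)
      have h6 : ‖x - y‖ ≤ ‖t - x‖ + ‖t - y‖ := by
        rw [norm_sub_rev t x]; exact norm_sub_le_norm_sub_add_norm_sub _ _ _
      have h7 : r * ‖x - y‖ ≤ r * ‖t - x‖ + r * ‖t - y‖ := by rw [← mul_add]; gcongr
      have : 0 ≤ r * ‖t - x‖ * (r * ‖t - y‖) := by positivity
      linarith
    have h6 : r ^ ((d : ℝ) / 2) * r ^ ((d : ℝ) / 2) = r ^ d := by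
      rw [← Real.rpow_add hr, add_halves, Real.rpow_natCast]
    calc _ ≤ ‖latticePacket α g Ω p.1 p.2 t‖ * ‖latticePacket α g Ω q.1 q.2 t‖ :=
          norm_inner_le_norm _ _
      _ ≤ (r ^ ((d : ℝ) / 2) * (C₀ * (1 + r * ‖t - x‖) ^ (-(2 * L)))) *
          ((K ^ ((d : ℝ) / 2) * r ^ ((d : ℝ) / 2)) *
            (C₀ * (K ^ (2 * L) * (1 + r * ‖t - y‖) ^ (-L)))) := by
          refine mul_le_mul h1 (h2.trans ?_) (norm_nonneg _) (by positivity)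
          gcongr
      _ = C₀ ^ 2 * K ^ ((d : ℝ) / 2) * K ^ (2 * L) * r ^ d *
          ((1 + r * ‖t - x‖) ^ (-(2 * L)) * (1 + r * ‖t - y‖) ^ (-L)) := by rw [← h6]; ring
      _ ≤ C₀ ^ 2 * K ^ ((d : ℝ) / 2) * K ^ (2 * L) * r ^ d *
          ((1 + r * ‖x - y‖) ^ (-L) * (1 + r * ‖t - x‖) ^ (-L)) := by gcongr
      _ = _ := by ring
  rw [inner_toL2]
  refine (norm_integral_le_of_norm_le ((integrable_one_add_scaled_norm (by linarith) hr
    x).const_mul _) (Filter.Eventually.of_forall hpt)).trans_eq ?_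
  rw [integral_const_mul, integral_one_add_scaled_norm L r hr, ← hI]
  field_simp

/-- The packets of a band-limited Schwartz window over an admissible lattice are a Bessel
sequence. -/
theorem exists_synthesisBound {Ω : PhaseLattice d} {α : ℝ} (hα : 0 < α)
    (hΩ : IsAdmissibleLattice α Ω) {c : ℝ} (hc : 0 < c) {g : 𝓢(E d, ℂ)} (hg : BandLimited c g) :
    ∃ B : ℝ, 0 ≤ B ∧ SynthesisBound B fun p : ℕ × (Fin d → ℤ) =>
      toL2 (latticePacket α g Ω p.1 p.2) := by
  obtain ⟨hfin, ρ, hρ, -, N, hN⟩ := hΩ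
  obtain ⟨μ, hμ, hμΩ⟩ := exists_norm_freq_lower_bound hfin
  have hc' : 0 < 2 * Real.pi * c := by positivity
  obtain ⟨K, hK, hKΩ⟩ := exists_scale_comparable hα hμ hμΩ hc'
  obtain ⟨C₁, hC₁, hgram⟩ := exists_gram_le Ω α g hK
  obtain ⟨C₂, hC₂⟩ := exists_sum_near_le hρ hN (lt_add_one (d : ℝ)) hc' hK
  -- By Plancherel, a nonzero inner product forces the frequency supports to meet. Undoing the
  -- factor `(2π)⁻¹` of the centres turns `c` into `2πc`.
  have hsupp : ∀ p q : ℕ × (Fin d → ℤ),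
      inner ℂ (toL2 (latticePacket α g Ω p.1 p.2)) (toL2 (latticePacket α g Ω q.1 q.2)) ≠ 0 →
      ‖Ω.freq p.1 - Ω.freq q.1‖ ≤ 2 * Real.pi * c * (Ω.scale α p.1 + Ω.scale α q.1) := by
    intro p q h
    rw [← inner_toL2_fourier, inner_toL2] at h
    obtain ⟨ζ, hζ⟩ : ∃ ζ, inner ℂ ((𝓕 (latticePacket α g Ω p.1 p.2) : 𝓢(E d, ℂ)) ζ)
        ((𝓕 (latticePacket α g Ω q.1 q.2) : 𝓢(E d, ℂ)) ζ) ≠ 0 := by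
      by_contra! h0
      exact h (integral_eq_zero_of_ae (Filter.Eventually.of_forall h0))
    have h1 := fourier_latticePacket_support hg (k := p.1) (j := p.2) (ζ := ζ)
      (fun h0 => hζ (by rw [h0, inner_zero_left]))
    have h2 := fourier_latticePacket_support hg (k := q.1) (j := q.2) (ζ := ζ)
      (fun h0 => hζ (by rw [h0, inner_zero_right]))
    have h3 : ‖(2 * Real.pi)⁻¹ • (Ω.freq p.1 - Ω.freq q.1)‖ ≤
        c * Ω.scale α p.1 + c * Ω.scale α q.1 := by
      rw [smul_sub, ← sub_sub_sub_cancel_left _ _ ζ]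
      refine (norm_sub_le _ _).trans ?_
      linarith
    rw [norm_smul, Real.norm_of_nonneg (by positivity), inv_mul_le_iff₀ (by positivity)] at h3
    linarith
  have hbound : ∀ (p : ℕ × (Fin d → ℤ)) (F : Finset (ℕ × (Fin d → ℤ))),
      ∑ q ∈ F, ‖inner ℂ (toL2 (latticePacket α g Ω p.1 p.2)) (toL2 (latticePacket α g Ω q.1 q.2))‖ ≤ C₁ * C₂ := by
    intro p F
    classical
    set e : ℕ × (Fin d → ℤ) → Lp ℂ 2 (volume : Measure (E d)) :=
      fun q => toL2 (latticePacket α g Ω q.1 q.2)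
    have h1 : ∑ q ∈ F, ‖inner ℂ (e p) (e q)‖ =
        ∑ q ∈ F.filter fun q => inner ℂ (e p) (e q) ≠ 0, ‖inner ℂ (e p) (e q)‖ := by
      rw [Finset.sum_filter]
      refine Finset.sum_congr rfl fun q _ => ?_
      split_ifs with h
      · rfl
      · rw [not_not.mp h, norm_zero]
    change ∑ q ∈ F, ‖inner ℂ (e p) (e q)‖ ≤ _
    have hnear : ∀ q ∈ F.filter (fun q => inner ℂ (e p) (e q) ≠ 0),
        ‖Ω.freq p.1 - Ω.freq q.1‖ ≤ 2 * Real.pi * c * (Ω.scale α p.1 + Ω.scale α q.1) ∧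
        Ω.scale α q.1 ≤ K * Ω.scale α p.1 ∧ Ω.scale α p.1 ≤ K * Ω.scale α q.1 := by
      intro q hq
      have h2 := hsupp p q (Finset.mem_filter.mp hq).2
      refine ⟨h2, hKΩ _ _ ?_, hKΩ _ _ h2⟩
      rw [norm_sub_rev, add_comm]
      exact h2
    rw [h1]
    refine le_trans ?_ (mul_le_mul_of_nonneg_left (hC₂ p _ hnear) hC₁)
    rw [Finset.mul_sum]
    refine Finset.sum_le_sum fun q hq => ?_
    obtain ⟨-, h2, h3⟩ := hnear q hq
    exact hgram p q h3 h2
  refine ⟨C₁ * C₂, ?_, synthesisBound_of_schur hbound⟩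
  exact (Finset.sum_nonneg fun _ _ => norm_nonneg _).trans (hbound (0, 0) ∅)

end

section

/-! ### Slowly varying weights -/

/-- The Japanese bracket `(R² + |ζ|²)^{1/2}` at scale `R`. -/
def bracket (R : ℝ) (ζ : E d) : ℝ := √(R ^ 2 + ‖ζ‖ ^ 2)

theorem bracket_sq (R : ℝ) (ζ : E d) : bracket R ζ ^ 2 = R ^ 2 + ‖ζ‖ ^ 2 :=
  Real.sq_sqrt (by positivity)

theorem bracket_nonneg (R : ℝ) (ζ : E d) : 0 ≤ bracket R ζ := Real.sqrt_nonneg _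

theorem le_bracket (R : ℝ) (ζ : E d) : R ≤ bracket R ζ :=
  Real.le_sqrt_of_sq_le (by nlinarith [sq_nonneg ‖ζ‖])

theorem norm_le_bracket (R : ℝ) (ζ : E d) : ‖ζ‖ ≤ bracket R ζ :=
  Real.le_sqrt_of_sq_le (by nlinarith [sq_nonneg R])

theorem bracket_pos {R : ℝ} (hR : 0 < R) (ζ : E d) : 0 < bracket R ζ :=
  hR.trans_le (le_bracket R ζ)

theorem bracket_le_add {R : ℝ} (ζ η : E d) : bracket R ζ ≤ bracket R η + ‖ζ - η‖ := by
  refine Real.sqrt_le_iff.mpr ⟨add_nonneg (bracket_nonneg _ _) (norm_nonneg _), ?_⟩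
  have h1 := bracket_sq R η
  have h2 := norm_le_bracket R η
  have h3 : ‖ζ‖ ≤ ‖ζ - η‖ + ‖η‖ := by simpa using norm_add_le (ζ - η) η
  have h4 : ‖ζ‖ ^ 2 ≤ (‖ζ - η‖ + ‖η‖) ^ 2 := by gcongr
  nlinarith [mul_le_mul_of_nonneg_left h2 (norm_nonneg (ζ - η))]

theorem hasTemperateGrowth_bracket_rpow {R : ℝ} (hR : 0 < R) (s : ℝ) :
    (fun ζ : E d => ((bracket R ζ ^ s : ℝ) : ℂ)).HasTemperateGrowth := by
  have h1 : (fun ζ : E d => (1 + ‖ζ‖ ^ 2) ^ (s / 2)).HasTemperateGrowth :=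
    Function.hasTemperateGrowth_one_add_norm_sq_rpow (E d) (s / 2)
  have h2 : (fun ζ : E d => (R ^ s) * (1 + ‖R⁻¹ • ζ‖ ^ 2) ^ (s / 2)).HasTemperateGrowth :=
    (Function.HasTemperateGrowth.const (R ^ s)).mul
      (h1.comp (R⁻¹ • ContinuousLinearMap.id ℝ (E d)).hasTemperateGrowth)
  have h3 : (fun ζ : E d => (R ^ s) * (1 + ‖R⁻¹ • ζ‖ ^ 2) ^ (s / 2)) =
      fun ζ : E d => bracket R ζ ^ s := by
    funext ζ
    rw [norm_smul, Real.norm_of_nonneg (by positivity), bracket, Real.sqrt_eq_rpow,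
      ← Real.rpow_mul (by positivity), show 1 / 2 * s = s / 2 by ring]
    have : R ^ 2 + ‖ζ‖ ^ 2 = R ^ 2 * (1 + (R⁻¹ * ‖ζ‖) ^ 2) := by field_simp
    rw [this, Real.mul_rpow (by positivity) (by positivity)]
    congr 1
    rw [← Real.rpow_natCast, ← Real.rpow_mul hR.le]
    congr 1
    push_cast
    ring
  rw [h3] at h2
  exact Function.Complex.hasTemperateGrowth_ofReal.comp h2

/-- Multiplication of a Schwartz function by the `s`-th power of the bracket at scale `R`. -/
def bracketMul (R s : ℝ) : 𝓢(E d, ℂ) →L[ℂ] 𝓢(E d, ℂ) :=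
  SchwartzMap.smulLeftCLM ℂ fun ζ : E d => ((bracket R ζ ^ s : ℝ) : ℂ)

theorem bracketMul_apply {R : ℝ} (hR : 0 < R) (s : ℝ) (u : 𝓢(E d, ℂ)) (ζ : E d) :
    bracketMul R s u ζ = ((bracket R ζ ^ s : ℝ) : ℂ) * u ζ := by
  rw [bracketMul, SchwartzMap.smulLeftCLM_apply_apply (hasTemperateGrowth_bracket_rpow hR s),
    smul_eq_mul]

theorem bracketMul_bracketMul {R : ℝ} (hR : 0 < R) (s t : ℝ) (u : 𝓢(E d, ℂ)) :
    bracketMul R s (bracketMul R t u) = bracketMul R (s + t) u := by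
  ext ζ
  rw [bracketMul_apply hR, bracketMul_apply hR, bracketMul_apply hR,
    Real.rpow_add (bracket_pos hR ζ)]
  push_cast
  ring

theorem bracketMul_neg_cancel {R : ℝ} (hR : 0 < R) (s : ℝ) (u : 𝓢(E d, ℂ)) :
    bracketMul R s (bracketMul R (-s) u) = u := by
  rw [bracketMul_bracketMul hR, add_neg_cancel]
  ext ζ
  rw [bracketMul_apply hR, Real.rpow_zero, Complex.ofReal_one, one_mul]

theorem inner_bracketMul {R : ℝ} (hR : 0 < R) (s : ℝ) (u v : 𝓢(E d, ℂ)) :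
    inner ℂ (toL2 (bracketMul R s u)) (toL2 v) = inner ℂ (toL2 u) (toL2 (bracketMul R s v)) := by
  rw [inner_toL2, inner_toL2]
  refine integral_congr_ae (Filter.Eventually.of_forall fun ζ => ?_)
  simp only [bracketMul_apply hR]
  rw [← Complex.real_smul, ← Complex.real_smul, inner_smul_right_eq_smul, inner_smul_left_eq_smul]

theorem norm_bracketMul_mono {R : ℝ} (hR : 1 ≤ R) {s t : ℝ} (hst : s ≤ t) (u : 𝓢(E d, ℂ)) :
    ‖toL2 (bracketMul R s u)‖ ≤ ‖toL2 (bracketMul R t u)‖ := by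
  have hR0 : 0 < R := one_pos.trans_le hR
  refine (sq_le_sq₀ (norm_nonneg _) (norm_nonneg _)).mp ?_
  rw [norm_toL2_sq, norm_toL2_sq]
  refine integral_mono (integrable_norm_sq _) (integrable_norm_sq _) fun ζ => ?_
  have h := bracket_nonneg R ζ
  simp only [bracketMul_apply hR0, norm_mul, Complex.norm_real,
    Real.norm_of_nonneg (Real.rpow_nonneg h _)]
  gcongr
  exact hR.trans (le_bracket R ζ)

/-- The bracket is 1-Lipschitz, so its values at `ζ` and `η` have ratio between `(1 + 2ε)⁻¹` and `1
+ ε`. -/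
theorem abs_log_bracket_sub_le {R : ℝ} (hR : 0 < R) {ε : ℝ} (hε : ε ≤ 1 / 2) {ζ η : E d}
    (h : ‖ζ - η‖ ≤ ε * bracket R η) :
    |Real.log (bracket R ζ) - Real.log (bracket R η)| ≤ 2 * ε := by
  have h1 := bracket_pos hR ζ
  have h2 := bracket_pos hR η
  have h3 := bracket_le_add (R := R) ζ η
  have h4 := bracket_le_add (R := R) η ζ
  rw [norm_sub_rev] at h4
  have hε0 : 0 ≤ ε := by
    by_contra! h0
    have := norm_nonneg (ζ - η)
    nlinarith
  rw [abs_le, ← Real.log_div h1.ne' h2.ne']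
  constructor
  · have h5 := Real.one_sub_inv_le_log_of_pos (div_pos h1 h2)
    rw [inv_div] at h5
    have h6 : bracket R η / bracket R ζ ≤ 1 + 2 * ε := by
      rw [div_le_iff₀ h1]
      nlinarith
    linarith
  · have h5 := Real.log_le_sub_one_of_pos (div_pos h1 h2)
    have h6 : bracket R ζ / bracket R η ≤ 1 + ε := by
      rw [div_le_iff₀ h2]
      nlinarith
    linarith

/-- The rescaled frequency centre, where Mathlib's Fourier transform of a packet is centred. -/
def PhaseLattice.center (Ω : PhaseLattice d) (k : ℕ) : E d := (2 * Real.pi)⁻¹ • Ω.freq k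

theorem PhaseLattice.norm_center (Ω : PhaseLattice d) (k : ℕ) :
    ‖Ω.center k‖ = (2 * Real.pi)⁻¹ * ‖Ω.freq k‖ := by
  rw [PhaseLattice.center, norm_smul, Real.norm_of_nonneg (by positivity)]

/-- At large scale `R`, the bracket is nearly constant on the frequency support of each packet. -/
theorem exists_bracket_slow {Ω : PhaseLattice d} {α μ : ℝ} (hα : 0 < α) (hμ : 0 < μ)
    (h : ∀ k, μ ≤ ‖Ω.freq k‖) {c : ℝ} (hc : 0 < c) {ε : ℝ} (hε : 0 < ε) :
    ∃ R₀ : ℝ, 1 ≤ R₀ ∧ ∀ R, R₀ ≤ R → ∀ (k : ℕ) (ζ : E d),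
      ‖ζ - Ω.center k‖ ≤ c * Ω.scale α k →
      |Real.log (bracket R ζ) - Real.log (bracket R (Ω.center k))| ≤ ε := by
  have hπ := Real.pi_pos
  set ε' : ℝ := min (ε / 2) (1 / 2) with hε'
  have hε'0 : 0 < ε' := by positivity
  -- In `2π + 1`, the `2π` comes from `‖freq‖ ≤ 2π * bracket` and the `1` from `R₀ ≤ bracket`.
  obtain ⟨R₀, hR₀, hR⟩ := exists_rpow_one_sub_le hα hμ
    (δ := ε' / (c * (2 * Real.pi + 1))) (by positivity)
  refine ⟨R₀, hR₀, fun R hRR k ζ hζ => ?_⟩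
  have hR0 : 0 < R := by linarith
  have h1 : ‖ζ - Ω.center k‖ ≤ ε' * bracket R (Ω.center k) := by
    refine hζ.trans ?_
    have h2 := hR _ (h k)
    have h3 : ‖Ω.freq k‖ ≤ 2 * Real.pi * bracket R (Ω.center k) := by
      have := norm_le_bracket R (Ω.center k)
      rw [Ω.norm_center, inv_mul_le_iff₀ (by positivity)] at this
      exact this
    have h4 : R₀ ≤ bracket R (Ω.center k) := hRR.trans (le_bracket _ _)
    calc c * Ω.scale α k ≤ c * (ε' / (c * (2 * Real.pi + 1)) * ‖Ω.freq k‖ +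
          ε' / (c * (2 * Real.pi + 1)) * R₀) := by gcongr; exact h2
      _ ≤ c * (ε' / (c * (2 * Real.pi + 1)) * (2 * Real.pi * bracket R (Ω.center k)) +
          ε' / (c * (2 * Real.pi + 1)) * bracket R (Ω.center k)) := by gcongr
      _ = ε' * bracket R (Ω.center k) := by field_simp
  exact (abs_log_bracket_sub_le hR0 (min_le_right _ _) h1).trans (by
    have := min_le_left (ε / 2) (1 / 2)
    linarith)

/-! ### Perturbing a Bessel sequence by a slowly varying weight -/

/-- If a multiplier varies little on the support of each member of a Bessel sequence, then
replacing it by constants there makes a small error. The proof groups the members according to the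
size of the multiplier. -/
theorem synthesisBound_exp_sub_one {ι : Type*} {u v : ι → 𝓢(E d, ℂ)} {B : ℝ} (hB : 0 ≤ B)
    (hu : SynthesisBound B fun p => toL2 (u p)) {Λ : E d → ℝ} {ℓ : ι → ℝ} {ε : ℝ} (hε : 0 < ε)
    (hε' : ε ≤ 1 / 2) (hΛ : ∀ p ζ, u p ζ ≠ 0 → |Λ ζ - ℓ p| ≤ ε)
    (hv : ∀ p ζ, v p ζ = ((Real.exp (Λ ζ - ℓ p) - 1 : ℝ) : ℂ) * u p ζ) :
    SynthesisBound (200 * ε ^ 2 * B) fun p => toL2 (v p) := by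
  classical
  intro F c
  -- Group by the integer part of `ℓ / ε`. Within the group `m`, the constants `ℓ p` may be replaced
  -- by `m * ε` at the price of the factors `a p`, which lie within `2ε` of one. The group sum `V m`
  -- is then a single function of `ζ` times `A m`, plus the small error `D m`.
  let n : ι → ℤ := fun p => ⌊ℓ p / ε⌋
  let G : ℤ → Finset ι := fun m => F.filter fun p => n p = m
  let a : ι → ℝ := fun p => Real.exp (n p * ε - ℓ p)
  let A : ℤ → 𝓢(E d, ℂ) := fun m => ∑ p ∈ G m, (c p * a p) • u p
  let D : ℤ → 𝓢(E d, ℂ) := fun m => ∑ p ∈ G m, (c p * (a p - 1 : ℝ)) • u p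
  let V : ℤ → 𝓢(E d, ℂ) := fun m => ∑ p ∈ G m, c p • v p
  have hn : ∀ p, |n p * ε - ℓ p| ≤ ε ∧ n p * ε - ℓ p ≤ 0 := by
    intro p
    have h1 := Int.floor_le (ℓ p / ε)
    have h2 := Int.lt_floor_add_one (ℓ p / ε)
    rw [le_div_iff₀ hε] at h1
    rw [div_lt_iff₀ hε] at h2
    constructor
    · rw [abs_le]; constructor <;> simp only [n] <;> nlinarith
    · simp only [n]; linarith
  have ha : ∀ p, ‖c p * a p‖ ≤ ‖c p‖ := by
    intro p
    rw [norm_mul, Complex.norm_real, Real.norm_of_nonneg (Real.exp_nonneg _)]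
    exact mul_le_of_le_one_right (norm_nonneg _) (Real.exp_le_one_iff.mpr (hn p).2)
  have ha' : ∀ p, ‖c p * (a p - 1 : ℝ)‖ ≤ 2 * ε * ‖c p‖ := by
    intro p
    rw [norm_mul, Complex.norm_real, mul_comm]
    gcongr
    have := Real.abs_exp_sub_one_le (x := n p * ε - ℓ p) ((hn p).1.trans (by linarith))
    rw [Real.norm_eq_abs]
    linarith [(hn p).1]
  have sum_apply : ∀ (s : Finset ι) (b : ι → ℂ) (w : ι → 𝓢(E d, ℂ)) (ζ : E d),
      (∑ p ∈ s, b p • w p) ζ = ∑ p ∈ s, b p * w p ζ := by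
    intro s b w ζ
    induction s using Finset.induction_on with
    | empty => simp
    | insert q s hq ih => rw [Finset.sum_insert hq, Finset.sum_insert hq, _root_.add_apply, ih,
        _root_.smul_apply, smul_eq_mul]
  have hA : ∀ m, ‖toL2 (A m)‖ ^ 2 ≤ B * ∑ p ∈ G m, ‖c p‖ ^ 2 := by
    intro m
    simp only [A, map_sum, map_smul]
    refine (hu (G m) _).trans ?_
    gcongr with p _
    exact ha p
  have hD : ∀ m, ‖toL2 (D m)‖ ^ 2 ≤ 4 * ε ^ 2 * B * ∑ p ∈ G m, ‖c p‖ ^ 2 := by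
    intro m
    simp only [D, map_sum, map_smul]
    refine (hu (G m) _).trans ?_
    rw [mul_comm (4 * ε ^ 2), mul_assoc]
    refine mul_le_mul_of_nonneg_left ?_ hB
    rw [Finset.mul_sum]
    refine Finset.sum_le_sum fun p _ => ?_
    calc _ ≤ (2 * ε * ‖c p‖) ^ 2 := by gcongr; exact ha' p
      _ = _ := by ring
  have hVeq : ∀ m ζ, V m ζ = ((Real.exp (Λ ζ - m * ε) - 1 : ℝ) : ℂ) * A m ζ + D m ζ := by
    intro m ζ
    simp only [V, A, D, sum_apply, Finset.mul_sum, ← Finset.sum_add_distrib]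
    refine Finset.sum_congr rfl fun p hp => ?_
    have hpm : n p = m := (Finset.mem_filter.mp hp).2
    have h1 : Real.exp (Λ ζ - ℓ p) = Real.exp (Λ ζ - m * ε) * a p := by
      simp only [a]
      rw [← Real.exp_add, hpm]
      congr 1
      ring
    rw [hv, h1]
    push_cast
    ring
  have hnear : ∀ m ζ, (∃ p ∈ G m, u p ζ ≠ 0) → |Λ ζ - m * ε| ≤ 2 * ε := by
    rintro m ζ ⟨p, hp, hpζ⟩
    have hpm : n p = m := (Finset.mem_filter.mp hp).2
    have h1 := abs_le.mp (hΛ p ζ hpζ)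
    have h2 := abs_le.mp (hn p).1
    rw [hpm] at h2
    rw [abs_le]
    constructor <;> linarith
  have hzero : ∀ m ζ, ¬ (∃ p ∈ G m, u p ζ ≠ 0) → V m ζ = 0 := by
    intro m ζ h
    push Not at h
    simp only [V, sum_apply]
    refine Finset.sum_eq_zero fun p hp => ?_
    rw [hv, h p hp, mul_zero, mul_zero]
  have hV : ∀ m ζ, ‖V m ζ‖ ^ 2 ≤ 32 * ε ^ 2 * ‖A m ζ‖ ^ 2 + 2 * ‖D m ζ‖ ^ 2 := by
    intro m ζ
    by_cases h : ∃ p ∈ G m, u p ζ ≠ 0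
    · have h1 := hnear m ζ h
      have h2 := Real.abs_exp_sub_one_le (x := Λ ζ - m * ε) (h1.trans (by linarith))
      have h3 : ‖V m ζ‖ ≤ 4 * ε * ‖A m ζ‖ + ‖D m ζ‖ := by
        rw [hVeq]
        refine (norm_add_le _ _).trans (add_le_add_left ?_ _)
        rw [norm_mul, Complex.norm_real, Real.norm_eq_abs]
        refine mul_le_mul_of_nonneg_right ?_ (norm_nonneg _)
        linarith
      have h4 : ‖V m ζ‖ ^ 2 ≤ (4 * ε * ‖A m ζ‖ + ‖D m ζ‖) ^ 2 := by gcongr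
      nlinarith [sq_nonneg (4 * ε * ‖A m ζ‖ - ‖D m ζ‖)]
    · rw [hzero m ζ h, norm_zero, zero_pow two_ne_zero]
      positivity
  let S := F.image n
  have hsum : ∑ p ∈ F, c p • v p = ∑ m ∈ S, V m :=
    (Finset.sum_fiberwise_of_maps_to (fun p hp => Finset.mem_image_of_mem n hp) _).symm
  have hoverlap : ∀ ζ, ‖(∑ m ∈ S, V m) ζ‖ ^ 2 ≤ 5 * ∑ m ∈ S, ‖V m ζ‖ ^ 2 := by
    intro ζ
    have h0 : (∑ m ∈ S, V m) ζ = ∑ m ∈ S, V m ζ := by simp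
    set S' := S.filter fun m => V m ζ ≠ 0 with hS'
    have h1 : ∑ m ∈ S, V m ζ = ∑ m ∈ S', V m ζ := by rw [hS', Finset.sum_filter_ne_zero]
    -- A group can be active at `ζ` only if `m * ε` is within `2ε` of `Λ ζ`, which leaves at most
    -- five values of `m`.
    have hcard : (S'.card : ℝ) ≤ 5 := by
      have hsub : S' ⊆ Finset.Icc (⌊Λ ζ / ε⌋ - 2) (⌊Λ ζ / ε⌋ + 2) := by
        intro m hm
        have hm' : ∃ p ∈ G m, u p ζ ≠ 0 := by
          by_contra h
          exact (Finset.mem_filter.mp hm).2 (hzero m ζ h)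
        have h2 := abs_le.mp (hnear m ζ hm')
        have h3 := Int.floor_le (Λ ζ / ε)
        have h4 := Int.lt_floor_add_one (Λ ζ / ε)
        rw [le_div_iff₀ hε] at h3
        rw [div_lt_iff₀ hε] at h4
        have h5 : (⌊Λ ζ / ε⌋ : ℝ) ≤ m + 2 := by
          refine le_of_mul_le_mul_right ?_ hε
          linarith
        have h6 : (m : ℝ) < ⌊Λ ζ / ε⌋ + 3 := by
          refine lt_of_mul_lt_mul_right ?_ hε.le
          linarith
        have h7 : (⌊Λ ζ / ε⌋ : ℤ) ≤ m + 2 := by exact_mod_cast h5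
        have h8 : (m : ℤ) < ⌊Λ ζ / ε⌋ + 3 := by exact_mod_cast h6
        rw [Finset.mem_Icc]
        omega
      have := Finset.card_le_card hsub
      rw [Int.card_Icc] at this
      have h9 : S'.card ≤ 5 := by omega
      exact_mod_cast h9
    rw [h0, h1]
    have h2 : ‖∑ m ∈ S', V m ζ‖ ^ 2 ≤ (∑ m ∈ S', ‖V m ζ‖) ^ 2 := by
      gcongr
      exact norm_sum_le _ _
    have h3 : (∑ m ∈ S', ‖V m ζ‖) ^ 2 ≤ S'.card * ∑ m ∈ S', ‖V m ζ‖ ^ 2 :=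
      sq_sum_le_card_mul_sum_sq
    have h4 : ∑ m ∈ S', ‖V m ζ‖ ^ 2 ≤ ∑ m ∈ S, ‖V m ζ‖ ^ 2 :=
      Finset.sum_le_sum_of_subset_of_nonneg (Finset.filter_subset _ _) fun _ _ _ => by positivity
    have h5 : 0 ≤ ∑ m ∈ S', ‖V m ζ‖ ^ 2 := Finset.sum_nonneg fun _ _ => by positivity
    calc _ ≤ _ := h2.trans h3
      _ ≤ 5 * ∑ m ∈ S', ‖V m ζ‖ ^ 2 := by gcongr
      _ ≤ _ := by gcongr
  have hL2 : ‖toL2 (∑ m ∈ S, V m)‖ ^ 2 ≤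
      5 * ∑ m ∈ S, (32 * ε ^ 2 * ‖toL2 (A m)‖ ^ 2 + 2 * ‖toL2 (D m)‖ ^ 2) := by
    simp only [norm_toL2_sq]
    have hint : ∀ m, Integrable fun ζ => 32 * ε ^ 2 * ‖A m ζ‖ ^ 2 + 2 * ‖D m ζ‖ ^ 2 :=
      fun m => ((integrable_norm_sq _).const_mul _).add ((integrable_norm_sq _).const_mul _)
    have h1 : 5 * ∑ m ∈ S, (32 * ε ^ 2 * (∫ ζ, ‖A m ζ‖ ^ 2) + 2 * ∫ ζ, ‖D m ζ‖ ^ 2) =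
        ∫ ζ, 5 * ∑ m ∈ S, (32 * ε ^ 2 * ‖A m ζ‖ ^ 2 + 2 * ‖D m ζ‖ ^ 2) := by
      rw [integral_const_mul, integral_finsetSum _ fun m _ => hint m]
      congr 1
      refine Finset.sum_congr rfl fun m _ => ?_
      rw [integral_add ((integrable_norm_sq _).const_mul _) ((integrable_norm_sq _).const_mul _),
        integral_const_mul, integral_const_mul]
    rw [h1]
    refine integral_mono (integrable_norm_sq _)
      ((integrable_finsetSum _ fun m _ => hint m).const_mul _) fun ζ => ?_
    refine (hoverlap ζ).trans ?_
    gcongr with m _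
    exact hV m ζ
  have hfinal : ∑ p ∈ F, ‖c p‖ ^ 2 = ∑ m ∈ S, ∑ p ∈ G m, ‖c p‖ ^ 2 :=
    (Finset.sum_fiberwise_of_maps_to (fun p hp => Finset.mem_image_of_mem n hp) _).symm
  have hlin : ∑ p ∈ F, c p • toL2 (v p) = toL2 (∑ m ∈ S, V m) := by
    rw [← hsum]
    simp only [map_sum, map_smul]
  -- The constant is `5 * (32 + 2 * 4) = 200`: five overlapping groups, with `32 ε² B` from `A m`
  -- and `2 * 4 ε² B` from `D m`.
  rw [hlin, hfinal]
  refine hL2.trans ?_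
  rw [Finset.mul_sum, Finset.mul_sum]
  refine Finset.sum_le_sum fun m _ => ?_
  have h1 := hA m
  have h2 := hD m
  have h3 : 32 * ε ^ 2 * ‖toL2 (A m)‖ ^ 2 ≤ 32 * ε ^ 2 * (B * ∑ p ∈ G m, ‖c p‖ ^ 2) := by gcongr
  nlinarith

end

section

/-! ### Weighted bounds for frame sums -/

section Hilbert

variable {ι H : Type*} [NormedAddCommGroup H] [InnerProductSpace ℂ H]

/-- One step of the frame algorithm reduces the norm. -/
theorem SynthesisBound.norm_sub_frame_le {e : ι → H} {A B : ℝ} (hB : 0 < B)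
    (h : SynthesisBound B e) (F : Finset ι) (y : H)
    (hF : A / 2 * ‖y‖ ^ 2 ≤ ∑ p ∈ F, ‖inner ℂ (e p) y‖ ^ 2) :
    ‖y - ((B⁻¹ : ℝ) : ℂ) • ∑ p ∈ F, inner ℂ (e p) y • e p‖ ≤ √(1 - A / (2 * B)) * ‖y‖ := by
  set S := ∑ p ∈ F, ‖inner ℂ (e p) y‖ ^ 2 with hS
  set Y := ∑ p ∈ F, inner ℂ (e p) y • e p with hY
  have h1 : inner ℂ Y y = (S : ℂ) := by
    rw [hY, sum_inner, hS, Complex.ofReal_sum]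
    refine Finset.sum_congr rfl fun p _ => ?_
    rw [inner_smul_left, RCLike.conj_mul]
    simp
  have h2 : ‖Y‖ ^ 2 ≤ B * S := h F _
  -- Expanding the square gives `‖y‖² - 2S/B + ‖Y‖²/B²`, which is at most `‖y‖² - S/B` because `‖Y‖²
  -- ≤ B S`.
  have h3 : ‖y - ((B⁻¹ : ℝ) : ℂ) • Y‖ ^ 2 ≤ (1 - A / (2 * B)) * ‖y‖ ^ 2 := by
    rw [norm_sub_sq (𝕜 := ℂ), inner_smul_right, ← inner_conj_symm, h1, norm_smul, Complex.norm_real,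
      Real.norm_of_nonneg (by positivity)]
    simp only [Complex.conj_ofReal, RCLike.re_to_complex]
    rw [← Complex.ofReal_mul, Complex.ofReal_re, mul_pow]
    have h4 : (B⁻¹) ^ 2 * ‖Y‖ ^ 2 ≤ B⁻¹ * S := by
      calc (B⁻¹) ^ 2 * ‖Y‖ ^ 2 ≤ (B⁻¹) ^ 2 * (B * S) := by gcongr
        _ = B⁻¹ * S := by field_simp
    have h5 : A / (2 * B) * ‖y‖ ^ 2 ≤ B⁻¹ * S := by
      calc A / (2 * B) * ‖y‖ ^ 2 = B⁻¹ * (A / 2 * ‖y‖ ^ 2) := by field_simp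
        _ ≤ _ := by gcongr
    linarith
  rw [← Real.sqrt_sq (norm_nonneg y), ← Real.sqrt_mul' _ (by positivity)]
  exact Real.le_sqrt_of_sq_le h3

/-- One step of the frame algorithm with slightly perturbed analysis and synthesis families. -/
theorem SynthesisBound.norm_sub_perturbed_frame_le {e e' e'' : ι → H} {A B ε : ℝ} (hB : 0 < B)
    (hε : 0 ≤ ε) (hbe : SynthesisBound B e) (hbe' : SynthesisBound (102 * B) e')
    (hd' : SynthesisBound (200 * ε ^ 2 * B) fun p => e' p - e p)
    (hd'' : SynthesisBound (200 * ε ^ 2 * B) fun p => e'' p - e p) (F : Finset ι) (y : H)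
    (hF : A / 2 * ‖y‖ ^ 2 ≤ ∑ p ∈ F, ‖inner ℂ (e p) y‖ ^ 2) :
    ‖y - ((B⁻¹ : ℝ) : ℂ) • ∑ p ∈ F, inner ℂ (e'' p) y • e' p‖ ≤
      (√(1 - A / (2 * B)) + 180 * ε) * ‖y‖ := by
  have h1 := hbe.norm_sub_frame_le hB F y hF
  have h2 : y - ((B⁻¹ : ℝ) : ℂ) • ∑ p ∈ F, inner ℂ (e'' p) y • e' p =
      (y - ((B⁻¹ : ℝ) : ℂ) • ∑ p ∈ F, inner ℂ (e p) y • e p) -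
      ((B⁻¹ : ℝ) : ℂ) • (∑ p ∈ F, inner ℂ (e p) y • (e' p - e p) +
        ∑ p ∈ F, inner ℂ (e'' p - e p) y • e' p) := by
    have : ∑ p ∈ F, inner ℂ (e'' p) y • e' p = ∑ p ∈ F, inner ℂ (e p) y • e p +
        (∑ p ∈ F, inner ℂ (e p) y • (e' p - e p) + ∑ p ∈ F, inner ℂ (e'' p - e p) y • e' p) := by
      rw [← Finset.sum_add_distrib, ← Finset.sum_add_distrib]
      refine Finset.sum_congr rfl fun p _ => ?_
      rw [inner_sub_left, smul_sub, sub_smul]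
      abel
    rw [this, smul_add, sub_sub]
  have sqrt_bound : ∀ {a b S : ℝ}, 0 ≤ a → 0 ≤ b → S ≤ b * ‖y‖ ^ 2 →
      √a * √S ≤ √(a * b) * ‖y‖ := by
    intro a b S ha hb hS
    calc √a * √S ≤ √a * √(b * ‖y‖ ^ 2) := by gcongr
      _ = √(a * b) * ‖y‖ := by
        rw [Real.sqrt_mul hb, Real.sqrt_sq (norm_nonneg y), Real.sqrt_mul ha, mul_assoc]
  -- Here `15` exceeds `√200`, and `165` below exceeds `√(102 * 200)`; they add up to `180`.
  have h3 : ‖∑ p ∈ F, inner ℂ (e p) y • (e' p - e p)‖ ≤ 15 * ε * B * ‖y‖ := by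
    refine (hd'.norm_sum_le F _).trans ((sqrt_bound (by positivity) hB.le
      (hbe.analysis hB.le F y)).trans ?_)
    gcongr
    refine Real.sqrt_le_iff.mpr ⟨by positivity, ?_⟩
    nlinarith [sq_nonneg (ε * B)]
  have h4 : ‖∑ p ∈ F, inner ℂ (e'' p - e p) y • e' p‖ ≤ 165 * ε * B * ‖y‖ := by
    refine (hbe'.norm_sum_le F _).trans ((sqrt_bound (by positivity) (by positivity)
      (hd''.analysis (by positivity) F y)).trans ?_)
    gcongr
    refine Real.sqrt_le_iff.mpr ⟨by positivity, ?_⟩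
    nlinarith [sq_nonneg (ε * B)]
  rw [h2]
  refine (norm_sub_le _ _).trans ?_
  rw [norm_smul, Complex.norm_real, Real.norm_of_nonneg (by positivity), add_mul]
  refine add_le_add h1 ?_
  calc B⁻¹ * _ ≤ B⁻¹ * (15 * ε * B * ‖y‖ + 165 * ε * B * ‖y‖) := by
        gcongr
        exact (norm_add_le _ _).trans (add_le_add h3 h4)
    _ = 180 * ε * ‖y‖ := by field_simp; ring

end Hilbert

/-! ### Packets on the frequency side -/

theorem fourier_sub_schwartz (u v : 𝓢(E d, ℂ)) : 𝓕 (u - v) = 𝓕 u - 𝓕 v :=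
  map_sub (fourierCLM ℂ 𝓢(E d, ℂ)) u v

/-- The Fourier transform of a lattice packet. -/
def freqPacket (α : ℝ) (g : 𝓢(E d, ℂ)) (Ω : PhaseLattice d) (p : ℕ × (Fin d → ℤ)) : 𝓢(E d, ℂ) :=
  𝓕 (latticePacket α g Ω p.1 p.2)

/-- The packet on the frequency side, multiplied by a power of the bracket that is normalized to
equal one at the centre of the packet. -/
def weightedPacket (α : ℝ) (g : 𝓢(E d, ℂ)) (Ω : PhaseLattice d) (R s : ℝ)
    (p : ℕ × (Fin d → ℤ)) : 𝓢(E d, ℂ) :=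
  ((bracket R (Ω.center p.1) ^ (-s) : ℝ) : ℂ) • bracketMul R s (freqPacket α g Ω p)

/-- The logarithm of the bracket varies by at most `η` on the frequency supports. -/
def SlowBracket (α c : ℝ) (Ω : PhaseLattice d) (R η : ℝ) : Prop :=
  ∀ (k : ℕ) (ζ : E d), ‖ζ - Ω.center k‖ ≤ c * Ω.scale α k →
    |Real.log (bracket R ζ) - Real.log (bracket R (Ω.center k))| ≤ η

variable {α c R η : ℝ} {Ω : PhaseLattice d} {g h : 𝓢(E d, ℂ)}

theorem synthesisBound_freqPacket {B : ℝ} (hg : SynthesisBound B fun p : ℕ × (Fin d → ℤ) =>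
    toL2 (latticePacket α g Ω p.1 p.2)) :
    SynthesisBound B fun p => toL2 (freqPacket α g Ω p) := by
  intro F a
  refine le_trans (le_of_eq ?_) (hg F a)
  have h1 : ∑ p ∈ F, a p • toL2 (freqPacket α g Ω p) =
      toL2 (𝓕 (∑ p ∈ F, a p • latticePacket α g Ω p.1 p.2)) := by
    simp only [FourierTransform.fourier_sum, FourierTransform.fourier_smul, map_sum, map_smul]
    rfl
  rw [h1, norm_toL2_fourier]
  simp only [map_sum, map_smul]

/-- The normalized weight is `exp (s * (log bracket ζ - log bracket center))`, whose exponent is at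
most `ε` in modulus on the packet's frequency support. -/
theorem synthesisBound_weightedPacket_sub (hR : 0 < R) (hs : SlowBracket α c Ω R η)
    (hgc : BandLimited c g) {B : ℝ} (hB : 0 ≤ B)
    (hg : SynthesisBound B fun p : ℕ × (Fin d → ℤ) => toL2 (latticePacket α g Ω p.1 p.2))
    {s ε : ℝ} (hε : 0 < ε) (hε' : ε ≤ 1 / 2) (hsε : |s| * η ≤ ε) :
    SynthesisBound (200 * ε ^ 2 * B) fun p =>
      toL2 (weightedPacket α g Ω R s p - freqPacket α g Ω p) := by
  refine synthesisBound_exp_sub_one hB (synthesisBound_freqPacket hg)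
    (Λ := fun ζ => s * Real.log (bracket R ζ))
    (ℓ := fun p => s * Real.log (bracket R (Ω.center p.1))) hε hε' ?_ ?_
  · intro p ζ hζ
    rw [← mul_sub, abs_mul]
    exact (mul_le_mul_of_nonneg_left (hs p.1 ζ (fourier_latticePacket_support hgc hζ))
      (abs_nonneg s)).trans hsε
  · intro p ζ
    have h1 := bracket_pos hR ζ
    have h2 := bracket_pos hR (Ω.center p.1)
    rw [_root_.sub_apply, weightedPacket, _root_.smul_apply, bracketMul_apply hR, smul_eq_mul,
      Real.rpow_def_of_pos h1, Real.rpow_def_of_pos h2, sub_eq_add_neg (s * _), Real.exp_add]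
    rw [mul_comm s, mul_comm s, mul_neg]
    push_cast
    ring

/-- Taking `ε = 1/2` bounds the difference from the unweighted packets by `50 B`, and `2 * (50 B +
B) = 102 B`. -/
theorem synthesisBound_weightedPacket (hR : 0 < R) (hs : SlowBracket α c Ω R η)
    (hgc : BandLimited c g) {B : ℝ} (hB : 0 ≤ B)
    (hg : SynthesisBound B fun p : ℕ × (Fin d → ℤ) => toL2 (latticePacket α g Ω p.1 p.2))
    {s : ℝ} (hsη : |s| * η ≤ 1 / 2) :
    SynthesisBound (102 * B) fun p => toL2 (weightedPacket α g Ω R s p) := by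
  have h1 := (synthesisBound_weightedPacket_sub hR hs hgc hB hg (by norm_num) le_rfl hsη).add
    (synthesisBound_freqPacket hg)
  simp only [← map_add, sub_add_cancel] at h1
  refine h1.mono (le_of_eq ?_)
  ring

theorem toL2_bracketMul_freqPacket (hR : 0 < R) (s : ℝ) (p : ℕ × (Fin d → ℤ)) :
    toL2 (bracketMul R s (freqPacket α g Ω p)) =
      ((bracket R (Ω.center p.1) ^ s : ℝ) : ℂ) • toL2 (weightedPacket α g Ω R s p) := by
  rw [weightedPacket, map_smul, smul_smul, ← Complex.ofReal_mul,
    ← Real.rpow_add (bracket_pos hR _), add_neg_cancel, Real.rpow_zero, Complex.ofReal_one,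
    one_smul]

/-- Plancherel followed by moving the weight: the power `t` put on `𝓕 ψ` is compensated by the power
`-t` on the packet, normalized at its centre. -/
theorem inner_latticePacket_eq (hR : 0 < R) (t : ℝ) (p : ℕ × (Fin d → ℤ)) (ψ : 𝓢(E d, ℂ)) :
    inner ℂ (toL2 (latticePacket α g Ω p.1 p.2)) (toL2 ψ) =
      ((bracket R (Ω.center p.1) ^ (-t) : ℝ) : ℂ) *
        inner ℂ (toL2 (weightedPacket α g Ω R (-t) p)) (toL2 (bracketMul R t (𝓕 ψ))) := by
  rw [weightedPacket, map_smul, inner_smul_left, Complex.conj_ofReal, ← mul_assoc,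
    ← Complex.ofReal_mul, ← Real.rpow_add (bracket_pos hR _), neg_neg, neg_add_cancel,
    Real.rpow_zero, Complex.ofReal_one, one_mul, ← inner_bracketMul hR, bracketMul_neg_cancel hR,
    freqPacket, inner_toL2_fourier]

/-! ### Sobolev norms of frame sums -/

/-- The Sobolev norm of a Schwartz function, with the bracket at scale `R`. -/
def sobNorm (R s : ℝ) (ψ : 𝓢(E d, ℂ)) : ℝ := ‖toL2 (bracketMul R s (𝓕 ψ))‖

theorem sobNorm_nonneg (R s : ℝ) (ψ : 𝓢(E d, ℂ)) : 0 ≤ sobNorm R s ψ := norm_nonneg _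

theorem sobNorm_add_le (R s : ℝ) (ψ χ : 𝓢(E d, ℂ)) :
    sobNorm R s (ψ + χ) ≤ sobNorm R s ψ + sobNorm R s χ := by
  simp only [sobNorm, FourierTransform.fourier_add, map_add]
  exact norm_add_le _ _

theorem sobNorm_sub_le (R s : ℝ) (ψ χ : 𝓢(E d, ℂ)) :
    sobNorm R s (ψ - χ) ≤ sobNorm R s ψ + sobNorm R s χ := by
  simp only [sobNorm, fourier_sub_schwartz, map_sub]
  exact norm_sub_le _ _

theorem sobNorm_smul (R s : ℝ) (a : ℂ) (ψ : 𝓢(E d, ℂ)) :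
    sobNorm R s (a • ψ) = ‖a‖ * sobNorm R s ψ := by
  simp only [sobNorm, FourierTransform.fourier_smul, map_smul, norm_smul]

theorem sobNorm_mono (hR : 1 ≤ R) {s t : ℝ} (hst : s ≤ t) (ψ : 𝓢(E d, ℂ)) :
    sobNorm R s ψ ≤ sobNorm R t ψ :=
  norm_bracketMul_mono hR hst _

/-- The partial frame-type sum `∑ a_p ⟨ψ, g_p⟩ h_p`. -/
def frameSum (α : ℝ) (g h : 𝓢(E d, ℂ)) (Ω : PhaseLattice d) (a : ℕ × (Fin d → ℤ) → ℂ)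
    (F : Finset (ℕ × (Fin d → ℤ))) (ψ : 𝓢(E d, ℂ)) : 𝓢(E d, ℂ) :=
  ∑ p ∈ F, (a p * inner ℂ (toL2 (latticePacket α g Ω p.1 p.2)) (toL2 ψ)) •
    latticePacket α h Ω p.1 p.2

theorem toL2_bracketMul_fourier_frameSum (hR : 0 < R) (a : ℕ × (Fin d → ℤ) → ℂ)
    (F : Finset (ℕ × (Fin d → ℤ))) (ψ : 𝓢(E d, ℂ)) (s t : ℝ) :
    toL2 (bracketMul R s (𝓕 (frameSum α g h Ω a F ψ))) =
      ∑ p ∈ F, (a p * ((bracket R (Ω.center p.1) ^ (s - t) : ℝ) : ℂ) *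
        inner ℂ (toL2 (weightedPacket α g Ω R (-t) p)) (toL2 (bracketMul R t (𝓕 ψ)))) •
        toL2 (weightedPacket α h Ω R s p) := by
  simp only [frameSum, FourierTransform.fourier_sum, FourierTransform.fourier_smul, map_sum,
    map_smul]
  refine Finset.sum_congr rfl fun p _ => ?_
  have h1 := toL2_bracketMul_freqPacket (α := α) (g := h) (Ω := Ω) hR s p
  rw [freqPacket] at h1
  rw [h1, inner_latticePacket_eq hR t, smul_smul, sub_eq_add_neg,
    Real.rpow_add (bracket_pos hR _)]
  congr 1
  push_cast
  ring

/-- Frame-type sums are bounded between weighted spaces. -/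
theorem sobNorm_frameSum_le (hR : 0 < R) (hs : SlowBracket α c Ω R η)
    (hgc : BandLimited c g) (hhc : BandLimited c h) {B B' : ℝ} (hB : 0 ≤ B) (hB' : 0 ≤ B')
    (hg : SynthesisBound B fun p : ℕ × (Fin d → ℤ) => toL2 (latticePacket α g Ω p.1 p.2))
    (hh : SynthesisBound B' fun p : ℕ × (Fin d → ℤ) => toL2 (latticePacket α h Ω p.1 p.2))
    {s t : ℝ} (hsη : |s| * η ≤ 1 / 2) (htη : |t| * η ≤ 1 / 2)
    {a : ℕ × (Fin d → ℤ) → ℂ} {A : ℝ}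
    (ha : ∀ p, ‖a p‖ * bracket R (Ω.center p.1) ^ s ≤ A * bracket R (Ω.center p.1) ^ t)
    (F : Finset (ℕ × (Fin d → ℤ))) (ψ : 𝓢(E d, ℂ)) :
    sobNorm R s (frameSum α g h Ω a F ψ) ≤ √(102 * B') * (A * √(102 * B)) * sobNorm R t ψ := by
  have hA : 0 ≤ A := by
    have h1 := ha (0, 0)
    have h2 := Real.rpow_pos_of_pos (bracket_pos hR (Ω.center 0)) t
    have h3 := Real.rpow_pos_of_pos (bracket_pos hR (Ω.center 0)) s
    refine le_of_mul_le_mul_right (le_trans ?_ h1) h2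
    rw [zero_mul]
    positivity
  unfold sobNorm
  rw [toL2_bracketMul_fourier_frameSum hR a F ψ s t, mul_assoc]
  set y := toL2 (bracketMul R t (𝓕 ψ))
  refine ((synthesisBound_weightedPacket hR hs hhc hB' hh hsη).norm_sum_le F _).trans
    (mul_le_mul_of_nonneg_left ?_ (Real.sqrt_nonneg _))
  have h1 := (synthesisBound_weightedPacket hR hs hgc hB hg (s := -t)
    (by rwa [abs_neg])).analysis (by positivity) F y
  have h2 : ∑ p ∈ F, ‖a p * ((bracket R (Ω.center p.1) ^ (s - t) : ℝ) : ℂ) *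
      inner ℂ (toL2 (weightedPacket α g Ω R (-t) p)) y‖ ^ 2 ≤ A ^ 2 * (102 * B * ‖y‖ ^ 2) := by
    refine le_trans ?_ (mul_le_mul_of_nonneg_left h1 (sq_nonneg A))
    rw [Finset.mul_sum]
    refine Finset.sum_le_sum fun p _ => ?_
    have hJ := bracket_pos hR (Ω.center p.1)
    rw [norm_mul, mul_pow, norm_mul, Complex.norm_real, Real.norm_of_nonneg (by positivity)]
    gcongr
    rw [Real.rpow_sub hJ, ← mul_div_assoc, div_le_iff₀ (by positivity)]
    exact ha p
  calc _ ≤ √(A ^ 2 * (102 * B * ‖y‖ ^ 2)) := Real.sqrt_le_sqrt h2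
    _ = _ := by
      rw [Real.sqrt_mul (by positivity), Real.sqrt_sq hA, Real.sqrt_mul (by positivity),
        Real.sqrt_sq (norm_nonneg _), mul_assoc]

/-- One step of the frame algorithm contracts a weighted norm, when the weight varies slowly. -/
theorem sobNorm_sub_frameSum_le (hR : 0 < R) (hs : SlowBracket α c Ω R η)
    (hgc : BandLimited c g) {A B : ℝ} (hB : 0 < B)
    (hg : SynthesisBound B fun p : ℕ × (Fin d → ℤ) => toL2 (latticePacket α g Ω p.1 p.2))
    {s ε : ℝ} (hε : 0 < ε) (hε' : ε ≤ 1 / 2) (hsε : |s| * η ≤ ε)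
    (F : Finset (ℕ × (Fin d → ℤ))) (ψ : 𝓢(E d, ℂ))
    (hF : A / 2 * ‖toL2 (bracketMul R s (𝓕 ψ))‖ ^ 2 ≤
      ∑ p ∈ F, ‖inner ℂ (toL2 (freqPacket α g Ω p)) (toL2 (bracketMul R s (𝓕 ψ)))‖ ^ 2) :
    sobNorm R s (ψ - ((B⁻¹ : ℝ) : ℂ) • frameSum α g g Ω 1 F ψ) ≤
      (√(1 - A / (2 * B)) + 180 * ε) * sobNorm R s ψ := by
  unfold sobNorm
  rw [fourier_sub_schwartz, FourierTransform.fourier_smul, map_sub, map_sub, map_smul,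
    map_smul, toL2_bracketMul_fourier_frameSum hR 1 F ψ s s]
  set y := toL2 (bracketMul R s (𝓕 ψ))
  simp only [sub_self, Real.rpow_zero, Pi.one_apply, Complex.ofReal_one, one_mul]
  -- With equal input and output weights, the scalar factors at the centres are `1`. What remains is
  -- a frame step with synthesis weight `s` and analysis weight `-s`, a small perturbation of the
  -- unweighted one.
  refine (synthesisBound_freqPacket hg).norm_sub_perturbed_frame_le hB hε.le
    (synthesisBound_weightedPacket hR hs hgc hB.le hg (hsε.trans hε')) ?_ ?_ F y hF
  · simpa only [map_sub] using synthesisBound_weightedPacket_sub hR hs hgc hB.le hg hε hε' hsε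
  · simpa only [map_sub] using synthesisBound_weightedPacket_sub hR hs hgc hB.le hg (s := -s) hε
      hε' (by rwa [abs_neg])

end

section

/-! ### Commutators of frame sums with coordinate multiplication -/

variable {α c R η : ℝ} {Ω : PhaseLattice d} {g h : 𝓢(E d, ℂ)}

theorem inner_coordMul (v : E d) (u w : 𝓢(E d, ℂ)) :
    inner ℂ (toL2 (coordMul v u)) (toL2 w) = inner ℂ (toL2 u) (toL2 (coordMul v w)) := by
  rw [inner_toL2, inner_toL2]
  refine integral_congr_ae (Filter.Eventually.of_forall fun ζ => ?_)
  simp only [coordMul_apply]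
  rw [← Complex.real_smul, ← Complex.real_smul, inner_smul_right_eq_smul, inner_smul_left_eq_smul]

theorem coordMul_latticePacket (v : E d) (k : ℕ) (j : Fin d → ℤ) :
    coordMul v (latticePacket α g Ω k j) =
      ((inner ℝ (Ω.pos k j) v : ℝ) : ℂ) • latticePacket α g Ω k j +
      (((Ω.scale α k)⁻¹ : ℝ) : ℂ) • latticePacket α (coordMul v g) Ω k j :=
  coordMul_packet α g (Ω.pos k j) (Ω.freq k) (Ω.freq_ne_zero k) v

/-- The contributions of the real centre coordinate `x · v` in analysis and synthesis cancel. The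
remaining terms again are frame sums, with one window multiplied by the coordinate and one more
inverse scale in the coefficients. -/
theorem coordMul_frameSum (v : E d) (a : ℕ × (Fin d → ℤ) → ℂ) (F : Finset (ℕ × (Fin d → ℤ)))
    (ψ : 𝓢(E d, ℂ)) :
    coordMul v (frameSum α g h Ω a F ψ) = frameSum α g h Ω a F (coordMul v ψ) +
      frameSum α g (coordMul v h) Ω (fun p => a p * (((Ω.scale α p.1)⁻¹ : ℝ) : ℂ)) F ψ -
      frameSum α (coordMul v g) h Ω (fun p => a p * (((Ω.scale α p.1)⁻¹ : ℝ) : ℂ)) F ψ := by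
  simp only [frameSum, map_sum, map_smul, ← Finset.sum_add_distrib, ← Finset.sum_sub_distrib]
  refine Finset.sum_congr rfl fun p _ => ?_
  rw [← inner_coordMul, coordMul_latticePacket, coordMul_latticePacket, map_add, map_smul, map_smul,
    inner_add_left, inner_smul_left, inner_smul_left, Complex.conj_ofReal, Complex.conj_ofReal]
  module

/-- The commutator of a frame sum with a power of a coordinate loses only lower powers, at the
price of a power of the bracket. -/
theorem exists_commutator_le (hR : 0 < R) (hs : SlowBracket α c Ω R η)
    (hbessel : ∀ g : 𝓢(E d, ℂ), BandLimited c g → ∃ B : ℝ, 0 ≤ B ∧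
      SynthesisBound B fun p : ℕ × (Fin d → ℤ) => toL2 (latticePacket α g Ω p.1 p.2))
    {T : ℝ} (hη : 0 ≤ η) (hT : T * η ≤ 1 / 2) {M A₀ : ℝ} (hM : 0 ≤ M)
    (hA₀ : ∀ k, (Ω.scale α k)⁻¹ ≤ A₀ * bracket R (Ω.center k) ^ M) (v : E d) (n : ℕ) :
    ∀ (k : ℕ) (g h : 𝓢(E d, ℂ)) (σ : ℝ), BandLimited c g → BandLimited c h →
      |σ| + M * (n + k) ≤ T →
      ∃ C : ℝ, 0 ≤ C ∧ ∀ (a : ℕ × (Fin d → ℤ) → ℂ) (F : Finset (ℕ × (Fin d → ℤ)))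
        (ψ : 𝓢(E d, ℂ)), (∀ p, ‖a p‖ ≤ (Ω.scale α p.1)⁻¹ ^ k) →
        sobNorm R σ ((coordMul v)^[n] (frameSum α g h Ω a F ψ) -
          frameSum α g h Ω a F ((coordMul v)^[n] ψ)) ≤
        C * ∑ m ∈ Finset.range n, sobNorm R (σ + M * (n - m + k)) ((coordMul v)^[m] ψ) := by
  -- Each inverse scale in the coefficients costs at most `M` orders of the bracket.
  have hbdd : ∀ (k : ℕ) (g h : 𝓢(E d, ℂ)) (σ : ℝ), BandLimited c g → BandLimited c h →
      |σ| + M * k ≤ T → ∃ C : ℝ, 0 ≤ C ∧ ∀ (a : ℕ × (Fin d → ℤ) → ℂ)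
        (F : Finset (ℕ × (Fin d → ℤ))) (ψ : 𝓢(E d, ℂ)), (∀ p, ‖a p‖ ≤ (Ω.scale α p.1)⁻¹ ^ k) →
        sobNorm R σ (frameSum α g h Ω a F ψ) ≤ C * sobNorm R (σ + M * k) ψ := by
    intro k g h σ hg hh hσ
    obtain ⟨B, hB, hBg⟩ := hbessel g hg
    obtain ⟨B', hB', hBh⟩ := hbessel h hh
    have hA₀0 : 0 ≤ A₀ := by
      have h1 := (inv_pos.mpr (Ω.scale_pos α 0)).le.trans (hA₀ 0)
      exact nonneg_of_mul_nonneg_left h1 (Real.rpow_pos_of_pos (bracket_pos hR _) _)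
    refine ⟨√(102 * B') * (A₀ ^ k * √(102 * B)), by positivity, fun a F ψ ha => ?_⟩
    have hMk : 0 ≤ M * k := by positivity
    refine sobNorm_frameSum_le hR hs hg hh hB hB' hBg hBh ?_ ?_ (fun p => ?_) F ψ
    · exact (mul_le_mul_of_nonneg_right (by linarith) hη).trans hT
    · refine (mul_le_mul_of_nonneg_right ?_ hη).trans hT
      refine (abs_add_le _ _).trans ?_
      rwa [abs_of_nonneg hMk]
    · have hJ := bracket_pos hR (Ω.center p.1)
      have h1 : ‖a p‖ ≤ A₀ ^ k * bracket R (Ω.center p.1) ^ (M * k) := by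
        refine (ha p).trans ?_
        rw [Real.rpow_mul hJ.le, Real.rpow_natCast, ← mul_pow]
        exact pow_le_pow_left₀ (inv_pos.mpr (Ω.scale_pos α p.1)).le (hA₀ p.1) k
      rw [add_comm, Real.rpow_add hJ, ← mul_assoc]
      gcongr
  -- The windows, `k` and `σ` stay general, because each commutation changes one window and raises
  -- `k` by one. The budget `M * (n + k)` is preserved, so one bound `T` covers all orders that
  -- occur.
  induction n with
  | zero =>
    intro k g h σ _ _ _
    refine ⟨0, le_rfl, fun a F ψ _ => ?_⟩
    simp [sobNorm]
  | succ n ih =>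
    intro k g h σ hg hh hσ
    push_cast at hσ
    have hMn : 0 ≤ M * n := by positivity
    obtain ⟨C₁, hC₁, h₁⟩ := ih k g h σ hg hh (by nlinarith)
    obtain ⟨C₂, hC₂, h₂⟩ := ih (k + 1) g (coordMul v h) σ hg (hh.coordMul v) (by
      push_cast; linarith)
    obtain ⟨C₃, hC₃, h₃⟩ := ih (k + 1) (coordMul v g) h σ (hg.coordMul v) hh (by
      push_cast; linarith)
    obtain ⟨C₄, hC₄, h₄⟩ := hbdd (k + 1) g (coordMul v h) σ hg (hh.coordMul v) (by
      push_cast; nlinarith)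
    obtain ⟨C₅, hC₅, h₅⟩ := hbdd (k + 1) (coordMul v g) h σ (hg.coordMul v) hh (by
      push_cast; nlinarith)
    refine ⟨C₁ + C₂ + C₃ + C₄ + C₅, by positivity, fun a F ψ ha => ?_⟩
    set a' : ℕ × (Fin d → ℤ) → ℂ := fun p => a p * (((Ω.scale α p.1)⁻¹ : ℝ) : ℂ) with ha'
    have ha'b : ∀ p, ‖a' p‖ ≤ (Ω.scale α p.1)⁻¹ ^ (k + 1) := by
      intro p
      have := inv_pos.mpr (Ω.scale_pos α p.1)
      rw [ha', norm_mul, Complex.norm_real, Real.norm_of_nonneg this.le, pow_succ]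
      gcongr
      exact ha p
    set x := coordMul v with hx
    have hadd : ∀ u w : 𝓢(E d, ℂ), x^[n] (u + w) = x^[n] u + x^[n] w := iterate_map_add x n
    have hsub : ∀ u w : 𝓢(E d, ℂ), x^[n] (u - w) = x^[n] u - x^[n] w := iterate_map_sub x n
    set S := ∑ m ∈ Finset.range (n + 1), sobNorm R (σ + M * ((n + 1 : ℕ) - m + k)) (x^[m] ψ) with hS
    have hterm : ∀ m ∈ Finset.range (n + 1),
        0 ≤ sobNorm R (σ + M * ((n + 1 : ℕ) - m + k)) (x^[m] ψ) := fun _ _ => sobNorm_nonneg _ _ _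
    have e₁ : ∑ m ∈ Finset.range n, sobNorm R (σ + M * (n - m + k)) (x^[m] (x ψ)) ≤ S := by
      rw [hS, Finset.sum_range_succ']
      refine le_trans (le_of_eq ?_) (le_add_of_nonneg_right (sobNorm_nonneg _ _ _))
      refine Finset.sum_congr rfl fun m _ => ?_
      rw [Function.iterate_succ_apply]
      congr 2
      push_cast
      ring
    have e₂ : ∑ m ∈ Finset.range n, sobNorm R (σ + M * (n - m + (k + 1 : ℕ))) (x^[m] ψ) ≤ S := by
      rw [hS, Finset.sum_range_succ]
      refine le_trans (le_of_eq ?_) (le_add_of_nonneg_right (sobNorm_nonneg _ _ _))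
      refine Finset.sum_congr rfl fun m _ => ?_
      congr 2
      push_cast
      ring
    have e₃ : sobNorm R (σ + M * (k + 1 : ℕ)) (x^[n] ψ) ≤ S := by
      refine le_trans (le_of_eq ?_)
        (Finset.single_le_sum hterm (Finset.mem_range.mpr (Nat.lt_succ_self n)))
      congr 2
      push_cast
      ring
    have key : x^[n + 1] (frameSum α g h Ω a F ψ) - frameSum α g h Ω a F (x^[n + 1] ψ) =
        (x^[n] (frameSum α g h Ω a F (x ψ)) - frameSum α g h Ω a F (x^[n] (x ψ))) +
        ((x^[n] (frameSum α g (x h) Ω a' F ψ) - frameSum α g (x h) Ω a' F (x^[n] ψ)) +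
          frameSum α g (x h) Ω a' F (x^[n] ψ)) -
        ((x^[n] (frameSum α (x g) h Ω a' F ψ) - frameSum α (x g) h Ω a' F (x^[n] ψ)) +
          frameSum α (x g) h Ω a' F (x^[n] ψ)) := by
      rw [Function.iterate_succ_apply, Function.iterate_succ_apply, hx, coordMul_frameSum, ← hx,
        hsub, hadd]
      abel
    rw [key]
    refine (sobNorm_sub_le _ _ _ _).trans ?_
    have t₁ := (h₁ a F (x ψ) ha).trans (mul_le_mul_of_nonneg_left e₁ hC₁)
    have t₂ := (h₂ a' F ψ ha'b).trans (mul_le_mul_of_nonneg_left e₂ hC₂)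
    have t₃ := (h₃ a' F ψ ha'b).trans (mul_le_mul_of_nonneg_left e₂ hC₃)
    have t₄ := (h₄ a' F (x^[n] ψ) ha'b).trans (mul_le_mul_of_nonneg_left e₃ hC₄)
    have t₅ := (h₅ a' F (x^[n] ψ) ha'b).trans (mul_le_mul_of_nonneg_left e₃ hC₅)
    calc _ ≤ C₁ * S + (C₂ * S + C₄ * S) + (C₃ * S + C₅ * S) := by
          refine add_le_add ((sobNorm_add_le _ _ _ _).trans (add_le_add t₁ ?_)) ?_
          · exact (sobNorm_add_le _ _ _ _).trans (add_le_add t₂ t₄)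
          · exact (sobNorm_add_le _ _ _ _).trans (add_le_add t₃ t₅)
      _ = _ := by ring

end

section

/-! ### The frame algorithm contracts weighted norms -/

variable {α c R η : ℝ} {Ω : PhaseLattice d} {g h : 𝓢(E d, ℂ)}

/-- This transports the frame inequality, assumed for functions of position, to arbitrary `L²`
functions of frequency. -/
theorem inner_freqPacket (p : ℕ × (Fin d → ℤ)) (y : Lp ℂ 2 (volume : Measure (E d))) :
    inner ℂ (toL2 (freqPacket α g Ω p)) y =
      inner ℂ ((latticePacket α g Ω p.1 p.2).toLp 2) (𝓕⁻ y : Lp ℂ 2 (volume : Measure (E d))) := by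
  have h := MeasureTheory.Lp.inner_fourier_eq
    ((latticePacket α g Ω p.1 p.2).toLp 2 : Lp ℂ 2 (volume : Measure (E d))) (𝓕⁻ y)
  rw [SchwartzMap.toLp_fourier_eq, FourierTransform.fourier_fourierInv_eq] at h
  exact h

/-- The lower frame bound holds, up to a factor two, already for large finite sets. -/
theorem IsGaborFrame.exists_eventually_le (hframe : IsGaborFrame α g Ω) :
    ∃ A : ℝ, 0 < A ∧ ∀ y : Lp ℂ 2 (volume : Measure (E d)),
      ∀ᶠ F : Finset (ℕ × (Fin d → ℤ)) in Filter.atTop,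
        A / 2 * ‖y‖ ^ 2 ≤ ∑ p ∈ F, ‖inner ℂ (toL2 (freqPacket α g Ω p)) y‖ ^ 2 := by
  obtain ⟨A, B, hA, hAB⟩ := hframe
  refine ⟨A, by exact_mod_cast hA, fun y => ?_⟩
  by_cases hy : y = 0
  · refine Filter.Eventually.of_forall fun F => ?_
    rw [hy, norm_zero]
    simp
  have hy0 : 0 < ‖y‖ := norm_pos_iff.mpr hy
  have h1 := (hAB (𝓕⁻ y : Lp ℂ 2 (volume : Measure (E d)))).1
  have h2 : ‖(𝓕⁻ y : Lp ℂ 2 (volume : Measure (E d)))‖ₑ = ‖y‖ₑ := by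
    rw [← ofReal_norm, ← ofReal_norm, ← MeasureTheory.Lp.norm_fourier_eq,
      FourierTransform.fourier_fourierInv_eq]
  rw [h2, ← ENNReal.tsum_prod (f := fun k j => ‖inner ℂ ((latticePacket α g Ω k j).toLp 2 volume)
    (𝓕⁻ y : Lp ℂ 2 (volume : Measure (E d)))‖ₑ ^ 2)] at h1
  simp only [← inner_freqPacket] at h1
  -- Halving `A` makes the inequality strict, so it passes from the full sum to all large finite
  -- sums.
  have h3 : ENNReal.ofReal (A / 2 * ‖y‖ ^ 2) < A * ‖y‖ₑ ^ 2 := by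
    have : (A : ℝ≥0∞) * ‖y‖ₑ ^ 2 = ENNReal.ofReal (A * ‖y‖ ^ 2) := by
      rw [ENNReal.ofReal_mul A.coe_nonneg, ENNReal.ofReal_pow (norm_nonneg _), ofReal_norm,
        ENNReal.ofReal_coe_nnreal]
    rw [this, ENNReal.ofReal_lt_ofReal_iff (by positivity)]
    have : (0 : ℝ) < A := by exact_mod_cast hA
    have : 0 < A * ‖y‖ ^ 2 := by positivity
    linarith
  have h4 := (ENNReal.summable (f := fun p : ℕ × (Fin d → ℤ) =>
    ‖inner ℂ (toL2 (freqPacket α g Ω p)) y‖ₑ ^ 2)).hasSum.eventually_const_lt (h3.trans_le h1)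
  filter_upwards [h4] with F hF
  have h5 : ∑ p ∈ F, ‖inner ℂ (toL2 (freqPacket α g Ω p)) y‖ₑ ^ 2 =
      ENNReal.ofReal (∑ p ∈ F, ‖inner ℂ (toL2 (freqPacket α g Ω p)) y‖ ^ 2) := by
    rw [ENNReal.ofReal_sum_of_nonneg fun _ _ => by positivity]
    refine Finset.sum_congr rfl fun p _ => ?_
    rw [ENNReal.ofReal_pow (norm_nonneg _), ofReal_norm]
  rw [h5] at hF
  exact (ENNReal.ofReal_le_ofReal_iff (Finset.sum_nonneg fun _ _ => by positivity)).mp hF.le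

/-! ### Norms measuring decay along the coordinate axes -/

/-- Multiplication by the `i`-th coordinate, iterated `n` times. -/
def coordPow (i : Fin d) (n : ℕ) (ψ : 𝓢(E d, ℂ)) : 𝓢(E d, ℂ) :=
  (coordMul (EuclideanSpace.single i (1 : ℝ)))^[n] ψ

theorem coordPow_smul (i : Fin d) (n : ℕ) (b : ℂ) (u : 𝓢(E d, ℂ)) :
    coordPow i n (b • u) = b • coordPow i n u := by
  unfold coordPow
  induction n with
  | zero => rfl
  | succ n ih => rw [Function.iterate_succ_apply', ih, map_smul, Function.iterate_succ_apply']

/-- A weighted Sobolev norm, measuring decay of order up to `N` along the coordinate axes. -/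
def axisNorm (R κ s M : ℝ) (N : ℕ) (ψ : 𝓢(E d, ℂ)) : ℝ :=
  ∑ i : Fin d, ∑ n ∈ Finset.range (N + 1), κ ^ n * sobNorm R (s - M * n) (coordPow i n ψ)

theorem axisNorm_zero (R κ s M : ℝ) (ψ : 𝓢(E d, ℂ)) :
    axisNorm R κ s M 0 ψ = d * sobNorm R s ψ := by
  simp [axisNorm, coordPow]

/-- Write `|ξ|^{α-1} = |ξ|^α / |ξ|` and bound the denominator below by `μ`. Thus an inverse scale
costs at most `α` orders of the bracket. -/
theorem inv_scale_le_bracket {μ : ℝ} (hμ : 0 < μ) (hα : 0 < α) (hΩ : ∀ k, μ ≤ ‖Ω.freq k‖) (R : ℝ)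
    (k : ℕ) : (Ω.scale α k)⁻¹ ≤ (2 * Real.pi) ^ α / μ * bracket R (Ω.center k) ^ α := by
  have h0 := Ω.norm_freq_pos k
  have h1 : ‖Ω.freq k‖ ≤ 2 * Real.pi * bracket R (Ω.center k) := by
    have := norm_le_bracket R (Ω.center k)
    rw [Ω.norm_center, inv_mul_le_iff₀ (by positivity)] at this
    exact this
  rw [Ω.inv_scale, Real.rpow_sub h0, Real.rpow_one, div_mul_eq_mul_div,
    ← Real.mul_rpow Real.two_pi_pos.le (bracket_nonneg _ _)]
  exact div_le_div₀ (Real.rpow_nonneg (mul_nonneg Real.two_pi_pos.le (bracket_nonneg _ _)) _) (Real.rpow_le_rpow h0.le h1 hα.le) hμ (hΩ k)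

/-- For a suitable scale `R` and a suitable weight `κ`, one step of the frame algorithm, taken over
a large enough finite set, contracts the norm `axisNorm`. -/
theorem exists_axisNorm_contraction (hα : 0 < α) (hΩ : IsAdmissibleLattice α Ω) (hc : 0 < c)
    (hgc : BandLimited c g) (hframe : IsGaborFrame α g Ω) {B : ℝ} (hB : 0 < B)
    (hgB : SynthesisBound B fun p : ℕ × (Fin d → ℤ) => toL2 (latticePacket α g Ω p.1 p.2))
    (s : ℝ) (N : ℕ) :
    ∃ R κ q η : ℝ, 1 ≤ R ∧ 0 < κ ∧ κ ≤ 1 ∧ 0 ≤ q ∧ q < 1 ∧ SlowBracket α c Ω R η ∧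
      |s| * η ≤ 1 / 2 ∧ ∀ ψ : 𝓢(E d, ℂ), ∀ᶠ F in Filter.atTop,
        axisNorm R κ s α N (ψ - ((B⁻¹ : ℝ) : ℂ) • frameSum α g g Ω 1 F ψ) ≤
          q * axisNorm R κ s α N ψ := by
  obtain ⟨A, hA, hAF⟩ := hframe.exists_eventually_le
  obtain ⟨μ, hμ, hμΩ⟩ := exists_norm_freq_lower_bound hΩ.1
  set q₀ := √(1 - A / (2 * B)) with hq₀
  have hq₀1 : q₀ < 1 := by
    rw [hq₀, Real.sqrt_lt' one_pos]
    have : 0 < A / (2 * B) := by positivity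
    linarith
  have hq₀0 : 0 ≤ q₀ := Real.sqrt_nonneg _
  -- With this choice `180 * ε = (1 - q₀) / 4`. The commutators will cost another quarter of `1 -
  -- q₀`, so the final factor stays below one.
  set ε := (1 - q₀) / 720 with hε
  have hε0 : 0 < ε := by rw [hε]; linarith
  have hε1 : ε ≤ 1 / 2 := by rw [hε]; linarith
  set T := |s| + 2 * α * N with hT
  have hT0 : 0 ≤ T := by positivity
  set η := ε / (T + 1) with hη
  have hη0 : 0 < η := by positivity
  have hTη : T * η ≤ ε := by
    rw [hη, mul_div_assoc', div_le_iff₀ (by positivity)]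
    nlinarith
  obtain ⟨R, hR1, hRs⟩ := exists_bracket_slow hα hμ hμΩ hc hη0
  have hslow : SlowBracket α c Ω R η := hRs R le_rfl
  have hR0 : 0 < R := one_pos.trans_le hR1
  -- Starting from the order `s - α * n`, the loss of `α * (n - m)` leads exactly to the order `s -
  -- α * m` that `axisNorm` attaches to the power `m`.
  have hcomm : ∀ (i : Fin d) (n : ℕ), n ≤ N → ∃ C : ℝ, 0 ≤ C ∧ ∀ F ψ,
      sobNorm R (s - α * n) (coordPow i n (frameSum α g g Ω 1 F ψ) -
        frameSum α g g Ω 1 F (coordPow i n ψ)) ≤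
        C * ∑ m ∈ Finset.range n, sobNorm R (s - α * m) (coordPow i m ψ) := by
    intro i n hn
    have hn' : (n : ℝ) ≤ N := by exact_mod_cast hn
    obtain ⟨C, hC, h⟩ := exists_commutator_le hR0 hslow
      (fun g hg => exists_synthesisBound hα hΩ hc hg) hη0.le (hTη.trans hε1) hα.le
      (inv_scale_le_bracket hμ hα hμΩ R) (EuclideanSpace.single i (1 : ℝ)) n 0 g g (s - α * n)
      hgc hgc (by
        have h1 := abs_sub s (α * n)
        rw [abs_of_nonneg (by positivity : 0 ≤ α * (n : ℝ))] at h1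
        have h2 : α * n ≤ α * N := by gcongr
        push_cast
        linarith)
    refine ⟨C, hC, fun F ψ => (h 1 F ψ (fun p => by simp)).trans_eq ?_⟩
    congr 1
    refine Finset.sum_congr rfl fun m _ => ?_
    unfold coordPow
    congr 1
    push_cast
    ring
  choose! C hC0 hC using hcomm
  set C' := ∑ i : Fin d, ∑ n ∈ Finset.range (N + 1), C i n with hC'
  have hC'0 : 0 ≤ C' := Finset.sum_nonneg fun i _ => Finset.sum_nonneg fun n hn =>
    hC0 i n (Nat.lt_succ_iff.mp (Finset.mem_range.mp hn))
  have hCC' : ∀ i n, n ≤ N → C i n ≤ C' := by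
    intro i n hn
    have h1 : C i n ≤ ∑ n ∈ Finset.range (N + 1), C i n :=
      Finset.single_le_sum (f := fun n => C i n) (fun m hm => hC0 i m
        (Nat.lt_succ_iff.mp (Finset.mem_range.mp hm))) (Finset.mem_range.mpr (Nat.lt_succ_of_le hn))
    exact h1.trans (Finset.single_le_sum (f := fun i => ∑ n ∈ Finset.range (N + 1), C i n)
      (fun j _ => Finset.sum_nonneg fun n hn =>
        hC0 j n (Nat.lt_succ_iff.mp (Finset.mem_range.mp hn))) (Finset.mem_univ i))
  set K := B⁻¹ * C' * (N + 1) with hK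
  have hK0 : 0 ≤ K := by positivity
  -- The commutators involve only `m < n`, where `κ ^ n ≤ κ * κ ^ m`. They thus carry a spare factor
  -- `κ`, chosen to beat the commutator constants.
  set κ := min 1 ((1 - q₀) / (4 * (K + 1))) with hκ
  have hκ0 : 0 < κ := lt_min one_pos (div_pos (by linarith) (by positivity))
  have hκ1 : κ ≤ 1 := min_le_left _ _
  have hKκ : K * κ ≤ (1 - q₀) / 4 := by
    calc K * κ ≤ (K + 1) * ((1 - q₀) / (4 * (K + 1))) := by
          refine mul_le_mul (by linarith) (min_le_right _ _) hκ0.le (by positivity)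
      _ = (1 - q₀) / 4 := by field_simp
  set q₁ := q₀ + 180 * ε with hq₁
  refine ⟨R, κ, q₁ + K * κ, η, hR1, hκ0, hκ1, by positivity, ?_, hslow, ?_, fun ψ => ?_⟩
  · rw [hq₁, hε]; linarith
  · refine (mul_le_mul_of_nonneg_right ?_ hη0.le).trans (hTη.trans hε1)
    have : 0 ≤ 2 * α * N := by positivity
    linarith
  have hev : ∀ᶠ F : Finset (ℕ × (Fin d → ℤ)) in Filter.atTop, ∀ i : Fin d,
      ∀ n ∈ Finset.range (N + 1),
      A / 2 * ‖toL2 (bracketMul R (s - α * n) (𝓕 (coordPow i n ψ)))‖ ^ 2 ≤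
        ∑ p ∈ F, ‖inner ℂ (toL2 (freqPacket α g Ω p))
          (toL2 (bracketMul R (s - α * n) (𝓕 (coordPow i n ψ))))‖ ^ 2 := by
    refine Filter.eventually_all.mpr fun i => (Filter.eventually_all_finset _).mpr fun n _ => hAF _
  filter_upwards [hev] with F hF
  unfold axisNorm
  rw [Finset.mul_sum]
  refine Finset.sum_le_sum fun i _ => ?_
  set X := ∑ n ∈ Finset.range (N + 1), κ ^ n * sobNorm R (s - α * n) (coordPow i n ψ) with hX
  have hterm : ∀ n ∈ Finset.range (N + 1),
      κ ^ n * sobNorm R (s - α * n)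
        (coordPow i n (ψ - ((B⁻¹ : ℝ) : ℂ) • frameSum α g g Ω 1 F ψ)) ≤
      q₁ * (κ ^ n * sobNorm R (s - α * n) (coordPow i n ψ)) + κ * (B⁻¹ * C') * X := by
    intro n hn
    have hnN : n ≤ N := Nat.lt_succ_iff.mp (Finset.mem_range.mp hn)
    have hnN' : (n : ℝ) ≤ N := by exact_mod_cast hnN
    have hsplit : coordPow i n (ψ - ((B⁻¹ : ℝ) : ℂ) • frameSum α g g Ω 1 F ψ) =
        (coordPow i n ψ - ((B⁻¹ : ℝ) : ℂ) • frameSum α g g Ω 1 F (coordPow i n ψ)) -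
        ((B⁻¹ : ℝ) : ℂ) • (coordPow i n (frameSum α g g Ω 1 F ψ) -
          frameSum α g g Ω 1 F (coordPow i n ψ)) := by
      have h1 : ∀ u w : 𝓢(E d, ℂ), coordPow i n (u - w) = coordPow i n u - coordPow i n w :=
        iterate_map_sub _ n
      rw [h1, coordPow_smul, smul_sub]
      abel
    have hmain : sobNorm R (s - α * n) (coordPow i n ψ -
        ((B⁻¹ : ℝ) : ℂ) • frameSum α g g Ω 1 F (coordPow i n ψ)) ≤
        q₁ * sobNorm R (s - α * n) (coordPow i n ψ) := by
      refine sobNorm_sub_frameSum_le hR0 hslow hgc hB hgB hε0 hε1 ?_ F _ (hF i n hn)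
      refine (mul_le_mul_of_nonneg_right ?_ hη0.le).trans hTη
      have h1 := abs_sub s (α * n)
      rw [abs_of_nonneg (by positivity : 0 ≤ α * (n : ℝ))] at h1
      have h2 : α * n ≤ α * N := by gcongr
      have h3 : 0 ≤ α * N := by positivity
      linarith
    have hrem : κ ^ n * ∑ m ∈ Finset.range n, sobNorm R (s - α * m) (coordPow i m ψ) ≤ κ * X := by
      rw [Finset.mul_sum, hX, Finset.mul_sum]
      refine (Finset.sum_le_sum fun m hm => ?_).trans
        (Finset.sum_le_sum_of_subset_of_nonneg (Finset.range_subset_range.mpr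
          (hnN.trans (Nat.le_succ N)))
          fun m _ _ => mul_nonneg hκ0.le (mul_nonneg (by positivity) (sobNorm_nonneg _ _ _)))
      rw [← mul_assoc, ← pow_succ']
      exact mul_le_mul_of_nonneg_right (pow_le_pow_of_le_one hκ0.le hκ1 (Finset.mem_range.mp hm))
        (sobNorm_nonneg _ _ _)
    have hS0 : 0 ≤ ∑ m ∈ Finset.range n, sobNorm R (s - α * m) (coordPow i m ψ) :=
      Finset.sum_nonneg fun _ _ => sobNorm_nonneg _ _ _
    rw [hsplit]
    calc _ ≤ κ ^ n * (q₁ * sobNorm R (s - α * n) (coordPow i n ψ) +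
          B⁻¹ * (C' * ∑ m ∈ Finset.range n, sobNorm R (s - α * m) (coordPow i m ψ))) := by
          refine mul_le_mul_of_nonneg_left ((sobNorm_sub_le _ _ _ _).trans (add_le_add hmain ?_))
            (by positivity)
          rw [sobNorm_smul, Complex.norm_real, Real.norm_of_nonneg (by positivity)]
          refine mul_le_mul_of_nonneg_left ((hC i n hnN F ψ).trans ?_) (by positivity)
          exact mul_le_mul_of_nonneg_right (hCC' i n hnN) hS0
      _ = q₁ * (κ ^ n * sobNorm R (s - α * n) (coordPow i n ψ)) + B⁻¹ * C' *
          (κ ^ n * ∑ m ∈ Finset.range n, sobNorm R (s - α * m) (coordPow i m ψ)) := by ring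
      _ ≤ q₁ * (κ ^ n * sobNorm R (s - α * n) (coordPow i n ψ)) + B⁻¹ * C' * (κ * X) := by gcongr
      _ = _ := by ring
  refine (Finset.sum_le_sum hterm).trans_eq ?_
  rw [Finset.sum_add_distrib, ← Finset.mul_sum, ← hX, Finset.sum_const, Finset.card_range,
    nsmul_eq_mul, hK]
  push_cast
  ring

end

section

/-! ### Tempered distributions are controlled by weighted Sobolev norms -/

theorem integrable_bracket_rpow_mul (s : ℝ) (ψ : 𝓢(E d, ℂ)) :
    Integrable fun ζ => bracket 1 ζ ^ s * ‖ψ ζ‖ := by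
  have h := (bracketMul 1 s ψ).integrable (μ := volume) |>.norm
  refine h.congr (Filter.Eventually.of_forall fun ζ => ?_)
  dsimp only
  rw [bracketMul_apply one_pos, norm_mul, Complex.norm_real,
    Real.norm_of_nonneg (Real.rpow_nonneg (bracket_nonneg _ _) _)]

/-- Moments of `ψ` are bounded by a weighted `L²` norm. -/
theorem exists_integral_bracket_le (hd : 1 ≤ d) (L : ℕ) :
    ∃ C : ℝ, 0 ≤ C ∧ ∀ u : 𝓢(E d, ℂ),
      ∫ ζ, bracket 1 ζ ^ (L : ℝ) * ‖u ζ‖ ≤ C * ‖toL2 (bracketMul 1 (L + d) u)‖ := by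
  -- Cauchy–Schwarz against `bracket ^ (-d)`, which is square integrable because `2d > d`; this
  -- explains the loss of `d` orders.
  set D : E d → ℝ := fun ζ => bracket 1 ζ ^ (-(d : ℝ)) with hD
  have hdpos : (0 : ℝ) < d := by exact_mod_cast hd
  have hb : ∀ ζ : E d, 0 < bracket 1 ζ := fun ζ => bracket_pos one_pos ζ
  have hD2 : ∀ ζ, D ζ ^ (2 : ℝ) = (1 + ‖ζ‖ ^ 2) ^ (-(2 * (d : ℝ)) / 2) := by
    intro ζ
    rw [hD, ← Real.rpow_mul (hb ζ).le, bracket, Real.sqrt_eq_rpow, ← Real.rpow_mul (by positivity),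
      one_pow]
    congr 1
    ring
  have hDint : Integrable fun ζ => D ζ ^ (2 : ℝ) := by
    simp_rw [hD2]
    exact integrable_rpow_neg_one_add_norm_sq (by simp; linarith)
  have hDm : MemLp D (ENNReal.ofReal 2) := by
    have hcont : Continuous D := by
      refine Continuous.rpow_const ?_ fun ζ => Or.inl (hb ζ).ne'
      unfold bracket
      fun_prop
    rw [show ENNReal.ofReal 2 = 2 by simp]
    refine (memLp_two_iff_integrable_sq hcont.aestronglyMeasurable).mpr ?_
    simpa only [Real.rpow_two] using hDint
  refine ⟨(∫ ζ, D ζ ^ (2 : ℝ)) ^ (1 / 2 : ℝ),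
    Real.rpow_nonneg (integral_nonneg fun ζ => Real.rpow_nonneg
      (Real.rpow_nonneg (hb ζ).le _) _) _, fun u => ?_⟩
  have hu : MemLp (fun ζ => ‖bracketMul 1 (L + d) u ζ‖) (ENNReal.ofReal 2) := by
    rw [show ENNReal.ofReal 2 = 2 by simp]
    exact ((bracketMul 1 (L + d) u).memLp 2 volume).norm
  have h := integral_mul_le_Lp_mul_Lq_of_nonneg (μ := (volume : Measure (E d)))
    (Real.HolderConjugate.two_two) (f := D)
    (g := fun ζ => ‖bracketMul 1 (L + d) u ζ‖)
    (Filter.Eventually.of_forall fun ζ => Real.rpow_nonneg (hb ζ).le _)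
    (Filter.Eventually.of_forall fun ζ => norm_nonneg _) hDm hu
  have h2 : (∫ ζ, ‖bracketMul 1 (L + d) u ζ‖ ^ (2 : ℝ)) ^ (1 / 2 : ℝ) =
      ‖toL2 (bracketMul 1 (L + d) u)‖ := by
    simp_rw [Real.rpow_two]
    rw [← norm_toL2_sq, ← Real.sqrt_eq_rpow, Real.sqrt_sq (norm_nonneg _)]
  rw [h2] at h
  refine le_trans (le_of_eq ?_) h
  refine integral_congr_ae (Filter.Eventually.of_forall fun ζ => ?_)
  simp only [hD]
  rw [bracketMul_apply one_pos, norm_mul, Complex.norm_real,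
    Real.norm_of_nonneg (Real.rpow_nonneg (hb ζ).le _), ← mul_assoc, ← Real.rpow_add (hb ζ)]
  congr 2
  ring

/-- Sobolev embedding for Schwartz functions. -/
theorem exists_norm_iteratedFDeriv_le (hd : 1 ≤ d) (L : ℕ) :
    ∃ C : ℝ, 0 ≤ C ∧ ∀ l ≤ L, ∀ (ψ : 𝓢(E d, ℂ)) (x : E d),
      ‖iteratedFDeriv ℝ l ψ x‖ ≤ C * sobNorm 1 (L + d) ψ := by
  obtain ⟨C, hC, h⟩ := exists_integral_bracket_le hd L
  refine ⟨(2 * Real.pi) ^ L * ((L + 1) * C), by positivity, fun l hl ψ x => ?_⟩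
  set u : 𝓢(E d, ℂ) := 𝓕⁻ ψ with hu
  have hψ : (ψ : E d → ℂ) = 𝓕 (u : E d → ℂ) := by
    rw [← SchwartzMap.fourier_coe, hu, FourierTransform.fourier_fourierInv_eq]
  have hb := Real.pow_mul_norm_iteratedFDeriv_fourier_le (f := (u : E d → ℂ)) (K := ⊤) (N := ⊤)
    (u.smooth ⊤) (fun k n _ _ => u.integrable_pow_mul_iteratedFDeriv volume k n)
    (k := l) (n := 0) le_top le_top x
  rw [← hψ, pow_zero, one_mul, pow_zero, mul_one] at hb
  refine hb.trans ?_
  have h1 : ∀ p ∈ Finset.range (l + 1) ×ˢ Finset.range (0 + 1),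
      ∫ v, ‖v‖ ^ p.1 * ‖iteratedFDeriv ℝ p.2 (u : E d → ℂ) v‖ ≤ C * sobNorm 1 (L + d) ψ := by
    intro p hp
    obtain ⟨hp1, hp2⟩ := Finset.mem_product.mp hp
    have hp20 : p.2 = 0 := by simpa using hp2
    have hp1l : p.1 ≤ L := (Nat.lt_succ_iff.mp (Finset.mem_range.mp hp1)).trans hl
    have huv : ∀ v, u v = (𝓕 ψ : 𝓢(E d, ℂ)) (-v) := by
      intro v
      rw [hu, SchwartzMap.fourierInv_coe, SchwartzMap.fourier_coe, Real.fourierInv_eq_fourier_neg]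
    calc ∫ v, ‖v‖ ^ p.1 * ‖iteratedFDeriv ℝ p.2 (u : E d → ℂ) v‖
        = ∫ v, ‖-v‖ ^ p.1 * ‖(𝓕 ψ : 𝓢(E d, ℂ)) (-v)‖ := by
          rw [hp20]
          simp only [norm_iteratedFDeriv_zero, huv, norm_neg]
      _ = ∫ v, ‖v‖ ^ p.1 * ‖(𝓕 ψ : 𝓢(E d, ℂ)) v‖ :=
          integral_neg_eq_self (fun v => ‖v‖ ^ p.1 * ‖(𝓕 ψ : 𝓢(E d, ℂ)) v‖) volume
      _ ≤ ∫ v, bracket 1 v ^ (L : ℝ) * ‖(𝓕 ψ : 𝓢(E d, ℂ)) v‖ := by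
          refine integral_mono ((𝓕 ψ : 𝓢(E d, ℂ)).integrable_pow_mul volume p.1)
            (integrable_bracket_rpow_mul _ _) fun v => ?_
          refine mul_le_mul_of_nonneg_right ?_ (norm_nonneg _)
          rw [Real.rpow_natCast]
          exact (pow_le_pow_left₀ (norm_nonneg _) (norm_le_bracket 1 v) _).trans
            (pow_le_pow_right₀ (le_bracket 1 v) hp1l)
      _ ≤ _ := h _
  have hS := sobNorm_nonneg 1 (L + d) ψ
  calc _ ≤ (2 * Real.pi) ^ l * ∑ p ∈ Finset.range (l + 1) ×ˢ Finset.range (0 + 1),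
        C * sobNorm 1 (L + d) ψ := by
        refine mul_le_mul_of_nonneg_left ?_ (by positivity)
        exact Finset.sum_le_sum h1
    _ = (2 * Real.pi) ^ l * ((l + 1) * (C * sobNorm 1 (L + d) ψ)) := by simp
    _ ≤ (2 * Real.pi) ^ L * ((L + 1) * (C * sobNorm 1 (L + d) ψ)) := by
        have hl' : (l : ℝ) ≤ L := by exact_mod_cast hl
        have h2π : 1 ≤ 2 * Real.pi := by linarith [Real.two_le_pi]
        gcongr
    _ = _ := by ring

/-- Multiplication by a coordinate commutes with differentiation up to lower order terms. -/
theorem abs_inner_mul_norm_iteratedFDeriv_le (v : E d) (hv : ‖v‖ ≤ 1) (l : ℕ) (ψ : 𝓢(E d, ℂ))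
    (x : E d) : |inner ℝ x v| * ‖iteratedFDeriv ℝ l ψ x‖ ≤
      ‖iteratedFDeriv ℝ l (coordMul v ψ) x‖ +
        2 ^ l * ∑ j ∈ Finset.range l, ‖iteratedFDeriv ℝ j ψ x‖ := by
  -- The coordinate is recentred at `x`, where it vanishes, so the Leibniz rule leaves only
  -- derivatives of `ψ` of order below `l`.
  set a : E d → ℝ := fun y => inner ℝ (y - x) v with ha
  have ha_smooth : ContDiff ℝ (⊤ : ℕ∞) a := (contDiff_id.sub contDiff_const).inner ℝ contDiff_const
  have hψ : ContDiff ℝ (⊤ : ℕ∞) (ψ : E d → ℂ) := ψ.smooth ⊤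
  have hl : (l : WithTop ℕ∞) ≤ ((⊤ : ℕ∞) : WithTop ℕ∞) := by exact_mod_cast le_top
  have h1 : (coordMul v ψ : E d → ℂ) =
      (inner ℝ x v : ℝ) • (ψ : E d → ℂ) + fun y => a y • ψ y := by
    funext y
    simp only [coordMul_apply, Pi.add_apply, Pi.smul_apply, ha, inner_sub_left, Complex.real_smul]
    push_cast
    ring
  have h2 : iteratedFDeriv ℝ l (coordMul v ψ) x = (inner ℝ x v : ℝ) • iteratedFDeriv ℝ l ψ x +
      iteratedFDeriv ℝ l (fun y => a y • ψ y) x := by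
    rw [h1, iteratedFDeriv_add_apply, iteratedFDeriv_const_smul_apply]
    · exact (hψ.of_le hl).contDiffAt
    · exact (contDiff_const.smul (hψ.of_le hl)).contDiffAt
    · exact ((ha_smooth.smul hψ).of_le hl).contDiffAt
  have h3 : ‖iteratedFDeriv ℝ l (fun y => a y • ψ y) x‖ ≤
      2 ^ l * ∑ j ∈ Finset.range l, ‖iteratedFDeriv ℝ j ψ x‖ := by
    refine (norm_iteratedFDeriv_smul_le ha_smooth hψ x (n := l) hl).trans ?_
    have hfd : fderiv ℝ a = fun _ => innerSL ℝ v := by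
      funext y
      have : a = fun y => innerSL ℝ v y - innerSL ℝ v x := by
        funext y
        simp only [ha, innerSL_apply_apply, ← inner_sub_right]
        exact real_inner_comm _ _
      rw [this, fderiv_sub_const]
      exact (innerSL ℝ v).hasFDerivAt.fderiv
    have hD : ∀ i, ‖iteratedFDeriv ℝ (i + 1) a x‖ ≤ 1 := by
      intro i
      rw [← norm_iteratedFDeriv_fderiv, hfd]
      rcases i with _ | i
      · rw [norm_iteratedFDeriv_zero, innerSL_apply_norm]
        exact hv
      · rw [iteratedFDeriv_const_of_ne (Nat.succ_ne_zero i)]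
        simp
    rw [Finset.sum_range_succ', norm_iteratedFDeriv_zero]
    have ha0 : a x = 0 := by simp [ha]
    rw [ha0, norm_zero, mul_zero, zero_mul, add_zero, ← Finset.sum_range_reflect
      (fun j => ‖iteratedFDeriv ℝ j ψ x‖), Finset.mul_sum]
    refine Finset.sum_le_sum fun i hi => ?_
    have hil : l - (i + 1) = l - 1 - i := by omega
    rw [hil]
    refine mul_le_mul_of_nonneg_right ?_ (norm_nonneg _)
    calc _ ≤ (2 ^ l : ℝ) * 1 := by
          gcongr
          · exact_mod_cast Nat.choose_le_two_pow l (i + 1)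
          · exact hD i
      _ = _ := mul_one _
  have h4 : |inner ℝ x v| * ‖iteratedFDeriv ℝ l ψ x‖ =
      ‖(inner ℝ x v : ℝ) • iteratedFDeriv ℝ l ψ x‖ := by
    rw [norm_smul, Real.norm_eq_abs]
  rw [h4, eq_sub_of_add_eq h2.symm]
  exact (norm_sub_le _ _).trans (by linarith)

/-- One power of `x_i` is traded for `coordMul` applied to `ψ`, modulo derivatives of lower order
that the induction hypothesis already covers. -/
theorem exists_coord_pow_mul_norm_iteratedFDeriv_le (hd : 1 ≤ d) (L : ℕ) (i : Fin d) (k : ℕ) :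
    ∃ C : ℝ, 0 ≤ C ∧ ∀ l ≤ L, ∀ (ψ : 𝓢(E d, ℂ)) (x : E d),
      |x i| ^ k * ‖iteratedFDeriv ℝ l ψ x‖ ≤
        C * ∑ n ∈ Finset.range (k + 1), sobNorm 1 (L + d) (coordPow i n ψ) := by
  induction k with
  | zero =>
    obtain ⟨C, hC, h⟩ := exists_norm_iteratedFDeriv_le hd L
    exact ⟨C, hC, fun l hl ψ x => by simpa [coordPow] using h l hl ψ x⟩
  | succ k ih =>
    obtain ⟨C, hC, h⟩ := ih
    refine ⟨C + 2 ^ L * L * C, by positivity, fun l hl ψ x => ?_⟩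
    set v : E d := EuclideanSpace.single i (1 : ℝ) with hv
    have hxi : inner ℝ x v = x i := by
      rw [hv, EuclideanSpace.inner_single_right]
      simp
    have h1 := abs_inner_mul_norm_iteratedFDeriv_le v (by simp [hv]) l ψ x
    rw [hxi] at h1
    set S := ∑ n ∈ Finset.range (k + 1 + 1), sobNorm 1 (L + d) (coordPow i n ψ) with hS
    have hS1 : ∑ n ∈ Finset.range (k + 1), sobNorm 1 (L + d) (coordPow i n (coordMul v ψ)) ≤ S := by
      rw [hS, Finset.sum_range_succ' _ (k + 1)]
      exact le_add_of_nonneg_right (sobNorm_nonneg _ _ _)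
    have hS2 : ∑ n ∈ Finset.range (k + 1), sobNorm 1 (L + d) (coordPow i n ψ) ≤ S := by
      rw [hS, Finset.sum_range_succ _ (k + 1)]
      exact le_add_of_nonneg_right (sobNorm_nonneg _ _ _)
    have hlL : (l : ℝ) ≤ L := by exact_mod_cast hl
    have hS0 : 0 ≤ S := Finset.sum_nonneg fun _ _ => sobNorm_nonneg _ _ _
    calc |x i| ^ (k + 1) * ‖iteratedFDeriv ℝ l ψ x‖
        = |x i| ^ k * (|x i| * ‖iteratedFDeriv ℝ l ψ x‖) := by ring
      _ ≤ |x i| ^ k * (‖iteratedFDeriv ℝ l (coordMul v ψ) x‖ +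
          2 ^ l * ∑ j ∈ Finset.range l, ‖iteratedFDeriv ℝ j ψ x‖) := by gcongr
      _ = |x i| ^ k * ‖iteratedFDeriv ℝ l (coordMul v ψ) x‖ +
          2 ^ l * ∑ j ∈ Finset.range l, |x i| ^ k * ‖iteratedFDeriv ℝ j ψ x‖ := by
          rw [mul_add, Finset.mul_sum, Finset.mul_sum, Finset.mul_sum]
          congr 1
          exact Finset.sum_congr rfl fun j _ => by ring
      _ ≤ C * S + 2 ^ l * ∑ j ∈ Finset.range l, C * S := by
          refine add_le_add ((h l hl _ x).trans (mul_le_mul_of_nonneg_left hS1 hC))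
            (mul_le_mul_of_nonneg_left (Finset.sum_le_sum fun j hj => ?_) (by positivity))
          exact (h j ((Finset.mem_range.mp hj).le.trans hl) _ x).trans
            (mul_le_mul_of_nonneg_left hS2 hC)
      _ = C * S + 2 ^ l * (l * (C * S)) := by simp
      _ ≤ C * S + 2 ^ L * (L * (C * S)) := by gcongr; norm_num
      _ = _ := by ring

/-- The Schwartz seminorms are bounded by weighted Sobolev norms along the axes. -/
theorem exists_seminorm_le (hd : 1 ≤ d) (k l : ℕ) :
    ∃ C : ℝ, 0 ≤ C ∧ ∀ ψ : 𝓢(E d, ℂ), SchwartzMap.seminorm ℂ k l ψ ≤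
      C * ∑ i : Fin d, ∑ n ∈ Finset.range (k + 1), sobNorm 1 (l + d) (coordPow i n ψ) := by
  have : Nonempty (Fin d) := ⟨⟨0, hd⟩⟩
  choose C hC h using fun i : Fin d => exists_coord_pow_mul_norm_iteratedFDeriv_le hd l i k
  have hC0 : 0 ≤ ∑ i, C i := Finset.sum_nonneg fun i _ => hC i
  refine ⟨(d : ℝ) ^ k * ∑ i, C i, by positivity, fun ψ => ?_⟩
  have hS0 : ∀ i : Fin d, 0 ≤ ∑ n ∈ Finset.range (k + 1), sobNorm 1 (l + d) (coordPow i n ψ) :=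
    fun i => Finset.sum_nonneg fun _ _ => sobNorm_nonneg _ _ _
  refine SchwartzMap.seminorm_le_bound ℂ k l ψ
    (mul_nonneg (by positivity) (Finset.sum_nonneg fun i _ => hS0 i)) fun x => ?_
  -- Decay along the axes is enough: at each `x` the largest coordinate controls the norm.
  obtain ⟨i, -, hi⟩ := Finset.exists_max_image Finset.univ (fun i => |x i|) Finset.univ_nonempty
  have hx : ‖x‖ ≤ d * |x i| := by
    have h1 : ‖x‖ ≤ ∑ j, |x j| := by
      rw [EuclideanSpace.norm_eq]
      refine Real.sqrt_le_iff.mpr ⟨Finset.sum_nonneg fun _ _ => abs_nonneg _, ?_⟩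
      simp only [Real.norm_eq_abs]
      exact Finset.sum_sq_le_sq_sum_of_nonneg fun _ _ => abs_nonneg _
    refine h1.trans ((Finset.sum_le_sum fun j _ => hi j (Finset.mem_univ j)).trans_eq ?_)
    simp
  calc ‖x‖ ^ k * ‖iteratedFDeriv ℝ l ψ x‖ ≤ (d * |x i|) ^ k * ‖iteratedFDeriv ℝ l ψ x‖ := by gcongr
    _ = d ^ k * (|x i| ^ k * ‖iteratedFDeriv ℝ l ψ x‖) := by ring
    _ ≤ d ^ k * (C i * ∑ n ∈ Finset.range (k + 1), sobNorm 1 (l + d) (coordPow i n ψ)) := by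
        exact mul_le_mul_of_nonneg_left (h i l le_rfl ψ x) (by positivity)
    _ ≤ d ^ k * ((∑ i, C i) * ∑ i, ∑ n ∈ Finset.range (k + 1),
          sobNorm 1 (l + d) (coordPow i n ψ)) := by
        refine mul_le_mul_of_nonneg_left (mul_le_mul ?_ ?_ (hS0 i) hC0) (by positivity)
        · exact Finset.single_le_sum (f := C) (fun j _ => hC j) (Finset.mem_univ i)
        · exact Finset.single_le_sum
            (f := fun i => ∑ n ∈ Finset.range (k + 1), sobNorm 1 (l + d) (coordPow i n ψ))
            (fun j _ => hS0 j) (Finset.mem_univ i)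
    _ = _ := by ring

theorem seminorm_conjSchwartz (k l : ℕ) (ψ : 𝓢(E d, ℂ)) :
    SchwartzMap.seminorm ℂ k l (conjSchwartz ψ) ≤ SchwartzMap.seminorm ℂ k l ψ := by
  refine SchwartzMap.seminorm_le_bound ℂ k l _ (apply_nonneg _ _) fun x => ?_
  refine le_trans (le_of_eq ?_) (SchwartzMap.le_seminorm ℂ k l ψ x)
  congr 1
  exact Complex.conjLIE.norm_iteratedFDeriv_comp_left (ψ : E d → ℂ) x l

theorem sobNorm_mono_scale {R s : ℝ} (hR : 1 ≤ R) (hs : 0 ≤ s) (ψ : 𝓢(E d, ℂ)) :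
    sobNorm 1 s ψ ≤ sobNorm R s ψ := by
  unfold sobNorm
  have hR0 : 0 < R := one_pos.trans_le hR
  refine (sq_le_sq₀ (norm_nonneg _) (norm_nonneg _)).mp ?_
  rw [norm_toL2_sq, norm_toL2_sq]
  refine integral_mono (integrable_norm_sq _) (integrable_norm_sq _) fun ζ => ?_
  have h1 := bracket_nonneg 1 ζ
  have h2 := bracket_nonneg R ζ
  simp only [bracketMul_apply hR0, bracketMul_apply one_pos, norm_mul, Complex.norm_real,
    Real.norm_of_nonneg (Real.rpow_nonneg h1 _), Real.norm_of_nonneg (Real.rpow_nonneg h2 _)]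
  gcongr
  unfold bracket
  gcongr

/-- Every tempered distribution is bounded in terms of some norm `axisNorm`. -/
theorem exists_tempered_le (hd : 1 ≤ d) {α : ℝ} (hα : 0 ≤ α) (f : 𝓢'(E d, ℂ)) :
    ∃ (s : ℝ) (N : ℕ), ∀ R κ : ℝ, 1 ≤ R → 0 < κ → κ ≤ 1 → ∃ C : ℝ, 0 ≤ C ∧
      ∀ ψ : 𝓢(E d, ℂ), ‖f (conjSchwartz ψ)‖ ≤ C * axisNorm R κ s α N ψ := by
  obtain ⟨S, C, -, hS⟩ := Seminorm.bound_of_continuous (schwartz_withSeminorms ℂ (E d) ℂ)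
    ((normSeminorm ℂ ℂ).comp (f : 𝓢(E d, ℂ) →ₗ[ℂ] ℂ)) (by
      have : Continuous fun ψ : 𝓢(E d, ℂ) => ‖f ψ‖ := f.continuous.norm
      exact this)
  have hS' : ∀ ψ : 𝓢(E d, ℂ), ‖f ψ‖ ≤ C * ∑ m ∈ S, SchwartzMap.seminorm ℂ m.1 m.2 ψ := by
    intro ψ
    have h1 := hS ψ
    have h2 : (S.sup (schwartzSeminormFamily ℂ (E d) ℂ)) ψ ≤
        ∑ m ∈ S, SchwartzMap.seminorm ℂ m.1 m.2 ψ := by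
      refine Seminorm.finset_sup_apply_le (Finset.sum_nonneg fun _ _ => apply_nonneg _ _)
        fun m hm => ?_
      exact Finset.single_le_sum (f := fun m : ℕ × ℕ => SchwartzMap.seminorm ℂ m.1 m.2 ψ)
        (fun _ _ => apply_nonneg _ _) hm
    exact h1.trans (mul_le_mul_of_nonneg_left h2 C.2)
  choose D hD0 hD using exists_seminorm_le hd
  set N := S.sup Prod.fst with hN
  set L := S.sup Prod.snd with hL
  -- This `s` leaves the order `s - α * n` at least `L + d` for every `n ≤ N`, as the Sobolev
  -- embedding requires.
  refine ⟨L + d + α * N, N, fun R κ hR hκ hκ1 => ?_⟩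
  have hsum : 0 ≤ ∑ m ∈ S, D m.1 m.2 := Finset.sum_nonneg fun m _ => hD0 _ _
  refine ⟨C * ((∑ m ∈ S, D m.1 m.2) * (κ ^ N)⁻¹), by positivity, fun ψ => ?_⟩
  refine (hS' _).trans ?_
  rw [mul_assoc]
  refine mul_le_mul_of_nonneg_left ?_ C.2
  rw [mul_assoc, Finset.sum_mul]
  refine Finset.sum_le_sum fun m hm => ?_
  refine ((seminorm_conjSchwartz _ _ _).trans (hD m.1 m.2 ψ)).trans
    (mul_le_mul_of_nonneg_left ?_ (hD0 _ _))
  have hm1 : m.1 ≤ N := Finset.le_sup (f := Prod.fst) hm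
  have hm2 : m.2 ≤ L := Finset.le_sup (f := Prod.snd) hm
  unfold axisNorm
  rw [Finset.mul_sum]
  refine Finset.sum_le_sum fun i _ => ?_
  rw [Finset.mul_sum]
  refine (Finset.sum_le_sum fun n hn => ?_).trans (Finset.sum_le_sum_of_subset_of_nonneg
    (Finset.range_subset_range.mpr (Nat.succ_le_succ hm1))
    fun n _ _ => mul_nonneg (by positivity) (mul_nonneg (by positivity) (sobNorm_nonneg _ _ _)))
  have hn : n ≤ N := (Nat.lt_succ_iff.mp (Finset.mem_range.mp hn)).trans hm1
  have hn' : (n : ℝ) ≤ N := by exact_mod_cast hn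
  have hm2' : (m.2 : ℝ) ≤ L := by exact_mod_cast hm2
  have h1 : sobNorm 1 (m.2 + d) (coordPow i n ψ) ≤
      sobNorm R (L + d + α * N - α * n) (coordPow i n ψ) := by
    refine (sobNorm_mono_scale hR (by positivity) _).trans (sobNorm_mono hR ?_ _)
    have : α * n ≤ α * N := by gcongr
    linarith
  have h2 : 1 ≤ (κ ^ N)⁻¹ * κ ^ n := by
    rw [inv_mul_eq_div, le_div_iff₀ (by positivity), one_mul]
    exact pow_le_pow_of_le_one hκ.le hκ1 hn
  calc _ ≤ _ := h1
    _ ≤ ((κ ^ N)⁻¹ * κ ^ n) * sobNorm R (L + d + α * N - α * n) (coordPow i n ψ) :=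
        le_mul_of_one_le_left (sobNorm_nonneg _ _ _) h2
    _ = _ := by ring

end

section

/-! ### Modulation spaces embed in weighted `L²` spaces on the frequency side -/

/-- An a priori bound in terms of `P` improves to a bound in terms of `Q`, if there is a map that
contracts both and changes the bounded quantity by a multiple of `Q`. -/
theorem le_of_contraction {X : Type*} {Φ P Q : X → ℝ} {C K q q' : ℝ} (hK : 0 ≤ K) (hq : 0 ≤ q)
    (hq1 : q < 1) (hq' : q' < 1) (hQ : ∀ ψ, 0 ≤ Q ψ) (hC : 0 ≤ C)
    (hΦ : ∀ ψ, Φ ψ ≤ C * P ψ)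
    (step : ∀ ψ, ∃ ψ', P ψ' ≤ q * P ψ ∧ Q ψ' ≤ q' * Q ψ ∧ Φ ψ ≤ Φ ψ' + K * Q ψ) (ψ : X) :
    Φ ψ ≤ K / (1 - q') * Q ψ := by
  have hq'' : 0 < 1 - q' := by linarith
  -- The a priori bound by `P` appears only with the factor `q ^ n`, while the errors sum to a
  -- geometric series in `Q`. This uses that the same `ψ'` contracts both.
  have h : ∀ (n : ℕ) (ψ : X), Φ ψ ≤ q ^ n * (C * P ψ) + K / (1 - q') * Q ψ := by
    intro n
    induction n with
    | zero =>
      intro ψ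
      have : 0 ≤ K / (1 - q') * Q ψ := mul_nonneg (by positivity) (hQ ψ)
      linarith [hΦ ψ, one_mul (C * P ψ), pow_zero q]
    | succ n ih =>
      intro ψ
      obtain ⟨ψ', h1, h2, h3⟩ := step ψ
      calc Φ ψ ≤ Φ ψ' + K * Q ψ := h3
        _ ≤ q ^ n * (C * P ψ') + K / (1 - q') * Q ψ' + K * Q ψ := by linarith [ih ψ']
        _ ≤ q ^ n * (C * (q * P ψ)) + K / (1 - q') * (q' * Q ψ) + K * Q ψ := by gcongr
        _ = _ := by field_simp; ring
  have h1 : Filter.Tendsto (fun n : ℕ => q ^ n * (C * P ψ) + K / (1 - q') * Q ψ) Filter.atTop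
      (nhds (0 * (C * P ψ) + K / (1 - q') * Q ψ)) :=
    ((tendsto_pow_atTop_nhds_zero_of_lt_one hq hq1).mul_const _).add_const _
  rw [zero_mul, zero_add] at h1
  exact ge_of_tendsto' h1 fun n => h n ψ

/-! ### Comparison of the weights with the bracket -/

theorem rpow_le_rpow_of_comparable {x y K : ℝ} (hx : 0 < x) (hy : 0 < y) (hK : 1 ≤ K)
    (hxy : x ≤ K * y) (hyx : y ≤ K * x) (β : ℝ) : x ^ β ≤ K ^ |β| * y ^ β := by
  have hK0 : 0 < K := one_pos.trans_le hK
  rcases le_total 0 β with h | h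
  · rw [abs_of_nonneg h, ← Real.mul_rpow hK0.le hy.le]
    exact Real.rpow_le_rpow hx.le hxy h
  · rw [abs_of_nonpos h, ← mul_le_mul_iff_of_pos_left (Real.rpow_pos_of_pos hK0 β), ← mul_assoc,
      ← Real.rpow_add hK0, add_neg_cancel, Real.rpow_zero, one_mul, ← Real.mul_rpow hK0.le hx.le]
    exact Real.rpow_le_rpow_of_nonpos hy hyx h

/-- The weights `(1 + |ξ|)^β` are comparable to powers of the bracket. -/
theorem exists_weight_comparable {R : ℝ} (hR : 1 ≤ R) (β : ℝ) :
    ∃ C : ℝ, 0 < C ∧ ∀ ζ : E d, weight β ((2 * Real.pi) • ζ) ≤ C * bracket R ζ ^ β ∧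
      bracket R ζ ^ β ≤ C * weight β ((2 * Real.pi) • ζ) := by
  have hR0 : 0 < R := one_pos.trans_le hR
  have hpi : 1 ≤ 2 * Real.pi := by linarith [Real.pi_gt_three]
  have hK : 1 ≤ R + 2 * Real.pi := by linarith
  refine ⟨(R + 2 * Real.pi) ^ |β|, Real.rpow_pos_of_pos (by linarith) _, fun ζ => ?_⟩
  have hJ := bracket_pos hR0 ζ
  have hn : ‖(2 * Real.pi) • ζ‖ = 2 * Real.pi * ‖ζ‖ := by
    rw [norm_smul, Real.norm_of_nonneg Real.two_pi_pos.le]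
  have hw : 0 < 1 + ‖(2 * Real.pi) • ζ‖ := by positivity
  have h1 : 1 + ‖(2 * Real.pi) • ζ‖ ≤ (R + 2 * Real.pi) * bracket R ζ := by
    have h2 := norm_le_bracket R ζ
    have h3 := le_bracket R ζ
    rw [hn, add_mul]
    have h4 : 1 * 1 ≤ R * bracket R ζ := mul_le_mul hR (hR.trans h3) one_pos.le hR0.le
    have h5 : 2 * Real.pi * ‖ζ‖ ≤ 2 * Real.pi * bracket R ζ := by gcongr
    linarith
  have h2 : bracket R ζ ≤ (R + 2 * Real.pi) * (1 + ‖(2 * Real.pi) • ζ‖) := by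
    have h3 : bracket R ζ ≤ R + ‖ζ‖ := by
      refine Real.sqrt_le_iff.mpr ⟨by positivity, ?_⟩
      nlinarith [mul_nonneg hR0.le (norm_nonneg ζ)]
    rw [hn]
    have h4 : ‖ζ‖ ≤ R * (2 * Real.pi * ‖ζ‖) := by
      rw [← mul_assoc]
      exact le_mul_of_one_le_left (norm_nonneg _) (by nlinarith)
    have h5 : 0 ≤ 2 * Real.pi * (1 + 2 * Real.pi * ‖ζ‖) := by positivity
    nlinarith
  exact ⟨rpow_le_rpow_of_comparable hw hJ hK h1 h2 β, rpow_le_rpow_of_comparable hJ hw hK h2 h1 β⟩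

theorem PhaseLattice.two_pi_smul_center (Ω : PhaseLattice d) (k : ℕ) :
    (2 * Real.pi) • Ω.center k = Ω.freq k := by
  rw [PhaseLattice.center, smul_smul, mul_inv_cancel₀ Real.two_pi_pos.ne', one_smul]

variable {α c R η : ℝ} {Ω : PhaseLattice d} {φ : 𝓢(E d, ℂ)}

/-! ### Modulation norms through finite sums -/

theorem weight_nonneg (β : ℝ) (ξ : E d) : 0 ≤ weight β ξ := Real.rpow_nonneg (by positivity) _

theorem modNorm_sq (β : ℝ) (f : 𝓢'(E d, ℂ)) :
    modNorm α φ Ω β f ^ 2 = ∑' p : ℕ × (Fin d → ℤ),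
      ENNReal.ofReal ((‖coeff α φ Ω f p.1 p.2‖ * weight β (Ω.freq p.1)) ^ 2) := by
  rw [modNorm, ← ENNReal.rpow_natCast, ← ENNReal.rpow_mul]
  norm_num
  rw [ENNReal.tsum_prod (f := fun k j =>
    ENNReal.ofReal ((‖coeff α φ Ω f k j‖ * weight β (Ω.freq k)) ^ 2))]
  refine tsum_congr fun k => ?_
  rw [← ENNReal.tsum_mul_right]
  refine tsum_congr fun j => ?_
  rw [mul_pow, ENNReal.ofReal_mul (by positivity), ENNReal.ofReal_pow (norm_nonneg _),
    ENNReal.ofReal_pow (weight_nonneg _ _), ofReal_norm]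

theorem sum_coeff_le {β : ℝ} {f : 𝓢'(E d, ℂ)} (hf : f ∈ modSpace α φ Ω β)
    (F : Finset (ℕ × (Fin d → ℤ))) :
    ∑ p ∈ F, (‖coeff α φ Ω f p.1 p.2‖ * weight β (Ω.freq p.1)) ^ 2 ≤
      (modNorm α φ Ω β f).toReal ^ 2 := by
  have hf' : modNorm α φ Ω β f ≠ ∞ := ne_of_lt hf
  have h1 := ENNReal.sum_le_tsum (f := fun p : ℕ × (Fin d → ℤ) =>
    ENNReal.ofReal ((‖coeff α φ Ω f p.1 p.2‖ * weight β (Ω.freq p.1)) ^ 2)) F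
  rw [← modNorm_sq, ← ENNReal.ofReal_sum_of_nonneg fun _ _ => by positivity] at h1
  rw [← ENNReal.toReal_pow]
  exact (ENNReal.ofReal_le_iff_le_toReal (ENNReal.pow_ne_top hf')).mp h1

theorem modNorm_le {β M : ℝ} (hM : 0 ≤ M) {f : 𝓢'(E d, ℂ)}
    (h : ∀ F : Finset (ℕ × (Fin d → ℤ)),
      ∑ p ∈ F, (‖coeff α φ Ω f p.1 p.2‖ * weight β (Ω.freq p.1)) ^ 2 ≤ M ^ 2) :
    modNorm α φ Ω β f ≤ ENNReal.ofReal M := by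
  refine (ENNReal.pow_le_pow_left_iff two_ne_zero).mp ?_
  rw [modNorm_sq, ENNReal.tsum_eq_iSup_sum, ← ENNReal.ofReal_pow hM]
  refine iSup_le fun F => ?_
  rw [← ENNReal.ofReal_sum_of_nonneg fun _ _ => by positivity]
  exact ENNReal.ofReal_le_ofReal (h F)

/-! ### Conjugation of test functions -/

theorem conjSchwartz_sub (u v : 𝓢(E d, ℂ)) :
    conjSchwartz (u - v) = conjSchwartz u - conjSchwartz v :=
  map_sub (SchwartzMap.postcompCLM (𝕜 := ℝ) (Complex.conjCLE : ℂ →L[ℝ] ℂ)) u v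

theorem conjSchwartz_sum {ι : Type*} (F : Finset ι) (u : ι → 𝓢(E d, ℂ)) :
    conjSchwartz (∑ p ∈ F, u p) = ∑ p ∈ F, conjSchwartz (u p) :=
  map_sum (SchwartzMap.postcompCLM (𝕜 := ℝ) (Complex.conjCLE : ℂ →L[ℝ] ℂ)) u F

theorem conjSchwartz_smul (a : ℂ) (u : 𝓢(E d, ℂ)) :
    conjSchwartz (a • u) = (starRingEnd ℂ) a • conjSchwartz u := by
  ext x
  simp [conjSchwartz_apply]

theorem conjSchwartz_conjSchwartz (u : 𝓢(E d, ℂ)) : conjSchwartz (conjSchwartz u) = u := by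
  ext x
  simp [conjSchwartz_apply]

/-- This moves the antilinear pairing to the frequency side: `f (conjSchwartz ψ)` is `𝓕 f` at the
conjugate of `𝓕 ψ`. -/
theorem fourier_conjSchwartz_fourier (ψ : 𝓢(E d, ℂ)) :
    𝓕 (conjSchwartz (𝓕 ψ)) = conjSchwartz ψ := by
  ext x
  have h1 : ψ x = (𝓕⁻ (𝓕 ψ) : 𝓢(E d, ℂ)) x := by rw [FourierTransform.fourierInv_fourier_eq]
  rw [conjSchwartz_apply, h1, SchwartzMap.fourier_coe, SchwartzMap.fourierInv_coe,
    Real.fourier_eq', Real.fourierInv_eq', ← integral_conj]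
  refine integral_congr_ae (Filter.Eventually.of_forall fun v => ?_)
  simp only [conjSchwartz_apply, smul_eq_mul, map_mul, ← Complex.exp_conj, Complex.conj_ofReal,
    Complex.conj_I]
  congr 2
  push_cast
  ring

/-- The pairing is a finite sum of coefficients of `f` against analysis coefficients of `ψ`.
Cauchy–Schwarz applies after distributing the weights `β` and `-β`: the first factor is part of the
modulation norm, the second is controlled by the Bessel bound. -/
theorem norm_frameSum_pairing_le (hR : 1 ≤ R) (hs : SlowBracket α c Ω R η)
    (hc : BandLimited c φ) {B : ℝ} (hB : 0 ≤ B)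
    (hφ : SynthesisBound B fun p : ℕ × (Fin d → ℤ) => toL2 (latticePacket α φ Ω p.1 p.2))
    {β : ℝ} (hβ : |β| * η ≤ 1 / 2) :
    ∃ K : ℝ, 0 ≤ K ∧ ∀ f ∈ modSpace α φ Ω β, ∀ F ψ,
      ‖f (conjSchwartz (frameSum α φ φ Ω 1 F ψ))‖ ≤
        K * (modNorm α φ Ω β f).toReal * sobNorm R (-β) ψ := by
  have hR0 : 0 < R := one_pos.trans_le hR
  obtain ⟨C, hC, hw⟩ := exists_weight_comparable (d := d) hR β
  refine ⟨C * √(102 * B), by positivity, fun f hf F ψ => ?_⟩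
  set y := toL2 (bracketMul R (-β) (𝓕 ψ)) with hy
  have h1 : f (conjSchwartz (frameSum α φ φ Ω 1 F ψ)) =
      ∑ p ∈ F, (starRingEnd ℂ) (inner ℂ (toL2 (latticePacket α φ Ω p.1 p.2)) (toL2 ψ)) *
        coeff α φ Ω f p.1 p.2 := by
    simp only [frameSum, conjSchwartz_sum, conjSchwartz_smul, map_sum, map_smul, Pi.one_apply,
      one_mul, smul_eq_mul, coeff]
  have h2 := (synthesisBound_weightedPacket hR0 hs hc hB hφ hβ).analysis (by positivity) F y
  have h3 : ∀ p : ℕ × (Fin d → ℤ),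
      ‖(starRingEnd ℂ) (inner ℂ (toL2 (latticePacket α φ Ω p.1 p.2)) (toL2 ψ)) *
        coeff α φ Ω f p.1 p.2‖ ≤ C * (‖inner ℂ (toL2 (weightedPacket α φ Ω R β p)) y‖ *
          (‖coeff α φ Ω f p.1 p.2‖ * weight β (Ω.freq p.1))) := by
    intro p
    have h4 := (hw (Ω.center p.1)).2
    rw [Ω.two_pi_smul_center] at h4
    rw [norm_mul, RCLike.norm_conj, inner_latticePacket_eq hR0 (-β), neg_neg, ← hy, norm_mul,
      Complex.norm_real, Real.norm_of_nonneg (Real.rpow_nonneg (bracket_nonneg _ _) _)]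
    calc _ ≤ C * weight β (Ω.freq p.1) * ‖inner ℂ (toL2 (weightedPacket α φ Ω R β p)) y‖ *
          ‖coeff α φ Ω f p.1 p.2‖ := by gcongr
      _ = _ := by ring
  rw [h1]
  refine (norm_sum_le _ _).trans ((Finset.sum_le_sum fun p _ => h3 p).trans ?_)
  rw [← Finset.mul_sum, mul_assoc C, mul_assoc C]
  refine mul_le_mul_of_nonneg_left ?_ hC.le
  refine (Real.sum_mul_le_sqrt_mul_sqrt _ _ _).trans ?_
  calc _ ≤ √(102 * B * ‖y‖ ^ 2) * √((modNorm α φ Ω β f).toReal ^ 2) := by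
        gcongr
        exact sum_coeff_le hf F
    _ = √(102 * B) * (modNorm α φ Ω β f).toReal * ‖y‖ := by
        rw [Real.sqrt_mul (by positivity), Real.sqrt_sq (norm_nonneg _),
          Real.sqrt_sq ENNReal.toReal_nonneg]
        ring

/-! ### Duality and Riesz representation -/

theorem IsAdmissiblePair.exists_bandLimited (h : IsAdmissiblePair α φ Ω) :
    ∃ c : ℝ, 0 < c ∧ BandLimited c φ := by
  obtain ⟨c₁, c₂, h1, h2, hs⟩ := h.annulus
  refine ⟨c₂, h1.trans h2, closure_minimal (fun ξ hξ => ?_) Metric.isClosed_closedBall⟩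
  rw [mem_closedBall_zero_iff]
  exact (hs hξ).2

/-- Elements of a modulation space are bounded by weighted Sobolev norms. -/
theorem exists_modSpace_pairing_le (hd : 1 ≤ d) (hα : 0 < α) (h : IsAdmissiblePair α φ Ω)
    (β : ℝ) : ∃ R K : ℝ, 1 ≤ R ∧ 0 ≤ K ∧ ∀ f ∈ modSpace α φ Ω β, ∀ ψ,
      ‖f (conjSchwartz ψ)‖ ≤ K * (modNorm α φ Ω β f).toReal * sobNorm R (-β) ψ := by
  obtain ⟨c, hc, hφ⟩ := h.exists_bandLimited
  obtain ⟨B₀, hB₀, hsyn₀⟩ := exists_synthesisBound hα h.lattice hc hφ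
  have hB : 0 < B₀ + 1 := by positivity
  have hsyn := hsyn₀.mono (le_add_of_nonneg_right zero_le_one)
  set B := B₀ + 1
  -- With `N = 0`, `axisNorm` is `d` times the Sobolev norm of order `-β`. These constants are fixed
  -- before `f`, and only they enter `K`.
  obtain ⟨R, κ', q', η, hR, -, -, hq'0, hq'1, hslow, hη, hcon'⟩ :=
    exists_axisNorm_contraction hα h.lattice hc hφ h.frame hB hsyn (-β) 0
  rw [abs_neg] at hη
  obtain ⟨K, hK, hKf⟩ := norm_frameSum_pairing_le hR hslow hφ hB.le hsyn hη
  have hq'' : 0 < 1 - q' := by linarith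
  refine ⟨R, B⁻¹ * K / (1 - q'), hR, by positivity, fun f hf ψ => ?_⟩
  obtain ⟨s, N, hfN⟩ := exists_tempered_le hd hα.le f
  obtain ⟨R₁, κ, q, -, hR₁, hκ, hκ1, hq0, hq1, -, -, hcon⟩ :=
    exists_axisNorm_contraction hα h.lattice hc hφ h.frame hB hsyn s N
  obtain ⟨C, hC, hfC⟩ := hfN R₁ κ hR₁ hκ hκ1
  have hd0 : (0 : ℝ) < d := by exact_mod_cast hd
  have key := le_of_contraction (Φ := fun ψ => ‖f (conjSchwartz ψ)‖)
    (P := axisNorm R₁ κ s α N) (Q := sobNorm R (-β))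
    (K := B⁻¹ * (K * (modNorm α φ Ω β f).toReal)) (by positivity) hq0 hq1 hq'1
    (fun ψ => sobNorm_nonneg _ _ _) hC hfC (fun ψ => ?_) ψ
  · refine key.trans_eq ?_
    ring
  -- Both contractions hold for all large `F`, so a single frame step achieves them simultaneously.
  obtain ⟨F, hF, hF'⟩ := ((hcon ψ).and (hcon' ψ)).exists
  refine ⟨_, hF, ?_, ?_⟩
  · rw [axisNorm_zero, axisNorm_zero, mul_left_comm] at hF'
    exact le_of_mul_le_mul_left hF' hd0
  · rw [conjSchwartz_sub, map_sub, conjSchwartz_smul, map_smul]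
    refine (norm_le_norm_sub_add _ _).trans (add_le_add le_rfl ?_)
    rw [norm_smul, RCLike.norm_conj, Complex.norm_real, Real.norm_of_nonneg (by positivity),
      mul_assoc]
    exact mul_le_mul_of_nonneg_left (hKf f hf F ψ) (by positivity)

/-- The Fourier transform of an element of a modulation space is a function in a weighted `L²`
space. -/
theorem exists_representedBy (hd : 1 ≤ d) (hα : 0 < α) (h : IsAdmissiblePair α φ Ω) (β : ℝ) :
    ∃ R K : ℝ, 1 ≤ R ∧ 0 ≤ K ∧ ∀ f ∈ modSpace α φ Ω β, ∃ G : Lp ℂ 2 (volume : Measure (E d)),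
      ‖G‖ ≤ K * (modNorm α φ Ω β f).toReal ∧
      RepresentedBy (𝓕 f) fun ζ => (starRingEnd ℂ) (G ζ) * ((bracket R ζ ^ (-β) : ℝ) : ℂ) := by
  obtain ⟨R, K, hR, hK, hf⟩ := exists_modSpace_pairing_le hd hα h β
  have hR0 : 0 < R := one_pos.trans_le hR
  refine ⟨R, K, hR, hK, fun f hfβ => ?_⟩
  set M := K * (modNorm α φ Ω β f).toReal
  have hM : 0 ≤ M := by positivity
  have h1 : ∀ χ : 𝓢(E d, ℂ), ‖𝓕 f χ‖ ≤ M * ‖toL2 (bracketMul R (-β) χ)‖ := by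
    intro χ
    have h2 := hf f hfβ (𝓕⁻ (conjSchwartz χ))
    rw [← fourier_conjSchwartz_fourier, FourierTransform.fourier_fourierInv_eq,
      conjSchwartz_conjSchwartz] at h2
    refine h2.trans_eq ?_
    congr 1
    unfold sobNorm
    rw [FourierTransform.fourier_fourierInv_eq, ← sq_eq_sq₀ (norm_nonneg _) (norm_nonneg _),
      norm_toL2_sq, norm_toL2_sq]
    simp only [bracketMul_apply hR0, conjSchwartz_apply, norm_mul, RCLike.norm_conj]
  -- Composing `𝓕 f` with multiplication by `bracket ^ β` gives a functional bounded in the plain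
  -- `L²` norm, which extends from the dense Schwartz space and is represented by `G`.
  set ℓ : 𝓢(E d, ℂ) →ₗ[ℂ] ℂ :=
    ((𝓕 f : 𝓢'(E d, ℂ)) : 𝓢(E d, ℂ) →ₗ[ℂ] ℂ).comp ((bracketMul R β : 𝓢(E d, ℂ) →L[ℂ] 𝓢(E d, ℂ)) : 𝓢(E d, ℂ) →ₗ[ℂ] 𝓢(E d, ℂ))
    with hℓ
  set T : 𝓢(E d, ℂ) →L[ℂ] Lp ℂ 2 (volume : Measure (E d)) := toL2 with hT
  have hℓM : ∀ u, ‖ℓ u‖ ≤ M * ‖(T : 𝓢(E d, ℂ) →ₗ[ℂ] Lp ℂ 2 (volume : Measure (E d))) u‖ := by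
    intro u
    have h2 := h1 (bracketMul R β u)
    have h3 := bracketMul_neg_cancel hR0 (-β) u
    rw [neg_neg] at h3
    rw [h3] at h2
    exact h2
  have hdense : DenseRange (T : 𝓢(E d, ℂ) →ₗ[ℂ] Lp ℂ 2 (volume : Measure (E d))) :=
    SchwartzMap.denseRange_toLpCLM (by norm_num)
  set Λ := ℓ.extendOfNorm (T : 𝓢(E d, ℂ) →ₗ[ℂ] Lp ℂ 2 (volume : Measure (E d)))
  set G := (InnerProductSpace.toDual ℂ (Lp ℂ 2 (volume : Measure (E d)))).symm Λ with hG
  refine ⟨G, ?_, fun χ => ?_⟩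
  · rw [hG, LinearIsometryEquiv.norm_map]
    exact ContinuousLinearMap.opNorm_le_bound _ hM
      (LinearMap.norm_extendOfNorm_apply_le hdense M hℓM)
  · have h2 : 𝓕 f χ = inner ℂ G (toL2 (bracketMul R (-β) χ)) := by
      rw [hG, InnerProductSpace.toDual_symm_apply]
      have h3 := LinearMap.extendOfNorm_eq hdense ⟨M, hℓM⟩ (bracketMul R (-β) χ)
      refine Eq.trans ?_ h3.symm
      have h4 := bracketMul_neg_cancel hR0 β χ
      change 𝓕 f χ = 𝓕 f (bracketMul R β (bracketMul R (-β) χ))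
      rw [h4]
    have h5 : (fun ζ => inner ℂ (G ζ) (toL2 (bracketMul R (-β) χ) ζ)) =ᵐ[volume]
        fun ζ => (starRingEnd ℂ) (G ζ) * ((bracket R ζ ^ (-β) : ℝ) : ℂ) * χ ζ := by
      filter_upwards [coeFn_toL2 (bracketMul R (-β) χ)] with ζ hζ
      rw [hζ, bracketMul_apply hR0]
      simp only [RCLike.inner_apply]
      ring
    refine ⟨(L2.integrable_inner (𝕜 := ℂ) G _).congr h5, ?_⟩
    rw [h2, L2.inner_def]
    exact integral_congr_ae h5

end

section

/-! ### Fourier multipliers on modulation spaces -/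

theorem RepresentedBy.locallyIntegrable {u : 𝓢'(E d, ℂ)} {g : E d → ℂ} (h : RepresentedBy u g) :
    LocallyIntegrable g := by
  intro x
  let χ : ContDiffBump x := ⟨1, 2, one_pos, one_lt_two⟩
  have h1 : HasCompactSupport (Complex.ofRealCLM ∘ χ) := χ.hasCompactSupport.comp_left rfl
  have h2 : ContDiff ℝ (⊤ : ℕ∞) (Complex.ofRealCLM ∘ χ) :=
    Complex.ofRealCLM.contDiff.comp χ.contDiff
  refine ⟨Metric.closedBall x 1, Metric.closedBall_mem_nhds x one_pos, ?_⟩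
  refine ((h (h1.toSchwartzMap h2)).1.integrableOn (s := Metric.closedBall x 1)).congr_fun
    (fun ζ hζ => ?_) measurableSet_closedBall
  have h3 : χ ζ = 1 := χ.one_of_mem_closedBall hζ
  change g ζ * ((χ ζ : ℝ) : ℂ) = g ζ
  rw [h3, Complex.ofReal_one, mul_one]

theorem RepresentedBy.ae_eq {u : 𝓢'(E d, ℂ)} {g g' : E d → ℂ} (h : RepresentedBy u g)
    (h' : RepresentedBy u g') : g =ᵐ[volume] g' := by
  refine ae_eq_of_integral_contDiff_smul_eq h.locallyIntegrable h'.locallyIntegrable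
    fun χ hχ hχc => ?_
  have h1 : HasCompactSupport (Complex.ofRealCLM ∘ χ) := hχc.comp_left rfl
  have h2 : ContDiff ℝ (⊤ : ℕ∞) (Complex.ofRealCLM ∘ χ) := Complex.ofRealCLM.contDiff.comp hχ
  have h3 := (h (h1.toSchwartzMap h2)).2.symm.trans (h' (h1.toSchwartzMap h2)).2
  have h4 : ∀ (f : E d → ℂ), ∫ ζ, χ ζ • f ζ = ∫ ζ, f ζ * h1.toSchwartzMap h2 ζ := by
    intro f
    refine integral_congr_ae (Filter.Eventually.of_forall fun ζ => ?_)
    change (χ ζ : ℝ) • f ζ = f ζ * ((χ ζ : ℝ) : ℂ)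
    rw [Complex.real_smul, mul_comm]
  rw [h4, h4, h3]

theorem RepresentedBy.congr {u : 𝓢'(E d, ℂ)} {g g' : E d → ℂ} (h : RepresentedBy u g)
    (hg : g =ᵐ[volume] g') : RepresentedBy u g' := by
  intro ψ
  have h1 : (fun ζ => g ζ * ψ ζ) =ᵐ[volume] fun ζ => g' ζ * ψ ζ := by
    filter_upwards [hg] with ζ hζ
    rw [hζ]
  exact ⟨(h ψ).1.congr h1, (h ψ).2.trans (integral_congr_ae h1)⟩

theorem RepresentedBy.unique {u u' : 𝓢'(E d, ℂ)} {g : E d → ℂ} (h : RepresentedBy (𝓕 u) g)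
    (h' : RepresentedBy (𝓕 u') g) : u = u' := by
  ext ψ
  have h1 := (h (𝓕⁻ ψ)).2.trans (h' (𝓕⁻ ψ)).2.symm
  rwa [TemperedDistribution.fourier_apply, TemperedDistribution.fourier_apply,
    FourierTransform.fourier_fourierInv_eq] at h1

/-- The function representing `𝓕 f` is unique almost everywhere, so the multiplier image does not
depend on the representative. -/
theorem IsMultiplierImage.representedBy {m : E d → ℂ} {f u : 𝓢'(E d, ℂ)} {g : E d → ℂ}
    (h : IsMultiplierImage m f u) (hg : RepresentedBy (𝓕 f) g) :
    RepresentedBy (𝓕 u) fun ζ => m ((2 * Real.pi) • ζ) * g ζ := by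
  obtain ⟨g', h1, h2⟩ := h
  refine h2.congr ?_
  filter_upwards [h1.ae_eq hg] with ζ hζ
  rw [hζ]

/-- A function in a weighted `L²` space is the Fourier transform of a tempered distribution. -/
theorem exists_representedBy_fourier {R : ℝ} (hR : 0 < R) (s : ℝ)
    (H : Lp ℂ 2 (volume : Measure (E d))) :
    ∃ u : 𝓢'(E d, ℂ), RepresentedBy (𝓕 u) fun ζ => ((bracket R ζ ^ s : ℝ) : ℂ) * H ζ := by
  refine ⟨𝓕⁻ (PointwiseConvergenceCLM.precomp ℂ (bracketMul R s) (H : 𝓢'(E d, ℂ))),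
    fun ψ => ⟨?_, ?_⟩⟩
  · have h1 := (Lp.memLp H).integrable_mul ((bracketMul R s ψ).memLp 2 volume)
    refine h1.congr (Filter.Eventually.of_forall fun ζ => ?_)
    simp only [Pi.mul_apply, bracketMul_apply hR]
    ring
  · rw [FourierTransform.fourier_fourierInv_eq]
    change (H : 𝓢'(E d, ℂ)) (bracketMul R s ψ) = _
    rw [Lp.toTemperedDistribution_apply]
    refine integral_congr_ae (Filter.Eventually.of_forall fun ζ => ?_)
    simp only [smul_eq_mul, bracketMul_apply hR]
    ring

/-! ### Weighted `L²` functions and symbols -/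

variable {α : ℝ} {Ω : PhaseLattice d} {φ : 𝓢(E d, ℂ)}

/-- Weighted `L²` functions on the frequency side give elements of a modulation space. -/
theorem exists_modNorm_le (hα : 0 < α) (h : IsAdmissiblePair α φ Ω) (β : ℝ) :
    ∃ R K : ℝ, 1 ≤ R ∧ 0 ≤ K ∧ ∀ (u : 𝓢'(E d, ℂ)) (H : Lp ℂ 2 (volume : Measure (E d))),
      (RepresentedBy (𝓕 u) fun ζ => ((bracket R ζ ^ (-β) : ℝ) : ℂ) * H ζ) →
      modNorm α φ Ω β u ≤ ENNReal.ofReal (K * ‖H‖) := by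
  obtain ⟨c, hc, hφ⟩ := h.exists_bandLimited
  obtain ⟨B, hB, hsyn⟩ := exists_synthesisBound hα h.lattice hc hφ
  obtain ⟨μ, hμ, hμΩ⟩ := exists_norm_freq_lower_bound h.lattice.1
  have hη : 0 < 1 / (2 * (|β| + 1)) := by positivity
  obtain ⟨R, hR, hslow⟩ := exists_bracket_slow hα hμ hμΩ hc hη
  have hβη : |β| * (1 / (2 * (|β| + 1))) ≤ 1 / 2 := by
    rw [mul_one_div, div_le_div_iff₀ (by positivity) two_pos]
    linarith
  have hR0 : 0 < R := one_pos.trans_le hR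
  obtain ⟨C, hC, hw⟩ := exists_weight_comparable (d := d) hR β
  refine ⟨R, C * √(102 * B), hR, by positivity, fun u H hu => modNorm_le (by positivity) fun F => ?_⟩
  have h1 := (synthesisBound_weightedPacket hR0 (hslow R le_rfl) hφ hB hsyn (s := -β)
    (by rwa [abs_neg])).analysis (by positivity) F H
  -- The coefficients of `u` are those of `H` against the weighted packets, up to the bracket at the
  -- centres; that factor cancels the modulation weight.
  have h2 : ∀ p : ℕ × (Fin d → ℤ), coeff α φ Ω u p.1 p.2 =
      ((bracket R (Ω.center p.1) ^ (-β) : ℝ) : ℂ) *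
        inner ℂ (toL2 (weightedPacket α φ Ω R (-β) p)) H := by
    intro p
    have h3 : coeff α φ Ω u p.1 p.2 = 𝓕 u (conjSchwartz (freqPacket α φ Ω p)) := by
      rw [TemperedDistribution.fourier_apply, freqPacket, fourier_conjSchwartz_fourier]
      rfl
    have h4 := congrArg (fun y => inner ℂ y H)
      (toL2_bracketMul_freqPacket (α := α) (g := φ) (Ω := Ω) hR0 (-β) p)
    simp only [inner_smul_left, Complex.conj_ofReal] at h4
    rw [h3, (hu _).2, ← h4, L2.inner_def]
    refine integral_congr_ae ?_
    filter_upwards [coeFn_toL2 (bracketMul R (-β) (freqPacket α φ Ω p))] with ζ hζ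
    rw [hζ, bracketMul_apply hR0, conjSchwartz_apply]
    simp only [RCLike.inner_apply, map_mul, Complex.conj_ofReal]
    ring
  calc _ ≤ ∑ p ∈ F, (C * ‖inner ℂ (toL2 (weightedPacket α φ Ω R (-β) p)) H‖) ^ 2 := by
        refine Finset.sum_le_sum fun p _ => ?_
        have hJ := Real.rpow_pos_of_pos (bracket_pos hR0 (Ω.center p.1)) (-β)
        have hW := (hw (Ω.center p.1)).1
        rw [Ω.two_pi_smul_center] at hW
        have hw0 := weight_nonneg β (Ω.freq p.1)
        have h5 : bracket R (Ω.center p.1) ^ (-β) * weight β (Ω.freq p.1) ≤ C := by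
          rw [Real.rpow_neg (bracket_nonneg _ _), inv_mul_le_iff₀
            (Real.rpow_pos_of_pos (bracket_pos hR0 _) _), mul_comm]
          exact hW
        rw [h2, norm_mul, Complex.norm_real, Real.norm_of_nonneg hJ.le]
        refine pow_le_pow_left₀ (by positivity) ?_ 2
        calc _ = bracket R (Ω.center p.1) ^ (-β) * weight β (Ω.freq p.1) *
              ‖inner ℂ (toL2 (weightedPacket α φ Ω R (-β) p)) H‖ := by ring
          _ ≤ _ := by gcongr
    _ = C ^ 2 * ∑ p ∈ F, ‖inner ℂ (toL2 (weightedPacket α φ Ω R (-β) p)) H‖ ^ 2 := by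
        simp only [mul_pow, Finset.mul_sum]
    _ ≤ C ^ 2 * (102 * B * ‖H‖ ^ 2) := by gcongr
    _ = _ := by
        rw [mul_pow, mul_pow, Real.sq_sqrt (by positivity)]
        ring

/-- A symbol satisfying the Miyachi condition that is bounded near the origin is bounded by a
weight. -/
theorem TwoSidedMiyachi.exists_norm_le {m : E d → ℂ} {β₀ a b : ℝ}
    (hm : TwoSidedMiyachi α β₀ a b m) (hm' : BoundedNearOrigin m) :
    ∃ C : ℝ, 0 ≤ C ∧ ∀ ξ : E d, ξ ≠ 0 → ‖m ξ‖ ≤ C * weight (-β₀) ξ := by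
  obtain ⟨σ, -, -, C, hC⟩ := hm
  obtain ⟨K, hK⟩ := hm'
  refine ⟨(|C| + |K|) * 2 ^ |(-β₀)|, by positivity, fun ξ hξ => ?_⟩
  have hξ0 : 0 < ‖ξ‖ := norm_pos_iff.mpr hξ
  rw [mul_assoc, add_mul]
  have hw := weight_nonneg (-β₀) ξ
  have h0 : (0 : ℝ) < 2 ^ |(-β₀)| := by positivity
  rcases le_or_gt 1 ‖ξ‖ with h | h
  · have h1 := (hC 0 (Nat.zero_le _) Fin.elim0 ξ).1 h
    simp only [partialDeriv, iteratedFDeriv_zero_apply, Nat.cast_zero, mul_zero, add_zero] at h1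
    have h2 := rpow_le_rpow_of_comparable hξ0 (by positivity : 0 < 1 + ‖ξ‖) one_le_two
      (by linarith) (by linarith) (-β₀)
    refine h1.trans (le_add_of_le_of_nonneg ?_ (by positivity))
    exact mul_le_mul (le_abs_self C) h2 (by positivity) (abs_nonneg C)
  · have h2 := rpow_le_rpow_of_comparable one_pos (by positivity : 0 < 1 + ‖ξ‖) one_le_two
      (by linarith) (by linarith) (-β₀)
    rw [Real.one_rpow] at h2
    refine (hK ξ hξ0 h).trans (le_add_of_nonneg_of_le (by positivity) ?_)
    exact (le_abs_self K).trans (le_mul_of_one_le_right (abs_nonneg K) h2)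

theorem ae_ne_zero (hd : 1 ≤ d) : ∀ᵐ ζ : E d, ζ ≠ 0 := by
  have : Nonempty (Fin d) := ⟨⟨0, hd⟩⟩
  exact Measure.ae_ne volume 0

theorem aestronglyMeasurable_symbol (hd : 1 ≤ d) {m : E d → ℂ} (hm : ContinuousOn m {0}ᶜ) :
    AEStronglyMeasurable (fun ζ => m ((2 * Real.pi) • ζ)) (volume : Measure (E d)) := by
  have h1 : ContinuousOn (fun ζ : E d => m ((2 * Real.pi) • ζ)) {0}ᶜ :=
    hm.comp (continuous_const_smul _).continuousOn fun ζ hζ =>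
      smul_ne_zero Real.two_pi_pos.ne' hζ
  have h2 := h1.aestronglyMeasurable (μ := (volume : Measure (E d)))
    (measurableSet_singleton 0).compl
  rwa [Measure.restrict_eq_self_of_ae_mem] at h2
  exact ae_ne_zero hd

/-- A symbol bounded by a weight maps weighted `L²` functions to weighted `L²` functions. -/
theorem exists_symbol_mul (hd : 1 ≤ d) {m : E d → ℂ} (hmc : ContinuousOn m {0}ᶜ) {C β₀ : ℝ}
    (hC : 0 ≤ C) (hm : ∀ ξ : E d, ξ ≠ 0 → ‖m ξ‖ ≤ C * weight (-β₀) ξ) {R R' : ℝ} (hR : 1 ≤ R)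
    (hR' : 1 ≤ R') (β : ℝ) : ∃ K : ℝ, 0 ≤ K ∧ ∀ G : Lp ℂ 2 (volume : Measure (E d)),
      ∃ H : Lp ℂ 2 (volume : Measure (E d)), ‖H‖ ≤ K * ‖G‖ ∧
        (fun ζ => m ((2 * Real.pi) • ζ) *
          ((starRingEnd ℂ) (G ζ) * ((bracket R ζ ^ (-(β - β₀)) : ℝ) : ℂ))) =ᵐ[volume]
        fun ζ => ((bracket R' ζ ^ (-β) : ℝ) : ℂ) * H ζ := by
  have hR0 : 0 < R := one_pos.trans_le hR
  have hR'0 : 0 < R' := one_pos.trans_le hR'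
  obtain ⟨C₁, hC₁, hw₁⟩ := exists_weight_comparable (d := d) hR (-(β - β₀))
  obtain ⟨C₂, hC₂, hw₂⟩ := exists_weight_comparable (d := d) hR' β
  refine ⟨C * (C₁ * C₂), by positivity, fun G => ?_⟩
  set h : E d → ℂ := fun ζ => ((bracket R' ζ ^ β : ℝ) : ℂ) * (m ((2 * Real.pi) • ζ) *
    ((starRingEnd ℂ) (G ζ) * ((bracket R ζ ^ (-(β - β₀)) : ℝ) : ℂ))) with hh
  have hmeas : ∀ {r : ℝ} (_ : 0 < r) (s : ℝ),
      AEStronglyMeasurable (fun ζ : E d => ((bracket r ζ ^ s : ℝ) : ℂ)) volume := fun hr s =>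
    (hasTemperateGrowth_bracket_rpow hr s).1.continuous.aestronglyMeasurable
  have h1 : AEStronglyMeasurable h volume :=
    (hmeas hR'0 β).mul ((aestronglyMeasurable_symbol hd hmc).mul
      ((Complex.continuous_conj.comp_aestronglyMeasurable (Lp.aestronglyMeasurable G)).mul
        (hmeas hR0 _)))
  have h2 : ∀ᵐ ζ : E d, ‖h ζ‖ ≤ C * (C₁ * C₂) * ‖G ζ‖ := by
    filter_upwards [ae_ne_zero hd] with ζ hζ
    have h3 := hm _ (smul_ne_zero Real.two_pi_pos.ne' hζ)
    have h4 := (hw₁ ζ).2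
    have h5 := (hw₂ ζ).2
    have hJ := Real.rpow_nonneg (bracket_nonneg R ζ) (-(β - β₀))
    have hJ' := Real.rpow_nonneg (bracket_nonneg R' ζ) β
    simp only [hh, norm_mul, Complex.norm_real, RCLike.norm_conj, Real.norm_of_nonneg hJ,
      Real.norm_of_nonneg hJ']
    -- The exponents `β`, `-β₀` and `-(β - β₀)` add up to zero. Passing through `weight` allows the
    -- two scales `R` and `R'` to differ.
    have hww : weight β ((2 * Real.pi) • ζ) * (weight (-β₀) ((2 * Real.pi) • ζ) *
        weight (-(β - β₀)) ((2 * Real.pi) • ζ)) = 1 := by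
      have h0 : 0 < 1 + ‖(2 * Real.pi) • ζ‖ := by positivity
      simp only [weight]
      rw [← Real.rpow_add h0, ← Real.rpow_add h0]
      ring_nf
      exact Real.rpow_zero _
    have w1 := weight_nonneg β ((2 * Real.pi) • ζ)
    have w2 := weight_nonneg (-β₀) ((2 * Real.pi) • ζ)
    calc _ ≤ C₂ * weight β ((2 * Real.pi) • ζ) * (C * weight (-β₀) ((2 * Real.pi) • ζ) *
          (‖G ζ‖ * (C₁ * weight (-(β - β₀)) ((2 * Real.pi) • ζ)))) := by gcongr
      _ = C * (C₁ * C₂) * ‖G ζ‖ * (weight β ((2 * Real.pi) • ζ) *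
          (weight (-β₀) ((2 * Real.pi) • ζ) * weight (-(β - β₀)) ((2 * Real.pi) • ζ))) := by ring
      _ = _ := by rw [hww, mul_one]
  have h3 : MemLp h 2 volume := (Lp.memLp G).of_le_mul h1 h2
  refine ⟨h3.toLp h, Lp.norm_le_mul_norm_of_ae_le_mul ?_, ?_⟩
  · filter_upwards [h2, h3.coeFn_toLp] with ζ hζ hζ'
    rwa [hζ']
  · filter_upwards [h3.coeFn_toLp] with ζ hζ
    rw [hζ, hh]
    dsimp only
    rw [← mul_assoc ((bracket R' ζ ^ (-β) : ℝ) : ℂ), ← Complex.ofReal_mul,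
      ← Real.rpow_add (bracket_pos hR'0 ζ), neg_add_cancel, Real.rpow_zero, Complex.ofReal_one,
      one_mul]

/-- `𝓕 f` lies in a weighted `L²` space, the symbol shifts its weight by `β₀`, and the product is
the Fourier transform of an element of the target space. Uniqueness follows from uniqueness of
representing functions and injectivity of `𝓕`. -/
theorem multiplierBounded (hd : 1 ≤ d) (hα : 0 < α) (h : IsAdmissiblePair α φ Ω) {m : E d → ℂ}
    {β₀ a b : ℝ} (hm : TwoSidedMiyachi α β₀ a b m) (hm' : BoundedNearOrigin m) (β : ℝ) :
    MultiplierBounded α φ Ω m (β - β₀) β := by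
  obtain ⟨C, hC, hmC⟩ := hm.exists_norm_le hm'
  have hmc : ContinuousOn m {0}ᶜ := by
    obtain ⟨σ, -, hσ, -⟩ := hm
    exact hσ.continuousOn
  obtain ⟨R, K, hR, hK, hf⟩ := exists_representedBy hd hα h (β - β₀)
  obtain ⟨R', K', hR', hK', hu⟩ := exists_modNorm_le hα h β
  obtain ⟨M, hM, hG⟩ := exists_symbol_mul hd hmc hC hmC hR hR' β
  refine ⟨(K' * (M * K)).toNNReal, fun f hfβ => ?_⟩
  obtain ⟨G, hGf, hfG⟩ := hf f hfβ
  obtain ⟨H, hHG, hH⟩ := hG G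
  obtain ⟨u, hu'⟩ := exists_representedBy_fourier (one_pos.trans_le hR') (-β) H
  refine ⟨⟨u, ⟨_, hfG, hu'.congr hH.symm⟩, fun v hv => ?_⟩, fun v hv => ?_⟩
  · exact RepresentedBy.unique (hv.representedBy hfG) (hu'.congr hH.symm)
  · refine (hu v H ((hv.representedBy hfG).congr hH)).trans ?_
    have h1 : K' * ‖H‖ ≤ K' * (M * K) * (modNorm α φ Ω (β - β₀) f).toReal := by
      calc K' * ‖H‖ ≤ K' * (M * (K * (modNorm α φ Ω (β - β₀) f).toReal)) := by
            gcongr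
            exact hHG.trans (mul_le_mul_of_nonneg_left hGf hM)
        _ = _ := by ring
    refine (ENNReal.ofReal_le_ofReal h1).trans_eq ?_
    rw [ENNReal.ofReal_mul (by positivity), ENNReal.ofReal_toReal (ne_of_lt hfβ)]
    rfl

end

section

/-! ### The oscillatory symbol -/

theorem contDiffAt_norm_rpow {x : E d} (hx : x ≠ 0) (α : ℝ) (n : ℕ) :
    ContDiffAt ℝ n (fun ξ : E d => ‖ξ‖ ^ α) x :=
  (contDiffAt_norm ℝ hx).rpow_const_of_ne (norm_ne_zero_iff.mpr hx)

/-- The derivatives of a power of the norm are homogeneous. -/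
theorem norm_iteratedFDeriv_norm_rpow_smul {x : E d} (hx : x ≠ 0) (α : ℝ) (n : ℕ) {t : ℝ}
    (ht : 0 < t) : t ^ n * ‖iteratedFDeriv ℝ n (fun ξ : E d => ‖ξ‖ ^ α) (t • x)‖ =
      t ^ α * ‖iteratedFDeriv ℝ n (fun ξ : E d => ‖ξ‖ ^ α) x‖ := by
  set h : E d → ℝ := fun ξ => ‖ξ‖ ^ α with hh
  have h1 : h ∘ (dilation t ht.ne' : E d ≃L[ℝ] E d) = t ^ α • h := by
    ext ξ
    change ‖t • ξ‖ ^ α = t ^ α * ‖ξ‖ ^ α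
    rw [norm_smul, Real.norm_of_nonneg ht.le, Real.mul_rpow ht.le (norm_nonneg _)]
  have h2 := ContinuousLinearEquiv.iteratedFDerivWithin_comp_right
    (dilation t ht.ne' : E d ≃L[ℝ] E d) h uniqueDiffOn_univ (Set.mem_univ (dilation t ht.ne' x)) n
  rw [Set.preimage_univ, iteratedFDerivWithin_univ, iteratedFDerivWithin_univ, h1, iteratedFDeriv_const_smul_apply (contDiffAt_norm_rpow hx α n)] at h2
  have h3 : (iteratedFDeriv ℝ n h ((dilation t ht.ne' : E d ≃L[ℝ] E d) x)).compContinuousLinearMap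
      (fun _ => ((dilation t ht.ne' : E d ≃L[ℝ] E d) : E d →L[ℝ] E d)) =
      t ^ n • iteratedFDeriv ℝ n h (t • x) := by
    ext v
    change iteratedFDeriv ℝ n h (t • x) (fun i => t • v i) = _
    rw [ContinuousMultilinearMap.map_smul_univ]
    simp
  rw [h3] at h2
  have h4 := congrArg norm h2
  rw [norm_smul, norm_smul, Real.norm_of_nonneg (by positivity),
    Real.norm_of_nonneg (by positivity)] at h4
  exact h4.symm

/-- By homogeneity it suffices to bound the derivative on the unit sphere, where it is continuous
and the sphere is compact. -/
theorem exists_norm_iteratedFDeriv_norm_rpow_le (α : ℝ) (n : ℕ) :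
    ∃ C : ℝ, ∀ x : E d, x ≠ 0 →
      ‖iteratedFDeriv ℝ n (fun ξ : E d => ‖ξ‖ ^ α) x‖ ≤ C * ‖x‖ ^ (α - n) := by
  have hcont : ContinuousOn (iteratedFDeriv ℝ n fun ξ : E d => ‖ξ‖ ^ α)
      (Metric.sphere (0 : E d) 1) := by
    intro x hx
    have hx0 : x ≠ 0 := by
      rintro rfl
      simp at hx
    have h1 := (contDiffAt_norm_rpow hx0 α (n + 1)).iteratedFDeriv_right (m := 1) (i := n)
      (by norm_cast; rw [add_comm])
    exact h1.continuousAt.continuousWithinAt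
  obtain ⟨C, hC⟩ := (isCompact_sphere (0 : E d) 1).exists_bound_of_continuousOn hcont
  refine ⟨C, fun x hx => ?_⟩
  have hx0 : 0 < ‖x‖ := norm_pos_iff.mpr hx
  have hu : ‖‖x‖⁻¹ • x‖ = 1 := by
    rw [norm_smul, norm_inv, norm_norm, inv_mul_cancel₀ hx0.ne']
  have h1 := norm_iteratedFDeriv_norm_rpow_smul (x := ‖x‖⁻¹ • x)
    (norm_ne_zero_iff.mp (by rw [hu]; exact one_ne_zero)) α n hx0
  rw [smul_smul, mul_inv_cancel₀ hx0.ne', one_smul] at h1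
  have h2 := hC (‖x‖⁻¹ • x) (by rwa [mem_sphere_zero_iff_norm])
  rw [Real.rpow_sub hx0, Real.rpow_natCast, ← mul_div_assoc, le_div_iff₀ (by positivity),
    mul_comm, h1, mul_comm]
  gcongr

theorem norm_iteratedFDeriv_cexp_mul_I (n : ℕ) (s : ℝ) :
    ‖iteratedFDeriv ℝ n (fun s : ℝ => Complex.exp ((s : ℂ) * Complex.I)) s‖ = 1 := by
  have hn : ∀ n : ℕ, iteratedDeriv n (fun s : ℝ => Complex.exp ((s : ℂ) * Complex.I))
      = fun s : ℝ => Complex.I ^ n * Complex.exp ((s : ℂ) * Complex.I) := by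
    intro n
    induction n with
    | zero => simp
    | succ n ih =>
      rw [iteratedDeriv_succ, ih]
      funext s
      have h1 : HasDerivAt (fun s : ℝ => (s : ℂ) * Complex.I) (1 * Complex.I) s :=
        (Complex.ofRealCLM.hasDerivAt (x := s)).mul_const Complex.I
      have h2 := (h1.cexp).const_mul (Complex.I ^ n)
      rw [h2.deriv]
      ring
  rw [norm_iteratedFDeriv_eq_norm_iteratedDeriv, hn]
  simp [Complex.norm_exp_ofReal_mul_I]

/-- The composition formula of Faà di Bruno; every derivative of `s ↦ e^{is}` has norm one. -/
theorem norm_iteratedFDeriv_oscillatorySymbol_le {α : ℝ} {n : ℕ} {x : E d} (hx : x ≠ 0) {D : ℝ}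
    (hD : ∀ i, 1 ≤ i → i ≤ n → ‖iteratedFDeriv ℝ i (fun ξ : E d => ‖ξ‖ ^ α) x‖ ≤ D ^ i) :
    ‖iteratedFDeriv ℝ n (oscillatorySymbol α : E d → ℂ) x‖ ≤ n.factorial * D ^ n := by
  have ho : IsOpen ({0}ᶜ : Set (E d)) := isOpen_compl_singleton
  have h1 := norm_iteratedFDerivWithin_comp_le (𝕜 := ℝ) (n := n) (N := n) (s := ({0}ᶜ : Set (E d)))
    (t := Set.univ) (g := fun s : ℝ => Complex.exp ((s : ℂ) * Complex.I))
    (f := fun ξ : E d => ‖ξ‖ ^ α) (x := x)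
    (hasTemperateGrowth_cexp_mul_I.1.of_le (by exact_mod_cast le_top)).contDiffOn
    (fun y hy => (contDiffAt_norm_rpow hy α n).contDiffWithinAt) le_rfl uniqueDiffOn_univ
    ho.uniqueDiffOn (Set.mapsTo_univ _ _) hx (C := 1) (D := D)
    (fun i _ => by
      rw [iteratedFDerivWithin_univ]
      exact (norm_iteratedFDeriv_cexp_mul_I i _).le)
    (fun i h1 h2 => by
      rw [iteratedFDerivWithin_of_isOpen i ho hx]
      exact hD i h1 h2)
  rw [iteratedFDerivWithin_of_isOpen n ho hx, mul_one] at h1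
  exact h1

theorem norm_partialDeriv_le (m : E d → ℂ) {n : ℕ} (i : Fin n → Fin d) (ξ : E d) :
    ‖partialDeriv m i ξ‖ ≤ ‖iteratedFDeriv ℝ n m ξ‖ := by
  refine (ContinuousMultilinearMap.le_opNorm _ _).trans_eq ?_
  simp

/-- The derivatives of the phase are `O(|ξ|^{α-k})`. For `k ≥ 1` this is at most `|ξ|^{(α-1)k}` when
`|ξ| ≥ 1`, and at most `|ξ|^{-k}` when `|ξ| < 1`, which allows `a = b = 0`. -/
theorem twoSidedMiyachi_oscillatorySymbol {α : ℝ} (hα : 0 < α) :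
    TwoSidedMiyachi α 0 0 0 (oscillatorySymbol α : E d → ℂ) := by
  choose C hC using fun n : ℕ => exists_norm_iteratedFDeriv_norm_rpow_le (d := d) α n
  refine ⟨(d : ℝ) / 2 + 1, by linarith, ?_, ?_⟩
  · intro x hx
    have h1 : ContDiffAt ℝ ((⌊(d : ℝ) / 2 + 1⌋₊ : ℕ) : ℕ∞)
        (fun s : ℝ => Complex.exp ((s : ℂ) * Complex.I)) (‖x‖ ^ α) :=
      (hasTemperateGrowth_cexp_mul_I.1.of_le (by exact_mod_cast le_top)).contDiffAt
    exact (h1.comp x (contDiffAt_norm_rpow hx α _)).contDiffWithinAt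
  set n₀ := ⌊(d : ℝ) / 2 + 1⌋₊
  -- The composition bound needs the form `D ^ i`; as `K ≥ 1` dominates every `C i`, so does `K ^ i`
  -- for `i ≥ 1`.
  set K := 1 + ∑ i ∈ Finset.range (n₀ + 1), |C i| with hK
  have hS : 0 ≤ ∑ i ∈ Finset.range (n₀ + 1), |C i| := Finset.sum_nonneg fun _ _ => abs_nonneg _
  have hK1 : 1 ≤ K := le_add_of_nonneg_right hS
  have hCK : ∀ i, 1 ≤ i → i ≤ n₀ → C i ≤ K ^ i := by
    intro i h1 hi
    have h2 : |C i| ≤ ∑ i ∈ Finset.range (n₀ + 1), |C i| :=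
      Finset.single_le_sum (f := fun i => |C i|) (fun _ _ => abs_nonneg _)
        (Finset.mem_range.mpr (Nat.lt_succ_of_le hi))
    exact (le_abs_self _).trans (h2.trans ((le_add_of_nonneg_left zero_le_one).trans
      (le_self_pow₀ hK1 (by omega))))
  have main : ∀ n ≤ n₀, ∀ (i : Fin n → Fin d) (ξ : E d), ξ ≠ 0 → ∀ γ : ℝ,
      (∀ k : ℕ, 1 ≤ k → ‖ξ‖ ^ (α - k) ≤ ‖ξ‖ ^ (γ * k)) →
      ‖partialDeriv (oscillatorySymbol α) i ξ‖ ≤ n₀.factorial * K ^ n₀ * ‖ξ‖ ^ (γ * n) := by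
    intro n hn i ξ hξ γ hγ
    have hξ0 : 0 < ‖ξ‖ := norm_pos_iff.mpr hξ
    refine (norm_partialDeriv_le _ _ _).trans ((norm_iteratedFDeriv_oscillatorySymbol_le
      (D := K * ‖ξ‖ ^ γ) hξ fun k h1 hk => ?_).trans ?_)
    · refine (hC k ξ hξ).trans ?_
      rw [mul_pow, ← Real.rpow_mul_natCast hξ0.le]
      exact mul_le_mul (hCK k h1 (hk.trans hn)) (hγ k h1) (by positivity) (by positivity)
    · rw [mul_pow, ← Real.rpow_mul_natCast hξ0.le, ← mul_assoc]
      gcongr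
  refine ⟨n₀.factorial * K ^ n₀, fun n hn i ξ => ⟨fun hξ => ?_, fun hξ0 hξ => ?_⟩⟩
  · rw [neg_zero, zero_add]
    refine main n hn i ξ (norm_pos_iff.mp (one_pos.trans_le hξ)) _ fun k hk => ?_
    refine Real.rpow_le_rpow_of_exponent_le hξ ?_
    have hk' : (1 : ℝ) ≤ k := by exact_mod_cast hk
    nlinarith
  · rw [neg_zero, zero_add]
    refine main n hn i ξ (norm_pos_iff.mp hξ0) _ fun k _ => ?_
    exact Real.rpow_le_rpow_of_exponent_ge hξ0 hξ.le (by linarith)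

theorem boundedNearOrigin_oscillatorySymbol (α : ℝ) :
    BoundedNearOrigin (oscillatorySymbol α : E d → ℂ) :=
  ⟨1, fun _ _ _ => (Complex.norm_exp_ofReal_mul_I _).le⟩

end

end Subdyadic

end

/-! ### The theorem -/

open Subdyadic
theorem theorem5p4 (d : ℕ) (hd : 1 ≤ d) (α : ℝ) (hα : 0 < α)
    (φ : 𝓢(E d, ℂ)) (Ω : PhaseLattice d) (hadm : IsAdmissiblePair α φ Ω) :
    (∀ (m : E d → ℂ) (β₀ a b : ℝ), TwoSidedMiyachi α β₀ a b m → BoundedNearOrigin m →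
      ∀ β : ℝ, MultiplierBounded α φ Ω m (β - β₀) β) ∧
    (∀ (m : E d → ℂ) (a b : ℝ), TwoSidedMiyachi α 0 a b m → BoundedNearOrigin m →
      ∀ β : ℝ, MultiplierBounded α φ Ω m β β) ∧
    ((∃ a b : ℝ, TwoSidedMiyachi α 0 a b (oscillatorySymbol α : E d → ℂ)) ∧
      BoundedNearOrigin (oscillatorySymbol α : E d → ℂ) ∧
      ∀ β : ℝ, MultiplierBounded α φ Ω (oscillatorySymbol α) β β) := by
  have h0 : ∀ (m : E d → ℂ) (a b : ℝ), TwoSidedMiyachi α 0 a b m → BoundedNearOrigin m →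
      ∀ β : ℝ, MultiplierBounded α φ Ω m β β := by
    intro m a b hm hm' β
    have h := multiplierBounded hd hα hadm hm hm' β
    rwa [sub_zero] at h
  have hosc := twoSidedMiyachi_oscillatorySymbol (d := d) hα
  have hosc' := boundedNearOrigin_oscillatorySymbol (d := d) α
  exact ⟨fun m β₀ a b hm hm' β => multiplierBounded hd hα hadm hm hm' β, h0,
    ⟨0, 0, hosc⟩, hosc', h0 _ 0 0 hosc hosc'⟩
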